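/- An instance of the Multi-Round Matching problem (MRM) consists of a bipartite compatibility graph $G(X,Y,E)$ with agents $X=\{x_1,\dots,x_n\}$ and resources $Y=\{y_1,\dots,y_m\}$, a number $k$ of rounds, and, for each agent $x_i$, a set $K_i\subseteq\{1,\dots,k\}$ of permissible rounds and a number $\rho_i\le|K_i|$. A $k$-round matching is a sequence $M_1,\dots,M_k$ of matchings of $G$. It satisfies the agent $x_i$ if $x_i$ is matched in (at least) $\rho_i$ rounds belonging to $K_i$. The problem is to find a $k$-round matching that satisfies all the agents, or to report that there is none. Instances are encoded as bit strings: $n$, $m$ and $k$ in unary, the $n\times m$ incidence matrix of $G$, and, for each agent $x_i$, the characteristic vector of $K_i$ and $\rho_i$ in unary. A $k$-round matching is encoded by the incidence matrices of $M_1,\dots,M_k$. **Proposition.** MRM can be solved in polynomial time: there is a deterministic (multi-stack) Turing machine which, on every instance of MRM, halts within a number of steps that is polynomial in the length of the encoded instance, and which outputs a $k$-round matching satisfying all the agents if one exists, and reports that there is none otherwise. Moreover, in the $k$-round matching that it outputs, every agent $x_i$ is matched in exactly $\rho_i$ rounds, all of them in $K_i$. -/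

import Mathlib

/-- An instance of the Multi-Round Matching problem: a bipartite compatibility graph with agents
`Fin n`, resources `Fin m` and edge set `E`; the number `k` of rounds (the rounds are `Fin k`);
for each agent `i`, its set `K i` of permissible rounds and the number `ρ i ≤ |K i|` of rounds
in which it wants to be matched. -/
structure MRMInstance where
  /-- number of agents -/
  n : ℕ
  /-- number of resources -/
  m : ℕ
  /-- number of rounds -/
  k : ℕ
  /-- edges of the compatibility graph -/
  E : Finset (Fin n × Fin m)
  /-- permissible rounds of each agent -/
  K : Fin n → Finset (Fin k)
  /-- desired number of rounds of each agent -/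
  ρ : Fin n → ℕ
  ρ_le : ∀ i, ρ i ≤ (K i).card

/-- A `k`-round matching: one matching of the compatibility graph for each of the `k` rounds. -/
@[ext]
structure KRoundMatching (I : MRMInstance) where
  /-- the set of edges used in each round -/
  edges : Fin I.k → Finset (Fin I.n × Fin I.m)
  edges_subset : ∀ h, edges h ⊆ I.E
  agent_unique : ∀ h i j j', (i, j) ∈ edges h → (i, j') ∈ edges h → j = j'
  resource_unique : ∀ h i i' j, (i, j) ∈ edges h → (i', j) ∈ edges h → i = i'

namespace KRoundMatching

/-- The set of rounds in which agent `i` is matched to some resource. -/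
def rounds {I : MRMInstance} (M : KRoundMatching I) (i : Fin I.n) : Finset (Fin I.k) :=
  Finset.univ.filter fun h => ∃ j, (i, j) ∈ M.edges h

/-- Agent `i` is satisfied: it is matched in (at least) `ρ i` rounds belonging to `K i`. -/
def Satisfies {I : MRMInstance} (M : KRoundMatching I) (i : Fin I.n) : Prop :=
  I.ρ i ≤ (M.rounds i ∩ I.K i).card

end KRoundMatching

/-- A natural number as a self-delimiting bit string: `n` ones followed by a zero. -/
def encodeUnary (n : ℕ) : List Bool :=
  Computability.unaryEncodeNat n ++ [false]

/-- A subset of `Fin a` as its bit vector of length `a`. -/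
def encodeSet {a : ℕ} (s : Finset (Fin a)) : List Bool :=
  List.ofFn fun i => decide (i ∈ s)

/-- A subset of `Fin a × Fin b` as its `a` by `b` incidence matrix, row by row. -/
def encodeMatrix {a b : ℕ} (s : Finset (Fin a × Fin b)) : List Bool :=
  (List.ofFn fun i => List.ofFn fun j => decide ((i, j) ∈ s)).flatten

/-- The encoding of an instance: `n`, `m`, `k` in unary, the `n` by `m` matrix of the compatibility
graph, and for each agent `i` the bit vector of `K i` followed by `ρ i` in unary. -/
def MRMInstance.encode (I : MRMInstance) : List Bool :=
  encodeUnary I.n ++ (encodeUnary I.m ++ (encodeUnary I.k ++ (encodeMatrix I.E ++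
    (List.ofFn fun i => encodeSet (I.K i) ++ encodeUnary (I.ρ i)).flatten)))

/-- The encoding of an answer: a single `0` for "there is no solution", and a `1` followed by the
`k` incidence matrices of the matchings `M₁, …, M_k` for a solution. -/
def encodeAnswer {I : MRMInstance} : Option (KRoundMatching I) → List Bool
  | none => [false]
  | some M => true :: (List.ofFn fun h => encodeMatrix (M.edges h)).flatten

/-! The encodings are injective, i.e. instances and answers can be read off from their codes. -/

theorem encodeUnary_append_inj : ∀ {a b : ℕ} {l l' : List Bool},
    encodeUnary a ++ l = encodeUnary b ++ l' → a = b ∧ l = l'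
  | 0, 0, l, l', h => by simpa [encodeUnary, Computability.unaryEncodeNat] using h
  | 0, b + 1, l, l', h => by simp [encodeUnary, Computability.unaryEncodeNat] at h
  | a + 1, 0, l, l', h => by simp [encodeUnary, Computability.unaryEncodeNat] at h
  | a + 1, b + 1, l, l', h => by
    have h' : encodeUnary a ++ l = encodeUnary b ++ l' := by
      simpa [encodeUnary, Computability.unaryEncodeNat] using h
    obtain ⟨h1, h2⟩ := encodeUnary_append_inj h'
    exact ⟨by rw [h1], h2⟩

/-- Concatenations of codes that can each be split off from the left can be split as well. -/
theorem flatten_ofFn_append_inj {α : Type} {c : α → List Bool}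
    (hc : ∀ {x y : α} {l l' : List Bool}, c x ++ l = c y ++ l' → x = y ∧ l = l') :
    ∀ {a : ℕ} {f g : Fin a → α} {l l' : List Bool},
      (List.ofFn fun i => c (f i)).flatten ++ l = (List.ofFn fun i => c (g i)).flatten ++ l' →
      f = g ∧ l = l'
  | 0, f, g, l, l', h => ⟨Subsingleton.elim _ _, by simpa using h⟩
  | a + 1, f, g, l, l', h => by
    simp only [List.ofFn_succ, List.flatten_cons, List.append_assoc] at h
    obtain ⟨h0, h1⟩ := hc h
    obtain ⟨h2, h3⟩ := flatten_ofFn_append_inj hc (f := fun i => f i.succ)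
      (g := fun i => g i.succ) h1
    refine ⟨funext fun i => ?_, h3⟩
    refine Fin.cases h0 (fun i => congrFun h2 i) i

theorem encodeSet_append_inj {a : ℕ} {s t : Finset (Fin a)} {l l' : List Bool}
    (h : encodeSet s ++ l = encodeSet t ++ l') : s = t ∧ l = l' := by
  obtain ⟨h1, h2⟩ := List.append_inj h (by simp [encodeSet])
  refine ⟨Finset.ext fun i => ?_, h2⟩
  simpa using congrFun (List.ofFn_injective h1) i

theorem encodeMatrix_append_inj {a b : ℕ} {s t : Finset (Fin a × Fin b)} {l l' : List Bool}
    (h : encodeMatrix s ++ l = encodeMatrix t ++ l') : s = t ∧ l = l' := by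
  obtain ⟨h1, h2⟩ := flatten_ofFn_append_inj (α := Fin b → Bool) (c := List.ofFn)
    (fun {x y l l'} h => by
      obtain ⟨h1, h2⟩ := List.append_inj h (by simp)
      exact ⟨List.ofFn_injective h1, h2⟩)
    (f := fun i j => decide ((i, j) ∈ s)) (g := fun i j => decide ((i, j) ∈ t)) h
  refine ⟨Finset.ext fun p => ?_, h2⟩
  simpa using congrFun (congrFun h1 p.1) p.2

theorem MRMInstance.encode_injective : Function.Injective MRMInstance.encode := by
  rintro ⟨n, m, k, E, K, ρ, hρ⟩ ⟨n', m', k', E', K', ρ', hρ'⟩ h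
  simp only [MRMInstance.encode] at h
  obtain ⟨rfl, h⟩ := encodeUnary_append_inj h
  obtain ⟨rfl, h⟩ := encodeUnary_append_inj h
  obtain ⟨rfl, h⟩ := encodeUnary_append_inj h
  obtain ⟨rfl, hl⟩ := encodeMatrix_append_inj h
  obtain ⟨hf, -⟩ := flatten_ofFn_append_inj (α := Finset (Fin k) × ℕ)
    (c := fun p => encodeSet p.1 ++ encodeUnary p.2)
    (fun {x y l l'} h => by
      simp only [List.append_assoc] at h
      obtain ⟨h1, h⟩ := encodeSet_append_inj h
      obtain ⟨h2, h⟩ := encodeUnary_append_inj h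
      exact ⟨Prod.ext h1 h2, h⟩)
    (f := fun i => (K i, ρ i)) (g := fun i => (K' i, ρ' i)) (l := []) (l' := []) (by rw [hl])
  obtain rfl : K = K' := funext fun i => congrArg Prod.fst (congrFun hf i)
  obtain rfl : ρ = ρ' := funext fun i => congrArg Prod.snd (congrFun hf i)
  rfl

theorem encodeAnswer_injective (I : MRMInstance) :
    Function.Injective (encodeAnswer (I := I)) := by
  rintro (_ | M) (_ | M') h
  · rfl
  · simp [encodeAnswer] at h
  · simp [encodeAnswer] at h
  · simp only [encodeAnswer, List.cons.injEq, true_and] at h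
    obtain ⟨h, -⟩ := flatten_ofFn_append_inj (c := encodeMatrix) encodeMatrix_append_inj
      (f := M.edges) (g := M'.edges) (l := []) (l' := []) (by rw [h])
    exact congrArg some (KRoundMatching.ext h)

/-!
A `k`-round matching that satisfies all the agents is a complete matching in an auxiliary bipartite
graph. Its left vertices are the pairs `(i, h)` of an agent `i` and a round `h ∈ K i`. Its right
vertices are the pairs of a resource and a round, where `(i, h)` is adjacent to `(j, h)` if `i` and
`j` are compatible, and in addition `|K i| - ρ i` vertices for each agent `i`, adjacent to all the
left vertices of `i`. The additional vertices of `i` absorb the permissible rounds in which `i` is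
not matched to a resource (`MRM.exists_complete_matching`). If they are all matched, and all the
left vertices too, then `i` is matched to a resource in exactly `ρ i` rounds
(`MRM.toMatching_spec`).

The matching is found by price increases. Every right vertex has a price, initially zero. An
unmatched left vertex is matched to a neighbour of least price, whose former partner becomes
unmatched and whose price grows by one. This preserves the invariants `PriceInv`
(`PriceInv.step`): vertices with positive price are matched, no partner is dearer by more than
one than another neighbour, and right vertices that are matched remain so. The last property makes
it possible to start with the additional vertices matched, so that they are matched in the end.
Prices are bounded by a number `N` that exceeds the number of left vertices, and when all the
neighbours of an unmatched left vertex have the price `N`, counting the partners above each price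
shows that there is no complete matching (`PriceInv.not_exists_matching`). The sum of the prices is
at most `N ^ 3`, as there are at most `N ^ 2` right vertices, hence `N ^ 4` passes through the left
vertices suffice (`MRM.matching_spec`).

Running times are never computed for this particular algorithm. It is written as an `ArrProg`, a
program with Boolean arrays, case distinctions, and loops that run through `0, …, N - 1`, where `N`
is the length of the input. Every such program runs in polynomial time: it is compiled into a
structured stack program (`ArrProg.execLE_compile`), which keeps each array on one stack and the
loop counters in unary on others, and whose control points become the labels of a multi-stack
Turing machine (`StackProg.polyTime_of_execLE`). The result is `ArrProg.polyTime`. It remains to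
verify the output of the array program, which is done in `MRM.exists_answer`.
-/

/-! ### Structured stack programs and their Turing machines -/

/-- Structured programs that act on a family of stacks of bits indexed by `κ`. -/
inductive StackProg (κ : Type) : Type
  /-- do nothing -/
  | skip : StackProg κ
  /-- push the bit `b` onto the stack `k` -/
  | push (k : κ) (b : Bool) : StackProg κ
  /-- remove the top of the stack `k`, if there is one -/
  | pop (k : κ) : StackProg κ
  /-- sequential composition -/
  | seq (c d : StackProg κ) : StackProg κ
  /-- case distinction: the stack `k` is empty, has top `false`, has top `true` -/
  | branch (k : κ) (e f t : StackProg κ) : StackProg κ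
  /-- repeat `c` as long as the stack `k` is not empty -/
  | repeatWhile (k : κ) (c : StackProg κ) : StackProg κ

namespace StackProg

variable {κ : Type}

/-- The control points of a program. -/
def Label : StackProg κ → Type
  | skip => Unit
  | push _ _ => Unit
  | pop _ => Unit
  | seq c d => c.Label ⊕ d.Label
  | branch _ e f t => Option (e.Label ⊕ f.Label ⊕ t.Label)
  | repeatWhile _ c => Option c.Label

/-- A program has finitely many control points. -/
@[reducible]
def fintypeLabel : (c : StackProg κ) → Fintype c.Label
  | skip => inferInstanceAs (Fintype Unit)
  | push _ _ => inferInstanceAs (Fintype Unit)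
  | pop _ => inferInstanceAs (Fintype Unit)
  | seq c d =>
    letI := fintypeLabel c; letI := fintypeLabel d
    inferInstanceAs (Fintype (c.Label ⊕ d.Label))
  | branch _ e f t =>
    letI := fintypeLabel e; letI := fintypeLabel f; letI := fintypeLabel t
    inferInstanceAs (Fintype (Option (e.Label ⊕ f.Label ⊕ t.Label)))
  | repeatWhile _ c =>
    letI := fintypeLabel c
    inferInstanceAs (Fintype (Option c.Label))

/-- The control point at which a program starts. -/
def entry : (c : StackProg κ) → c.Label
  | skip => ()
  | push _ _ => ()
  | pop _ => ()
  | seq c _ => Sum.inl c.entry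
  | branch _ _ _ _ => (none : Option _)
  | repeatWhile _ _ => (none : Option _)

/-- The machine statements of a program whose control points are embedded by `emb` into the labels
of a larger machine, and which leaves for the label `exit`. The internal state of the machine is
`none` at every control point; it holds the top of a stack only during a case distinction. -/
def code {Λ : Type} : (c : StackProg κ) → (c.Label → Λ) → Λ → c.Label →
    Turing.TM2.Stmt (fun _ : κ => Bool) Λ (Option Bool)
  | skip, _, exit, _ => .goto fun _ => exit
  | push k b, _, exit, _ => .push k (fun _ => b) (.goto fun _ => exit)
  | pop k, _, exit, _ => .pop k (fun s _ => s) (.goto fun _ => exit)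
  | seq c d, emb, exit, l =>
    match (l : c.Label ⊕ d.Label) with
    | .inl l => code c (fun l => emb (Sum.inl l)) (emb (Sum.inr d.entry)) l
    | .inr l => code d (fun l => emb (Sum.inr l)) exit l
  | branch k e f t, emb, exit, l =>
    match (l : Option (e.Label ⊕ f.Label ⊕ t.Label)) with
    | none => .peek k (fun _ o => o) (.branch (fun o => o.isNone)
        (.load (fun _ => none) (.goto fun _ => emb (some (Sum.inl e.entry))))
        (.branch (fun o => o == some false)
          (.load (fun _ => none) (.goto fun _ => emb (some (Sum.inr (Sum.inl f.entry)))))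
          (.load (fun _ => none) (.goto fun _ => emb (some (Sum.inr (Sum.inr t.entry)))))))
    | some (.inl l) => code e (fun l => emb (some (Sum.inl l))) exit l
    | some (.inr (.inl l)) => code f (fun l => emb (some (Sum.inr (Sum.inl l)))) exit l
    | some (.inr (.inr l)) => code t (fun l => emb (some (Sum.inr (Sum.inr l)))) exit l
  | repeatWhile k c, emb, exit, l =>
    match (l : Option c.Label) with
    | none => .peek k (fun _ o => o) (.branch (fun o => o.isNone)
        (.load (fun _ => none) (.goto fun _ => exit))
        (.load (fun _ => none) (.goto fun _ => emb (some c.entry))))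
    | some l => code c (fun l => emb (some l)) (emb none) l

variable [DecidableEq κ]

/-- `Exec c S S' n`: started on the stacks `S`, the program `c` stops with the stacks `S'` after
`n` machine steps. -/
inductive Exec : StackProg κ → (κ → List Bool) → (κ → List Bool) → ℕ → Prop
  | skip (S) : Exec skip S S 1
  | push (k b S) : Exec (push k b) S (Function.update S k (b :: S k)) 1
  | pop (k S) : Exec (pop k) S (Function.update S k (S k).tail) 1
  | seq {c d S S' S'' m n} : Exec c S S' m → Exec d S' S'' n → Exec (seq c d) S S'' (m + n)
  | branch_nil {k e f t S S' n} : S k = [] → Exec e S S' n → Exec (branch k e f t) S S' (1 + n)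
  | branch_false {k e f t S S' n} (l : List Bool) : S k = false :: l → Exec f S S' n →
      Exec (branch k e f t) S S' (1 + n)
  | branch_true {k e f t S S' n} (l : List Bool) : S k = true :: l → Exec t S S' n →
      Exec (branch k e f t) S S' (1 + n)
  | while_nil {k c S} : S k = [] → Exec (repeatWhile k c) S S 1
  | while_cons {k c S S' S'' m n} : S k ≠ [] → Exec c S S' m → Exec (repeatWhile k c) S' S'' n →
      Exec (repeatWhile k c) S S'' (1 + (m + n))

/-- The machine `M` goes in `n` steps from the label `l` and stacks `S` to `l'` and `S'`. -/
def Steps {Λ : Type} (M : Λ → Turing.TM2.Stmt (fun _ : κ => Bool) Λ (Option Bool)) (n : ℕ)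
    (l : Λ) (S : κ → List Bool) (l' : Λ) (S' : κ → List Bool) : Prop :=
  (flip bind (Turing.TM2.step M))^[n]
    (some (⟨some l, none, S⟩ : Turing.TM2.Cfg (fun _ : κ => Bool) Λ (Option Bool))) =
    some ⟨some l', none, S'⟩

theorem Steps.trans {Λ : Type} {M : Λ → Turing.TM2.Stmt (fun _ : κ => Bool) Λ (Option Bool)}
    {m n : ℕ} {l l' l'' : Λ} {S S' S'' : κ → List Bool} (h : Steps M m l S l' S')
    (h' : Steps M n l' S' l'' S'') : Steps M (m + n) l S l'' S'' := by
  unfold Steps at *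
  rw [Nat.add_comm, Function.iterate_add_apply, h, h']

theorem Steps.one {Λ : Type} {M : Λ → Turing.TM2.Stmt (fun _ : κ => Bool) Λ (Option Bool)}
    {l l' : Λ} {S S' : κ → List Bool}
    (h : Turing.TM2.stepAux (M l) none S = ⟨some l', none, S'⟩) : Steps M 1 l S l' S' := by
  simp [Steps, flip, Turing.TM2.step, h]

/-- A machine that contains the statements of a program follows its executions. -/
theorem Exec.steps {c : StackProg κ} {S S' : κ → List Bool} {n : ℕ} (h : Exec c S S' n)
    {Λ : Type} {M : Λ → Turing.TM2.Stmt (fun _ : κ => Bool) Λ (Option Bool)}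
    {emb : c.Label → Λ} {exit : Λ} (hM : ∀ l, M (emb l) = code c emb exit l) :
    Steps M n (emb c.entry) S exit S' := by
  induction h generalizing exit with
  | skip S => exact .one (by rw [hM]; simp [code])
  | push k b S => exact .one (by rw [hM]; simp [code])
  | pop k S => exact .one (by rw [hM]; simp [code])
  | seq _ _ ih₁ ih₂ =>
    exact (ih₁ (emb := fun l => emb (Sum.inl l)) fun l => hM (Sum.inl l)).trans
      (ih₂ (emb := fun l => emb (Sum.inr l)) fun l => hM (Sum.inr l))
  | branch_nil hk _ ih =>
    refine (Steps.one ?_).trans (ih (emb := fun l => emb (some (Sum.inl l)))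
      fun l => hM (some (Sum.inl l)))
    rw [hM]; simp [code, entry, hk]
  | branch_false l hk _ ih =>
    refine (Steps.one ?_).trans (ih (emb := fun l => emb (some (Sum.inr (Sum.inl l))))
      fun l => hM (some (Sum.inr (Sum.inl l))))
    rw [hM]; simp [code, entry, hk]
  | branch_true l hk _ ih =>
    refine (Steps.one ?_).trans (ih (emb := fun l => emb (some (Sum.inr (Sum.inr l))))
      fun l => hM (some (Sum.inr (Sum.inr l))))
    rw [hM]; simp [code, entry, hk]
  | while_nil hk => exact .one (by rw [hM]; simp [code, entry, hk])
  | @while_cons k c S _ _ _ _ hk _ _ ih₁ ih₂ =>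
    obtain ⟨x, l, hl⟩ := List.exists_cons_of_ne_nil hk
    refine (Steps.one (l' := emb (some c.entry)) (S' := S) ?_).trans
      ((ih₁ (emb := fun l => emb (some l)) fun l => hM (some l)).trans (ih₂ hM))
    rw [hM]; simp [code, entry, hl]

/-- `ExecLE c S S' B`: started on `S`, the program `c` stops with `S'` after at most `B` steps. -/
def ExecLE (c : StackProg κ) (S S' : κ → List Bool) (B : ℕ) : Prop :=
  ∃ n ≤ B, Exec c S S' n

theorem ExecLE.mono {c : StackProg κ} {S S' : κ → List Bool} {B B' : ℕ} (h : ExecLE c S S' B)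
    (hB : B ≤ B') : ExecLE c S S' B' :=
  let ⟨n, hn, h⟩ := h; ⟨n, hn.trans hB, h⟩

theorem ExecLE.seq {c d : StackProg κ} {S S' S'' : κ → List Bool} {B B' : ℕ}
    (h : ExecLE c S S' B) (h' : ExecLE d S' S'' B') : ExecLE (c.seq d) S S'' (B + B') :=
  let ⟨_, hn, h⟩ := h; let ⟨_, hn', h'⟩ := h'; ⟨_, Nat.add_le_add hn hn', h.seq h'⟩

theorem execLE_skip (S : κ → List Bool) : ExecLE skip S S 1 := ⟨1, le_rfl, .skip S⟩

theorem execLE_push {k : κ} {b : Bool} {S S' : κ → List Bool}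
    (h : S' = Function.update S k (b :: S k)) : ExecLE (push k b) S S' 1 :=
  ⟨1, le_rfl, h ▸ .push k b S⟩

theorem execLE_pop {k : κ} {S S' : κ → List Bool} (h : S' = Function.update S k (S k).tail) :
    ExecLE (pop k) S S' 1 :=
  ⟨1, le_rfl, h ▸ .pop k S⟩

theorem execLE_branch_nil {k : κ} {e f t : StackProg κ} {S S' : κ → List Bool} {B : ℕ}
    (hk : S k = []) (h : ExecLE e S S' B) : ExecLE (branch k e f t) S S' (1 + B) :=
  let ⟨_, hn, h⟩ := h; ⟨_, Nat.add_le_add_left hn 1, .branch_nil hk h⟩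

theorem execLE_branch_cons {k : κ} {e f t : StackProg κ} {S S' : κ → List Bool} {B : ℕ} {b : Bool}
    {l : List Bool} (hk : S k = b :: l) (h : ExecLE (if b then t else f) S S' B) :
    ExecLE (branch k e f t) S S' (1 + B) := by
  obtain ⟨n, hn, h⟩ := h
  cases b
  · exact ⟨_, Nat.add_le_add_left hn 1, .branch_false l hk h⟩
  · exact ⟨_, Nat.add_le_add_left hn 1, .branch_true l hk h⟩

/-- A loop that is controlled by the stack `k` passes through the stacks `T 0, …, T n` if `k` is
nonempty in all of them but the last. -/
theorem execLE_while {k : κ} {c : StackProg κ} {B : ℕ} (n : ℕ) (T : ℕ → κ → List Bool)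
    (h : ∀ i < n, T i k ≠ [] ∧ ExecLE c (T i) (T (i + 1)) B) (hn : T n k = []) :
    ExecLE (repeatWhile k c) (T 0) (T n) (n * (B + 1) + 1) := by
  induction n generalizing T with
  | zero => exact ⟨1, by simp, .while_nil hn⟩
  | succ n ih =>
    obtain ⟨hk, m, hm, h0⟩ := h 0 n.succ_pos
    obtain ⟨m', hm', h'⟩ := ih (fun i => T (i + 1)) (fun i hi => h (i + 1) (by omega)) hn
    exact ⟨_, by rw [Nat.succ_mul]; omega, .while_cons hk h0 h'⟩

/-- The machine that runs `c` and then halts, reading its input from the stack `inp` and leaving its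
output on the stack `out`. -/
def machine [Fintype κ] (c : StackProg κ) (inp out : κ) : Turing.FinTM2 :=
  letI := c.fintypeLabel
  { K := κ
    k₀ := inp
    k₁ := out
    Γ := fun _ => Bool
    Λ := Option c.Label
    main := some c.entry
    σ := Option Bool
    initialState := none
    m := fun l => l.elim .halt (code c some none) }

theorem initList_machine [Fintype κ] (c : StackProg κ) (inp out : κ) (l : List Bool) :
    Turing.initList (c.machine inp out) l =
      (⟨some (some c.entry), none, Function.update (fun _ => []) inp l⟩ :
        Turing.TM2.Cfg (fun _ : κ => Bool) (Option c.Label) (Option Bool)) := by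
  refine congrArg (Turing.TM2.Cfg.mk (some (some c.entry)) none) (funext fun (k : κ) => ?_)
  by_cases hk : k = inp
  · subst hk
    exact (dif_pos rfl).trans (Function.update_self (β := fun _ => List Bool) k l _).symm
  · exact (dif_neg hk).trans (Function.update_of_ne (β := fun _ => List Bool) hk l fun _ => []).symm

theorem haltList_machine [Fintype κ] (c : StackProg κ) (inp out : κ) (l : List Bool) :
    Turing.haltList (c.machine inp out) l =
      (⟨none, none, Function.update (fun _ => []) out l⟩ :
        Turing.TM2.Cfg (fun _ : κ => Bool) (Option c.Label) (Option Bool)) := by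
  refine congrArg (Turing.TM2.Cfg.mk none none) (funext fun (k : κ) => ?_)
  by_cases hk : k = out
  · subst hk
    exact (dif_pos rfl).trans (Function.update_self (β := fun _ => List Bool) k l _).symm
  · exact (dif_neg hk).trans (Function.update_of_ne (β := fun _ => List Bool) hk l fun _ => []).symm

/-- A function that is computed by a stack program in polynomially many steps is computed by a
Turing machine in polynomial time. -/
theorem polyTime_of_execLE [Fintype κ] {α : Type} (enc : α → List Bool) (f : α → List Bool)
    (c : StackProg κ) (inp out : κ) (p : Polynomial ℕ)
    (h : ∀ a, ExecLE c (Function.update (fun _ => []) inp (enc a))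
      (Function.update (fun _ => []) out (f a)) (p.eval (enc a).length)) :
    Nonempty (Turing.TM2ComputableInPolyTime enc (id : List Bool → List Bool) f) := by
  choose n hn hex using h
  -- one additional step executes the halting statement
  refine ⟨{
    tm := c.machine inp out
    inputAlphabet := Equiv.refl _
    outputAlphabet := Equiv.refl _
    time := p + 1
    outputsFun := fun a => ⟨⟨n a + 1, ?_⟩, by simpa using hn a⟩ }⟩
  have hst := (hex a).steps (M := (c.machine inp out).m) (emb := some) (exit := none) fun l => rfl
  have hid : ∀ l : List Bool, List.map (Equiv.refl Bool).invFun l = l := fun l => by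
    simp [Equiv.refl]
  have hin := initList_machine c inp out (enc a)
  have hout := haltList_machine c inp out (f a)
  refine (congrArg (fun l => (flip bind (c.machine inp out).step)^[n a + 1]
    (some (Turing.initList (c.machine inp out) l))) (hid (enc a))).trans ?_
  refine Eq.trans ?_ (congrArg (fun l => some (Turing.haltList (c.machine inp out) l))
    (hid (f a))).symm
  rw [Function.iterate_succ_apply', hin, hout]
  exact congrArg (fun o => flip bind (c.machine inp out).step o) hst

end StackProg

/-! ### Array programs -/

/-- Programs that act on Boolean arrays with four indices. The arrays are indexed by the values of
the loop variables, all of which run through `0, …, N - 1`. -/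
inductive ArrProg (A V : Type) : Type
  /-- do nothing -/
  | skip : ArrProg A V
  /-- set the entry of the array `a` at the position `x` to `b` -/
  | set (a : A) (x : V × V × V × V) (b : Bool) : ArrProg A V
  /-- execute `p` or `q` according to the entry of the array `a` at the position `x` -/
  | ite (a : A) (x : V × V × V × V) (p q : ArrProg A V) : ArrProg A V
  /-- sequential composition -/
  | seq (p q : ArrProg A V) : ArrProg A V
  /-- execute `p` with `v = 0, …, N - 1` -/
  | loop (v : V) (p : ArrProg A V) : ArrProg A V
  /-- move the next bit of the input into the array `a` at the position `x` -/
  | read (a : A) (x : V × V × V × V) : ArrProg A V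
  /-- append the bit `b` to the output -/
  | write (b : Bool) : ArrProg A V

namespace ArrProg

variable {A V : Type}

/-- The contents of the arrays, the input that has not been read, and the output. -/
structure State (A : Type) where
  /-- the entries of the arrays -/
  mem : A × ℕ × ℕ × ℕ × ℕ → Bool
  /-- the unread input -/
  inp : List Bool
  /-- the output written up to now -/
  out : List Bool

/-- The value of an index tuple. -/
def key (env : V → ℕ) (x : V × V × V × V) : ℕ × ℕ × ℕ × ℕ :=
  (env x.1, env x.2.1, env x.2.2.1, env x.2.2.2)

/-- Store a bit. -/
def State.put [DecidableEq A] (s : State A) (a : A) (k : ℕ × ℕ × ℕ × ℕ) (b : Bool) : State A :=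
  { s with mem := Function.update s.mem (a, k) b }

variable [DecidableEq A] [DecidableEq V]

/-- The semantics of array programs. -/
def run (N : ℕ) : ArrProg A V → (V → ℕ) → State A → State A
  | skip, _, s => s
  | set a x b, env, s => s.put a (key env x) b
  | ite a x p q, env, s => if s.mem (a, key env x) then run N p env s else run N q env s
  | seq p q, env, s => run N q env (run N p env s)
  | loop v p, env, s =>
    (List.range N).foldl (fun s i => run N p (Function.update env v i) s) s
  | read a x, env, s =>
    { mem := Function.update s.mem (a, key env x) (s.inp.headD false)
      inp := s.inp.tail
      out := s.out }
  | write b, _, s => { s with out := s.out ++ [b] }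

/-- No loop rebinds a variable that is bound already. The value of a bound variable is stored only
once, hence an inner loop would destroy it. -/
def WF : List V → ArrProg A V → Bool
  | _, skip => true
  | _, set _ _ _ => true
  | bd, ite _ _ p q => WF bd p && WF bd q
  | bd, seq p q => WF bd p && WF bd q
  | bd, loop v p => !(v ∈ bd) && WF (v :: bd) p
  | _, read _ _ => true
  | _, write _ => true

end ArrProg

/-! ### Compilation of array programs into stack programs -/

/-- The stacks that are used for the execution of an array program. -/
inductive Stk (A V : Type) : Type
  /-- the input -/
  | inp : Stk A V
  /-- the output -/
  | out : Stk A V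
  /-- the reversed output -/
  | buf : Stk A V
  /-- the reversal of an initial segment of an array -/
  | tmp : Stk A V
  /-- units taken from another stack -/
  | sav : Stk A V
  /-- `N` units -/
  | cnt (e : Fin 4) : Stk A V
  /-- units taken from `cnt e` -/
  | alt (e : Fin 4) : Stk A V
  /-- the value of the variable `v` in unary -/
  | idx (v : V) : Stk A V
  /-- the difference of `N` and the value of the variable `v`, in unary -/
  | rem (v : V) : Stk A V
  /-- the entries of the array `a` in lexicographic order -/
  | arr (a : A) : Stk A V
  deriving DecidableEq, Fintype

namespace StackProg

variable {κ : Type}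

/-- Repeat `c` once for each element of the stack `s`, which is moved to `s'` and back. -/
def forEach (s s' : κ) (c : StackProg κ) : StackProg κ :=
  seq (repeatWhile s (seq (pop s) (seq c (push s' true))))
    (repeatWhile s' (seq (pop s') (push s true)))

/-- Move the top of the stack `s` to `t`. -/
def move (s t : κ) : StackProg κ :=
  branch s skip (seq (pop s) (push t false)) (seq (pop s) (push t true))

/-- Move the stack `s` to `t`, in reversed order. -/
def transfer (s t : κ) : StackProg κ :=
  repeatWhile s (move s t)

/-- Push `b` onto all the stacks in a list. -/
def pushList (b : Bool) : List κ → StackProg κ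
  | [] => skip
  | k :: ks => seq (push k b) (pushList b ks)

/-- Empty all the stacks in a list. -/
def clearList : List κ → StackProg κ
  | [] => skip
  | k :: ks => seq (repeatWhile k (pop k)) (clearList ks)

/-- A bound for the time of `forEach` with `n` repetitions of a program with time bound `B`. -/
def forEachCost (n B : ℕ) : ℕ := n * (B + 3) + 1 + (n * 3 + 1)

theorem forEachCost_mono {n n' B : ℕ} (h : n ≤ n') : forEachCost n B ≤ forEachCost n' B := by
  unfold forEachCost; gcongr

variable [DecidableEq κ]

open Function in
/-- The loop `forEach` passes through the stacks `T 0, …, T n` if its body does so whatever the two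
stacks that control the loop contain. -/
theorem execLE_forEach {s s' : κ} (hs : s ≠ s') {c : StackProg κ} {B n : ℕ}
    (T : ℕ → κ → List Bool)
    (h : ∀ i < n, ∀ x y, ExecLE c (update (update (T i) s x) s' y)
      (update (update (T (i + 1)) s x) s' y) B)
    (h0 : T 0 s = List.replicate n true) (h0' : T 0 s' = [])
    (hn : T n s = List.replicate n true) (hn' : T n s' = []) :
    ExecLE (forEach s s' c) (T 0) (T n) (forEachCost n B) := by
  have e0 : T 0 = update (update (T 0) s (List.replicate (n - 0) true)) s'
      (List.replicate 0 true) := by simp [← h0, ← h0']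
  have en : T n = update (update (T n) s (List.replicate n true)) s'
      (List.replicate (n - n) true) := by simp [← hn, ← hn']
  rw [e0, en]
  refine ExecLE.seq (S' := update (update (T n) s (List.replicate (n - n) true)) s'
      (List.replicate n true)) ?_ ?_
  · refine execLE_while n (fun i => update (update (T i) s (List.replicate (n - i) true)) s'
      (List.replicate i true)) (fun i hi => ?_) (by simp [hs])
    obtain ⟨m, hm⟩ : ∃ m, n - i = m + 1 := ⟨n - i - 1, by omega⟩
    refine ⟨by simp [hs, hm], ?_⟩
    have hm' : n - (i + 1) = m := by omega
    refine ExecLE.mono (ExecLE.seq (execLE_pop rfl) (ExecLE.seq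
      (S' := update (update (T (i + 1)) s (List.replicate m true)) s' (List.replicate i true))
      ?_ (execLE_push ?_))) (B := 1 + (B + 1)) (by omega)
    · convert h i hi (List.replicate m true) (List.replicate i true) using 1
      funext k
      by_cases h1 : k = s
      · subst h1; simp [hs, hm, List.replicate_succ]
      · by_cases h2 : k = s' <;> simp [update_apply, h1, h2, hs.symm]
    · funext k
      by_cases h1 : k = s
      · subst h1; simp [hs, hm']
      · by_cases h2 : k = s' <;> simp [h1, h2, List.replicate_succ]
  · have := execLE_while (k := s') (c := seq (pop s') (push s true)) (B := 2) n
      (fun i => update (update (T n) s (List.replicate i true)) s'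
      (List.replicate (n - i) true)) (fun i hi => ?_) (by simp)
    · simpa using this
    · obtain ⟨m, hm⟩ : ∃ m, n - i = m + 1 := ⟨n - i - 1, by omega⟩
      have hm' : n - (i + 1) = m := by omega
      refine ⟨by simp [hm], ExecLE.seq (execLE_pop rfl) (execLE_push ?_)⟩
      funext k
      by_cases h1 : k = s
      · subst h1; simp [hs, List.replicate_succ]
      · by_cases h2 : k = s' <;> simp [update_apply, h1, h2, hs.symm, hm, hm', List.replicate_succ]

/-- The stacks after `q` elements have been moved from the stack `s` to `t`. -/
def shift (s t : κ) (q : ℕ) (S : κ → List Bool) : κ → List Bool :=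
  Function.update (Function.update S s ((S s).drop q)) t (((S s).take q).reverse ++ S t)

theorem shift_zero {s t : κ} (S : κ → List Bool) : shift s t 0 S = S := by
  simp [shift]

theorem shift_shift {s t : κ} (hs : s ≠ t) (q r : ℕ) (S : κ → List Bool) :
    shift s t r (shift s t q S) = shift s t (q + r) S := by
  funext k
  by_cases h1 : k = s
  · subst h1; simp [shift, hs]
  · by_cases h2 : k = t
    · subst h2; simp [shift, hs, List.take_add]
    · simp [shift, h1, h2]

theorem shift_of_ne {s t k : κ} (hs : k ≠ s) (ht : k ≠ t) (q : ℕ) (S : κ → List Bool) :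
    shift s t q S k = S k := by
  simp [shift, hs, ht]

theorem shift_update {s t k : κ} (hs : k ≠ s) (ht : k ≠ t) (q : ℕ) (S : κ → List Bool)
    (l : List Bool) :
    shift s t q (Function.update S k l) = Function.update (shift s t q S) k l := by
  funext j
  by_cases h0 : j = k
  · subst h0; simp [shift, hs, ht]
  · by_cases h1 : j = s
    · subst h1; simp [shift, h0, Function.update_apply, ht.symm]
    · by_cases h2 : j = t
      · subst h2; simp [shift, h0, hs.symm]
      · simp [shift, h0, h1, h2]

theorem execLE_move {s t : κ} (hs : s ≠ t) (S : κ → List Bool) :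
    ExecLE (move s t) S (shift s t 1 S) 3 := by
  rcases hS : S s with _ | ⟨b, l⟩
  · have : shift s t 1 S = S := by simp [shift, hS]; simp [← hS]
    rw [this]
    exact ExecLE.mono (execLE_branch_nil hS (execLE_skip _)) (by omega)
  · refine execLE_branch_cons (B := 2) hS ?_
    have : ExecLE (seq (pop s) (push t b)) S (shift s t 1 S) 2 :=
      ExecLE.seq (execLE_pop rfl) (execLE_push (by simp [shift, hS, hs.symm]))
    cases b <;> simpa using this

theorem execLE_transfer {s t : κ} (hs : s ≠ t) (S : κ → List Bool) :
    ExecLE (transfer s t) S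
      (Function.update (Function.update S s []) t ((S s).reverse ++ S t))
      ((S s).length * 4 + 1) := by
  have := execLE_while (k := s) (c := move s t) (B := 3) (S s).length (fun i => shift s t i S)
    (fun i hi => ⟨by simp [shift, hs]; omega, ?_⟩) (by simp [shift, hs])
  · simpa [shift_zero, shift, transfer] using this
  · rw [← shift_shift hs]
    exact execLE_move hs _

theorem execLE_pushList {b : Bool} {ks : List κ} (hks : ks.Nodup) (S : κ → List Bool) :
    ExecLE (pushList b ks) S (fun k => if k ∈ ks then b :: S k else S k) (ks.length + 1) := by
  induction ks generalizing S with
  | nil => simpa [pushList] using execLE_skip S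
  | cons j ks ih =>
    rw [List.nodup_cons] at hks
    refine ExecLE.mono (ExecLE.seq (execLE_push rfl) (?_ : ExecLE _ _ _ (ks.length + 1)))
      (by simp; omega)
    convert ih hks.2 _ using 1
    funext k
    by_cases hk : k = j
    · subst hk; simp [hks.1]
    · simp [hk]

theorem execLE_clearList {ks : List κ} (S : κ → List Bool) {X : ℕ}
    (hX : ∀ k, (S k).length ≤ X) :
    ExecLE (clearList ks) S (fun k => if k ∈ ks then [] else S k)
      (ks.length * (X * 2 + 1) + 1) := by
  induction ks generalizing S with
  | nil => simpa [clearList] using execLE_skip S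
  | cons j ks ih =>
    have h1 := execLE_while (k := j) (c := pop j) (B := 1) (S j).length
      (fun i => Function.update S j ((S j).drop i)) (fun i hi => ⟨by simp; omega, ?_⟩) (by simp)
    · refine ExecLE.mono (ExecLE.seq (S' := Function.update S j []) (B := X * 2 + 1)
        (by simpa using h1.mono (Nat.add_le_add_right (Nat.mul_le_mul_right 2 (hX j)) 1))
        (?_ : ExecLE _ _ _ (ks.length * (X * 2 + 1) + 1))) (by simp [Nat.succ_mul]; omega)
      convert ih (Function.update S j []) (fun k => ?_) using 1
      · funext k
        by_cases hk : k = j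
        · subst hk; simp
        · simp [hk]
      · by_cases hk : k = j
        · subst hk; simp
        · simp [hk, hX]
    · exact execLE_pop (by simp)

end StackProg

namespace ArrProg

open StackProg Function

variable {A V : Type}

/-- The position of an index tuple in the lexicographic order. -/
def addr (N : ℕ) (k : ℕ × ℕ × ℕ × ℕ) : ℕ :=
  k.1 * N ^ 3 + k.2.1 * N ^ 2 + k.2.2.1 * N ^ 1 + k.2.2.2 * N ^ 0

/-- The index tuple at a position of the lexicographic order. -/
def tupleAt (N : ℕ) (p : ℕ) : ℕ × ℕ × ℕ × ℕ :=
  (p / N ^ 3, p / N ^ 2 % N, p / N % N, p % N)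

theorem tupleAt_addr {N : ℕ} {k : ℕ × ℕ × ℕ × ℕ} (h2 : k.2.1 < N)
    (h3 : k.2.2.1 < N) (h4 : k.2.2.2 < N) : tupleAt N (addr N k) = k := by
  obtain ⟨a, b, c, d⟩ := k
  simp only at h2 h3 h4
  have hN : 0 < N := by omega
  have e1 : (a * N ^ 3 + b * N ^ 2 + c * N ^ 1 + d * N ^ 0) % N = d := by
    rw [show a * N ^ 3 + b * N ^ 2 + c * N ^ 1 + d * N ^ 0 = d + N * (a * N ^ 2 + b * N + c) by
      ring,
      Nat.add_mul_mod_self_left, Nat.mod_eq_of_lt h4]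
  have e2 : (a * N ^ 3 + b * N ^ 2 + c * N ^ 1 + d * N ^ 0) / N = c + N * (a * N + b) := by
    rw [show a * N ^ 3 + b * N ^ 2 + c * N ^ 1 + d * N ^ 0 = d + N * (a * N ^ 2 + b * N + c) by
      ring,
      Nat.add_mul_div_left _ _ hN, Nat.div_eq_of_lt h4]
    ring
  have e3 : (a * N ^ 3 + b * N ^ 2 + c * N ^ 1 + d * N ^ 0) / N ^ 2 = b + N * a := by
    rw [show N ^ 2 = N * N by ring, ← Nat.div_div_eq_div_mul, ← show N ^ 2 = N * N by ring, e2,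
      Nat.add_mul_div_left _ _ hN, Nat.div_eq_of_lt h3]
    ring
  have e4 : (a * N ^ 3 + b * N ^ 2 + c * N ^ 1 + d * N ^ 0) / N ^ 3 = a := by
    rw [show N ^ 3 = N ^ 2 * N by ring, ← Nat.div_div_eq_div_mul, ← show N ^ 3 = N ^ 2 * N by ring,
      e3, Nat.add_mul_div_left _ _ hN, Nat.div_eq_of_lt h2]
    ring
  simp only [tupleAt, addr, e1, e2, e3, e4, Nat.add_mul_mod_self_left, Nat.mod_eq_of_lt h2,
    Nat.mod_eq_of_lt h3]

theorem addr_tupleAt (N p : ℕ) : addr N (tupleAt N p) = p := by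
  have e1 := Nat.div_add_mod p N
  have e2 := Nat.div_add_mod (p / N) N
  have e3 := Nat.div_add_mod (p / N ^ 2) N
  rw [Nat.div_div_eq_div_mul] at e2 e3
  rw [← pow_two] at e2
  rw [← pow_succ] at e3
  simp only [addr, tupleAt]
  conv_rhs => rw [← e1, ← e2, ← e3]
  ring

theorem addr_lt {N : ℕ} {k : ℕ × ℕ × ℕ × ℕ} (h1 : k.1 < N) (h2 : k.2.1 < N)
    (h3 : k.2.2.1 < N) (h4 : k.2.2.2 < N) : addr N k < N ^ 4 := by
  obtain ⟨a, b, c, d⟩ := k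
  simp only at h1 h2 h3 h4
  obtain ⟨m, rfl⟩ : ∃ m, N = m + 1 := ⟨N - 1, by omega⟩
  have := Nat.mul_le_mul_right ((m + 1) ^ 3) (Nat.le_of_lt_succ h1)
  have := Nat.mul_le_mul_right ((m + 1) ^ 2) (Nat.le_of_lt_succ h2)
  have := Nat.mul_le_mul_right ((m + 1) ^ 1) (Nat.le_of_lt_succ h3)
  have := pow_zero (m + 1)
  have : d * (m + 1) ^ 0 = d := by ring
  have : (m + 1) ^ 4 = m * (m + 1) ^ 3 + m * (m + 1) ^ 2 + m * (m + 1) ^ 1 + m + 1 := by ring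
  simp only [addr]
  omega

/-- The stacks that represent the variables `env` and the state `s` of an array program. -/
def layout (N : ℕ) (env : V → ℕ) (s : State A) : Stk A V → List Bool
  | .inp => s.inp
  | .out => []
  | .buf => s.out.reverse
  | .tmp => []
  | .sav => []
  | .cnt _ => List.replicate N true
  | .alt _ => []
  | .idx v => List.replicate (env v) true
  | .rem v => List.replicate (N - env v) true
  | .arr a => (List.range (N ^ 4)).map fun p => s.mem (a, tupleAt N p)

/-- Nested loops that repeat `c` for `N ^ e` times. -/
def nest (c : StackProg (Stk A V)) : ℕ → StackProg (Stk A V)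
  | 0 => c
  | e + 1 => forEach (.cnt (Fin.ofNat 4 e)) (.alt (Fin.ofNat 4 e)) (nest c e)

/-- A time bound for `nest c e`, where `B` is one for `c`. -/
def nestCost (N B : ℕ) : ℕ → ℕ
  | 0 => B
  | e + 1 => forEachCost N (nestCost N B e)

/-- Move as many entries of the array `a` as the value of `v` times `N ^ e`. -/
def seekDigit (a : A) (v : V) (e : ℕ) : StackProg (Stk A V) :=
  forEach (.idx v) .sav (nest (move (.arr a) .tmp) e)

/-- Move all the entries of `a` before the position `x` to the stack `tmp`. -/
def seek (a : A) (x : V × V × V × V) : StackProg (Stk A V) :=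
  StackProg.seq (seekDigit a x.1 3) (StackProg.seq (seekDigit a x.2.1 2)
    (StackProg.seq (seekDigit a x.2.2.1 1) (seekDigit a x.2.2.2 0)))

/-- A time bound for `seek`. -/
def seekCost (N : ℕ) : ℕ :=
  forEachCost N (nestCost N 3 3) + (forEachCost N (nestCost N 3 2) +
    (forEachCost N (nestCost N 3 1) + forEachCost N (nestCost N 3 0)))

/-- Replace the entry at the position `x`. -/
def setEntry (a : A) (x : V × V × V × V) (b : Bool) : StackProg (Stk A V) :=
  StackProg.seq (seek a x) (StackProg.seq (pop (.arr a))
    (StackProg.seq (push (.arr a) b) (transfer .tmp (.arr a))))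

/-- A time bound for `setEntry`. -/
def setCost (N : ℕ) : ℕ := seekCost N + (1 + (1 + (N ^ 4 * 4 + 1)))

/-- The stack program for an array program. -/
def compile : ArrProg A V → StackProg (Stk A V)
  | skip => StackProg.skip
  | set a x b => setEntry a x b
  | ite a x p q =>
    .seq (seek a x) (.branch (.arr a) .skip
      (.seq (transfer .tmp (.arr a)) (compile q)) (.seq (transfer .tmp (.arr a)) (compile p)))
  | seq p q => .seq (compile p) (compile q)
  | loop v p =>
    .seq (repeatWhile (.rem v) (.seq (compile p) (.seq (pop (.rem v)) (push (.idx v) true))))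
      (repeatWhile (.idx v) (.seq (pop (.idx v)) (push (.rem v) true)))
  | read a x =>
    .branch .inp (setEntry a x false) (.seq (pop .inp) (setEntry a x false))
      (.seq (pop .inp) (setEntry a x true))
  | write b => push .buf b

/-- A time bound for compiled array programs. -/
def cost (N : ℕ) : ArrProg A V → ℕ
  | skip => 1
  | set _ _ _ => setCost N
  | ite _ _ p q => seekCost N + (1 + ((N ^ 4 * 4 + 1) + (cost N p + cost N q)))
  | seq p q => cost N p + cost N q
  | loop _ p => (N * (cost N p + 2 + 1) + 1) + (N * (2 + 1) + 1)
  | read _ _ => 1 + (1 + setCost N)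
  | write _ => 1

variable [DecidableEq A] [DecidableEq V]

/-- Executions of nested loops, for a program that realizes the first step of an action of `ℕ`
that does not depend on the counters. -/
theorem execLE_nest {N B : ℕ} {c : StackProg (Stk A V)}
    (F : ℕ → (Stk A V → List Bool) → Stk A V → List Bool)
    (F0 : ∀ S, F 0 S = S) (FF : ∀ q r S, F r (F q S) = F (q + r) S)
    (Fcnt : ∀ q S e, F q S (.cnt e) = S (.cnt e)) (Falt : ∀ q S e, F q S (.alt e) = S (.alt e))
    (Fcnt' : ∀ q S e l, F q (update S (.cnt e) l) = update (F q S) (.cnt e) l)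
    (Falt' : ∀ q S e l, F q (update S (.alt e) l) = update (F q S) (.alt e) l)
    (hc : ∀ S, ExecLE c S (F 1 S) B) (e : ℕ) (he : e ≤ 4) (S : Stk A V → List Bool)
    (hS : ∀ j : Fin 4, j.val < e → S (.cnt j) = List.replicate N true ∧ S (.alt j) = []) :
    ExecLE (nest c e) S (F (N ^ e) S) (nestCost N B e) := by
  induction e generalizing S with
  | zero => simpa [nest, nestCost] using hc S
  | succ e ih =>
    have hj : (Fin.ofNat 4 e).val = e := by simp; omega
    simp only [nest, nestCost]
    generalize Fin.ofNat 4 e = d at hj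
    have h := execLE_forEach (s := .cnt d) (s' := .alt d)
      (c := nest c e) (B := nestCost N B e) (n := N) (by simp) (fun i => F (i * N ^ e) S)
      (fun i hi x y => ?_) ?_ ?_ ?_ ?_
    · simpa [F0, pow_succ, mul_comm] using h
    · have := ih (by omega) (update (update (F (i * N ^ e) S) (.cnt d) x) (.alt d) y)
        (fun j hj' => ?_)
      · rw [Falt', Fcnt', FF] at this
        simpa [Nat.succ_mul] using this
      · have hne : j ≠ d := fun h => by rw [h] at hj'; omega
        have := hS j (by omega)
        simp [hne, Fcnt, Falt, this]
    · simpa [F0] using (hS d (by omega)).1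
    · simpa [F0] using (hS d (by omega)).2
    · simpa [Fcnt] using (hS d (by omega)).1
    · simpa [Falt] using (hS d (by omega)).2

theorem execLE_seekDigit {N m e : ℕ} {a : A} {v : V} {S : Stk A V → List Bool} (he : e ≤ 4)
    (hm : m ≤ N) (hcnt : ∀ j, S (.cnt j) = List.replicate N true) (halt : ∀ j, S (.alt j) = [])
    (hv : S (.idx v) = List.replicate m true) (hsav : S .sav = []) :
    ExecLE (seekDigit a v e) S (shift (.arr a) .tmp (m * N ^ e) S)
      (forEachCost N (nestCost N 3 e)) := by
  have h := execLE_forEach (s := .idx v) (s' := .sav)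
      (c := nest (move (.arr a) .tmp) e) (B := nestCost N 3 e) (n := m) (by simp)
      (fun i => shift (.arr a) .tmp (i * N ^ e) S) (fun i hi x y => ?_) ?_ ?_ ?_ ?_
  · exact ExecLE.mono (by simpa [seekDigit, shift_zero] using h) (forEachCost_mono hm)
  · have := execLE_nest (N := N) (shift (.arr a) .tmp) shift_zero
      (fun q r S => shift_shift (by simp) q r S)
      (fun q S e => shift_of_ne (by simp) (by simp) q S)
      (fun q S e => shift_of_ne (by simp) (by simp) q S)
      (fun q S e l => shift_update (by simp) (by simp) q S l)
      (fun q S e l => shift_update (by simp) (by simp) q S l)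
      (fun S => execLE_move (by simp) S) e he
      (update (update (shift (.arr a) .tmp (i * N ^ e) S) (.idx v) x) .sav y)
      (fun j _ => by simp [shift_of_ne, hcnt, halt])
    rw [shift_update (by simp) (by simp), shift_update (by simp) (by simp),
      shift_shift (by simp)] at this
    simpa [Nat.succ_mul] using this
  all_goals simp [shift_of_ne, hv, hsav]

theorem execLE_seek {N : ℕ} {a : A} {x : V × V × V × V} {env : V → ℕ} (henv : ∀ v, env v < N)
    (s : State A) :
    ExecLE (seek a x) (layout N env s)
      (shift (.arr a) .tmp (addr N (key env x)) (layout N env s)) (seekCost N) := by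
  have key (q e : ℕ) (v : V) (he : e ≤ 4) :
      ExecLE (seekDigit a v e) (shift (.arr a) .tmp q (layout N env s))
        (shift (.arr a) .tmp (q + env v * N ^ e) (layout N env s))
        (forEachCost N (nestCost N 3 e)) := by
    rw [← shift_shift (by simp)]
    refine execLE_seekDigit he (henv v).le (fun j => ?_) (fun j => ?_) ?_ ?_ <;>
      rw [shift_of_ne (by simp) (by simp)] <;> simp [layout]
  have h0 := key 0 3 x.1 (by omega)
  rw [shift_zero, zero_add] at h0
  exact h0.seq ((key _ 2 x.2.1 (by omega)).seq
    ((key _ 1 x.2.2.1 (by omega)).seq (key _ 0 x.2.2.2 (by omega))))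

omit [DecidableEq V] in
theorem key_lt {N : ℕ} {env : V → ℕ} (henv : ∀ v, env v < N) (x : V × V × V × V) :
    addr N (key env x) < N ^ 4 :=
  addr_lt (henv _) (henv _) (henv _) (henv _)

omit [DecidableEq V] in
/-- The list of entries of an array after an assignment. -/
theorem layout_put {N : ℕ} {k : ℕ × ℕ × ℕ × ℕ} (h2 : k.2.1 < N) (h3 : k.2.2.1 < N)
    (h4 : k.2.2.2 < N) (env : V → ℕ) (s : State A) (a : A) (b : Bool) :
    layout N env (s.put a k b) (.arr a) = (layout N env s (.arr a)).set (addr N k) b := by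
  refine List.ext_getElem (by simp [layout]) fun p hp _ => ?_
  simp only [layout, State.put, List.getElem_map, List.getElem_range, List.getElem_set]
  by_cases h : addr N k = p
  · subst h; simp [tupleAt_addr h2 h3 h4]
  · have : tupleAt N p ≠ k := fun h' => h (by rw [← h', addr_tupleAt])
    simp [h, this]

theorem execLE_setEntry {N : ℕ} {a : A} {x : V × V × V × V} {env : V → ℕ}
    (henv : ∀ v, env v < N) (s : State A) (b : Bool) :
    ExecLE (setEntry a x b) (layout N env s) (layout N env (s.put a (key env x) b))
      (setCost N) := by
  have hlt := key_lt henv x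
  set q := addr N (key env x) with hq
  set l := layout N env s (.arr a) with hl
  have hlen : l.length = N ^ 4 := by simp [hl, layout]
  refine (execLE_seek henv s).seq (ExecLE.seq (execLE_pop rfl) (ExecLE.seq
    (S' := update (update (layout N env s) (.arr a) (b :: l.drop (q + 1))) .tmp (l.take q).reverse)
    (execLE_push ?_) ?_))
  · funext k
    by_cases h1 : k = .arr a
    · subst h1; simp [shift, ← hq, ← hl]
    · by_cases h2 : k = .tmp
      · subst h2; simp [shift, ← hq, ← hl]; simp [layout]
      · simp [shift, h1, h2]
  · refine ExecLE.mono (B := min q (N ^ 4) * 4 + 1) ?_ (by omega)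
    convert execLE_transfer (s := Stk.tmp) (t := .arr a) (by simp)
      (update (update (layout N env s) (.arr a) (b :: l.drop (q + 1))) .tmp (l.take q).reverse)
      using 1
    · funext k
      by_cases h1 : k = .arr a
      · subst h1
        rw [layout_put (henv _) (henv _) (henv _), List.set_eq_take_append_cons_drop]
        simp [← hq, ← hl, hlen, hlt]
      · by_cases h2 : k = .tmp
        · subst h2; simp [layout]
        · simp only [update_of_ne h1, update_of_ne h2]
          cases k <;> simp_all [layout, State.put]
    · simp [hlen]

theorem execLE_loop {N B : ℕ} {v : V} {c : StackProg (Stk A V)} {env : V → ℕ} {s : ℕ → State A}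
    (hv : env v = 0)
    (h : ∀ i < N, ExecLE c (layout N (update env v i) (s i)) (layout N (update env v i) (s (i + 1)))
      B) :
    ExecLE (.seq (repeatWhile (.rem v) (.seq c (.seq (pop (.rem v)) (push (.idx v) true))))
      (repeatWhile (.idx v) (.seq (pop (.idx v)) (push (.rem v) true))))
      (layout N env (s 0)) (layout N env (s N)) ((N * (B + 2 + 1) + 1) + (N * (2 + 1) + 1)) := by
  have hinc : ∀ i < N, ∀ t : State A, update (update (layout N (update env v i) t) (.rem v)
      (List.replicate (N - (i + 1)) true)) (.idx v) (List.replicate (i + 1) true) =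
      layout N (update env v (i + 1)) t := by
    intro i hi t
    funext k
    cases k with
    | idx w => by_cases hw : w = v <;> simp_all [layout]
    | rem w => by_cases hw : w = v <;> simp_all [layout]
    | _ => simp [layout]
  have henv : update env v 0 = env := by rw [← hv]; simp
  have h1 := execLE_while (k := .rem v)
    (c := .seq c (.seq (pop (.rem v)) (push (.idx v) true))) (B := B + 2) N
    (fun i => layout N (update env v i) (s i)) (fun i hi => ⟨?_, ?_⟩) (by simp [layout])
  · refine ExecLE.seq (S' := layout N (update env v N) (s N)) (by simpa [henv] using h1) ?_
    have h2 := execLE_while (k := .idx v)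
      (c := .seq (pop (.idx v)) (push (.rem v) true)) (B := 2) N
      (fun i => layout N (update env v (N - i)) (s N)) (fun i hi => ⟨?_, ?_⟩) (by simp [layout])
    · simpa [henv] using h2
    · simp [layout]; omega
    · refine ExecLE.seq (B := 1) (B' := 1) (execLE_pop rfl) (execLE_push ?_)
      obtain ⟨m, hm⟩ : ∃ m, N - i = m + 1 := ⟨N - i - 1, by omega⟩
      have hm' : N - (i + 1) = m := by omega
      have hm'' : N - m = i + 1 := by omega
      have hm3 : N - (m + 1) = i := by omega
      funext k
      cases k with
      | idx w => by_cases hw : w = v <;> simp_all [layout]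
      | rem w => by_cases hw : w = v <;> simp_all [layout, List.replicate_succ]
      | _ => simp [layout]
  · simp [layout]; omega
  · refine (h i hi).seq (ExecLE.seq (B := 1) (B' := 1) (execLE_pop rfl) (execLE_push ?_))
    rw [← hinc i hi]
    obtain ⟨m, hm⟩ : ∃ m, N - i = m + 1 := ⟨N - i - 1, by omega⟩
    have hm' : N - (i + 1) = m := by omega
    simp [layout, hm, hm', List.replicate_succ]

theorem execLE_read {N : ℕ} {a : A} {x : V × V × V × V} {env : V → ℕ}
    (henv : ∀ v, env v < N) (s : State A) :
    ExecLE (compile (read a x)) (layout N env s) (layout N env (run N (read a x) env s))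
      (cost N (read a x : ArrProg A V)) := by
  rcases hs : s.inp with _ | ⟨b, l⟩
  · have h : run N (read a x) env s = s.put a (key env x) false := by
      simp [run, hs, State.put]
    rw [h]
    exact ExecLE.mono (execLE_branch_nil (by simp [layout, hs])
      (execLE_setEntry henv s false)) (by simp [cost])
  · have hpop : update (layout N env s) .inp (layout N env s .inp).tail =
        layout N env { s with inp := l } := by
      funext k
      cases k <;> simp [layout, hs]
    have h : ExecLE (.seq (pop .inp) (setEntry a x b)) (layout N env s)
        (layout N env (run N (read a x) env s)) (1 + setCost N) := by
      refine (execLE_pop hpop.symm).seq ?_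
      convert execLE_setEntry henv { s with inp := l } b using 2
      simp [run, hs, State.put]
    refine execLE_branch_cons (b := b) (l := l) (by simp [layout, hs]) ?_
    cases b <;> simpa using h

/-- The compiled program follows the semantics of the array program. -/
theorem execLE_compile {N : ℕ} (p : ArrProg A V) (bd : List V) (hp : p.WF bd) (env : V → ℕ)
    (henv : ∀ v, env v < N) (h0 : ∀ v ∉ bd, env v = 0) (s : State A) :
    ExecLE (compile p) (layout N env s) (layout N env (run N p env s)) (cost N p) := by
  induction p generalizing bd env s with
  | skip => exact execLE_skip _
  | set a x b => exact execLE_setEntry henv s b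
  | ite a x p q ihp ihq =>
    simp only [WF, Bool.and_eq_true] at hp
    have hlt := key_lt henv x
    have hl : (layout N env s (.arr a)).length = N ^ 4 := by simp [layout]
    refine (execLE_seek henv s).seq ?_
    have hrest : ExecLE (transfer .tmp (.arr a))
        (shift (.arr a) .tmp (addr N (key env x)) (layout N env s)) (layout N env s)
        (N ^ 4 * 4 + 1) := by
      refine ExecLE.mono (B := min (addr N (key env x)) (N ^ 4) * 4 + 1) ?_ (by omega)
      convert execLE_transfer (s := Stk.tmp) (t := .arr a) (by simp)
        (shift (.arr a) .tmp (addr N (key env x)) (layout N env s)) using 1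
      · funext k
        by_cases h1 : k = .arr a
        · subst h1; simp [shift, layout]
        · by_cases h2 : k = .tmp
          · subst h2; simp [layout]
          · simp [shift, h1, h2]
      · simp [shift, layout]
    refine execLE_branch_cons (b := s.mem (a, key env x))
      (l := (layout N env s (.arr a)).drop (addr N (key env x) + 1)) ?_ ?_
    · simp only [shift, ne_eq, reduceCtorEq, not_false_eq_true, update_of_ne, update_self]
      rw [List.drop_eq_getElem_cons (by omega)]
      simp [layout, tupleAt_addr (N := N) (k := key env x) (henv _) (henv _) (henv _)]
    · simp only [run]
      split_ifs
      · exact ExecLE.mono (hrest.seq (ihp bd hp.1 env henv h0 s)) (by omega)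
      · exact ExecLE.mono (hrest.seq (ihq bd hp.2 env henv h0 s)) (by omega)
  | seq p q ihp ihq =>
    simp only [WF, Bool.and_eq_true] at hp
    exact (ihp bd hp.1 env henv h0 s).seq (ihq bd hp.2 env henv h0 _)
  | loop v p ih =>
    simp only [WF, Bool.and_eq_true, Bool.not_eq_true', decide_eq_false_iff_not] at hp
    have := execLE_loop (N := N) (B := cost N p) (v := v) (c := compile p) (env := env)
      (s := fun i => (List.range i).foldl (fun s i => run N p (update env v i) s) s)
      (h0 v hp.1) (fun i hi => ?_)
    · simpa [compile, run, cost] using this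
    · simp only [List.range_succ, List.foldl_append, List.foldl_cons, List.foldl_nil]
      refine ih (v :: bd) hp.2 _ (fun w => ?_) (fun w hw => ?_) _
      · by_cases hw : w = v <;> simp [hw, hi, henv]
      · rw [List.mem_cons, not_or] at hw
        simp [hw.1, h0 w hw.2]
  | read a x => exact execLE_read henv s
  | write b =>
    refine execLE_push ?_
    funext k
    cases k <;> simp [layout, run]

/-! ### The running time of array programs -/

/-- Every machine step writes at most one bit of the output. -/
theorem length_out_run_le {N : ℕ} (p : ArrProg A V) (env : V → ℕ)
    (s : State A) : (run N p env s).out.length ≤ s.out.length + cost N p := by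
  induction p generalizing env s with
  | skip => simp [run]
  | set a x b => simp [run, State.put]
  | ite a x p q ihp ihq =>
    have := ihp env s
    have := ihq env s
    simp only [run, cost]
    split_ifs <;> omega
  | seq p q ihp ihq =>
    have := ihp env s
    have := ihq env (run N p env s)
    simp only [run, cost]
    omega
  | loop v p ih =>
    simp only [run, cost]
    suffices ∀ n, ((List.range n).foldl (fun s i => run N p (update env v i) s) s).out.length ≤
        s.out.length + n * cost N p by
      have h1 := this N
      have h2 : N * cost N p ≤ N * (cost N p + 2 + 1) := Nat.mul_le_mul_left _ (by omega)
      omega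
    intro n
    induction n with
    | zero => simp
    | succ n ihn =>
      have h1 := ih (update env v n)
        ((List.range n).foldl (fun s i => run N p (update env v i) s) s)
      simp only [List.range_succ, List.foldl_append, List.foldl_cons, List.foldl_nil, Nat.succ_mul]
      omega
  | read a x => simp [run]
  | write b => simp [run, cost]

theorem length_inp_run_le {N : ℕ} (p : ArrProg A V) (env : V → ℕ) (s : State A) :
    (run N p env s).inp.length ≤ s.inp.length := by
  induction p generalizing env s with
  | ite a x p q ihp ihq =>
    simp only [run]
    split_ifs
    exacts [ihp env s, ihq env s]
  | seq p q ihp ihq => exact (ihq env _).trans (ihp env s)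
  | loop v p ih =>
    simp only [run]
    generalize List.range N = l
    induction l generalizing s with
    | nil => simp
    | cons i l ihl => exact (ihl _).trans (ih _ _)
  | _ => simp [run, State.put]

variable [Fintype A] [Fintype V]

variable (A V) in
/-- The stacks that initially hold `N` units. -/
noncomputable def unitStacks : List (Stk A V) :=
  (Finset.univ.filter fun k : Stk A V => (∃ e, k = .cnt e) ∨ ∃ v, k = .rem v).toList

variable (A V) in
/-- The stacks that hold the arrays. -/
noncomputable def arrayStacks : List (Stk A V) :=
  (Finset.univ.filter fun k : Stk A V => ∃ a, k = .arr a).toList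

theorem nodup_unitStacks : (unitStacks A V).Nodup := Finset.nodup_toList _

theorem nodup_arrayStacks : (arrayStacks A V).Nodup := Finset.nodup_toList _

variable (A V) in
/-- Set up the stacks: count the bits of the input and fill the arrays with zeros. -/
noncomputable def setup : StackProg (Stk A V) :=
  .seq (repeatWhile .inp (.seq (move .inp .tmp) (pushList true (unitStacks A V))))
    (.seq (transfer .tmp .inp) (nest (pushList false (arrayStacks A V)) 4))

variable (A V) in
/-- Reverse the buffered output and empty all the other stacks. -/
noncomputable def finish : StackProg (Stk A V) :=
  .seq (transfer .buf .out) (clearList (Finset.univ.filter fun k : Stk A V => k ≠ .out).toList)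

/-- The complete stack program for an array program. -/
noncomputable def toStackProg (p : ArrProg A V) : StackProg (Stk A V) :=
  .seq (setup A V) (.seq (compile p) (finish A V))

/-- A bound for the time of `setup`, with `u` stacks of units and `r` arrays. -/
def setupCost (u r N : ℕ) : ℕ :=
  (N * (3 + (u + 1) + 1) + 1) + ((N * 4 + 1) + nestCost N (r + 1) 4)

/-- A bound for the time of `finish`, with `t` stacks and `c` steps before. -/
def finishCost (t c N : ℕ) : ℕ :=
  (c * 4 + 1) + (t * ((N + N ^ 4 + c) * 2 + 1) + 1)

theorem execLE_setup (w : List Bool) :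
    ExecLE (setup A V) (update (fun _ => []) .inp w)
      (layout w.length (fun _ => 0) ⟨fun _ => false, w, []⟩)
      (setupCost (unitStacks A V).length (arrayStacks A V).length w.length) := by
  set N := w.length with hN
  let U : ℕ → Stk A V → List Bool := fun i k => if k ∈ unitStacks A V then List.replicate i true
    else if k = .inp then w.drop i else if k = .tmp then (w.take i).reverse else []
  have hinp : Stk.inp ∉ unitStacks A V := by simp [unitStacks]
  have htmp : Stk.tmp ∉ unitStacks A V := by simp [unitStacks]
  have hU0 : U 0 = update (fun _ => []) .inp w := by
    funext k
    by_cases h : k = .inp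
    · subst h; simp [U, hinp]
    · simp [U, h]
  refine ExecLE.seq (S' := U N) ?_ (ExecLE.seq
    (S' := fun k => if k = .inp then w else if k ∈ unitStacks A V then List.replicate N true
      else []) ?_ ?_)
  · rw [← hU0]
    refine execLE_while N U (fun i hi => ⟨by simp [U, hinp]; omega, ?_⟩) (by simp [U, hinp, hN])
    refine ExecLE.seq (execLE_move (by simp) _) ?_
    convert execLE_pushList nodup_unitStacks (shift Stk.inp .tmp 1 (U i)) using 1
    funext k
    by_cases h : k ∈ unitStacks A V
    · have h1 : k ≠ .inp := fun h' => hinp (h' ▸ h)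
      have h2 : k ≠ .tmp := fun h' => htmp (h' ▸ h)
      simp only [if_true, shift_of_ne h1 h2, U, h, List.replicate_succ]
    · simp only [if_false, U, h]
      by_cases h1 : k = .inp
      · subst h1; simp [shift, hinp]
      · by_cases h2 : k = .tmp
        · subst h2
          simp [shift, hinp, htmp, List.take_add]
        · simp [shift, h1, h2, h]
  · refine ExecLE.mono (B := (U N .tmp).length * 4 + 1) ?_ (by simp [U, htmp, hN])
    convert execLE_transfer (s := Stk.tmp) (t := .inp) (by simp) (U N) using 1
    funext k
    by_cases h1 : k = .inp
    · subst h1; simp [U, hinp, htmp, hN]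
    · by_cases h2 : k = .tmp
      · subst h2; simp [htmp]
      · simp [U, h1, h2]
  · have key := execLE_nest (N := N) (c := pushList false (arrayStacks A V))
      (fun q S k => if k ∈ arrayStacks A V then List.replicate q false ++ S k else S k)
      (fun S => by simp) (fun q r S => ?_) (fun q S e => by simp [arrayStacks])
      (fun q S e => by simp [arrayStacks]) (fun q S e l => ?_) (fun q S e l => ?_)
      (fun S => by simpa using execLE_pushList nodup_arrayStacks S) 4 le_rfl
      (fun k => if k = .inp then w else if k ∈ unitStacks A V then List.replicate N true
      else []) (fun j _ => by simp [unitStacks])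
    · convert key using 1
      funext k
      cases k <;> simp [layout, arrayStacks, unitStacks]
    · funext k
      by_cases h : k ∈ arrayStacks A V
      · simp [h, ← List.append_assoc, Nat.add_comm]
      · simp [h]
    · funext k
      by_cases h : k = .cnt e
      · subst h; simp [arrayStacks]
      · simp [h]
    · funext k
      by_cases h : k = .alt e
      · subst h; simp [arrayStacks]
      · simp [h]

theorem execLE_toStackProg (p : ArrProg A V) (hp : p.WF []) (w : List Bool) (hw : w ≠ []) :
    ExecLE (toStackProg p) (update (fun _ => []) .inp w)
      (update (fun _ => []) .out (run w.length p (fun _ => 0) ⟨fun _ => false, w, []⟩).out)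
      (setupCost (unitStacks A V).length (arrayStacks A V).length w.length + (cost w.length p +
        finishCost (Finset.univ.filter fun k : Stk A V => k ≠ .out).card (cost w.length p)
          w.length)) := by
  have hpos : 0 < w.length := List.length_pos_iff.mpr hw
  refine (execLE_setup w).seq ((execLE_compile p [] hp _ (fun _ => hpos) (fun _ _ => rfl) _).seq ?_)
  set N := w.length with hN
  have hout := length_out_run_le (N := N) p (fun _ => 0) ⟨fun _ => false, w, []⟩
  have hin := length_inp_run_le (N := N) p (fun _ => 0) ⟨fun _ => false, w, []⟩
  set s := run N p (fun _ => 0) ⟨fun _ => false, w, []⟩ with hs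
  simp only [List.length_nil, zero_add] at hout hin
  refine ExecLE.seq (execLE_transfer (by simp) _ |>.mono (by simpa [layout] using hout)) ?_
  have h := execLE_clearList (ks := (Finset.univ.filter fun k : Stk A V => k ≠ .out).toList)
    (update (update (layout N (fun _ => 0) s) .buf []) .out
      ((layout N (fun _ : V => 0) s .buf).reverse ++ layout N (fun _ : V => 0) s .out))
    (X := N + N ^ 4 + cost N p) (fun k => ?_)
  · rw [Finset.length_toList] at h
    convert h using 1
    funext k
    by_cases hk : k = .out
    · subst hk; simp [layout]
    · simp [hk]
  · cases k <;> simp [layout] <;> omega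

/-- A function on the natural numbers that is bounded by a polynomial. -/
def PolyBounded (f : ℕ → ℕ) : Prop := ∃ p : Polynomial ℕ, ∀ n, f n ≤ p.eval n

namespace PolyBounded

theorem const (c : ℕ) : PolyBounded fun _ => c := ⟨Polynomial.C c, by simp⟩

theorem id : PolyBounded fun n => n := ⟨Polynomial.X, by simp⟩

theorem add {f g : ℕ → ℕ} (hf : PolyBounded f) (hg : PolyBounded g) :
    PolyBounded fun n => f n + g n :=
  let ⟨p, hp⟩ := hf; let ⟨q, hq⟩ := hg
  ⟨p + q, fun n => by simpa using Nat.add_le_add (hp n) (hq n)⟩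

theorem mul {f g : ℕ → ℕ} (hf : PolyBounded f) (hg : PolyBounded g) :
    PolyBounded fun n => f n * g n :=
  let ⟨p, hp⟩ := hf; let ⟨q, hq⟩ := hg
  ⟨p * q, fun n => by simpa using Nat.mul_le_mul (hp n) (hq n)⟩

theorem pow (c : ℕ) : PolyBounded fun n => n ^ c := ⟨Polynomial.X ^ c, by simp⟩

theorem forEachCost {f : ℕ → ℕ} (hf : PolyBounded f) :
    PolyBounded fun n => StackProg.forEachCost n (f n) :=
  ((id.mul (hf.add (const 3))).add (const 1)).add ((id.mul (const 3)).add (const 1))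

theorem nestCost (B e : ℕ) : PolyBounded fun n => ArrProg.nestCost n B e := by
  induction e with
  | zero => exact const B
  | succ e ih => exact ih.forEachCost

theorem seekCost : PolyBounded ArrProg.seekCost :=
  (nestCost 3 3).forEachCost.add ((nestCost 3 2).forEachCost.add
    ((nestCost 3 1).forEachCost.add (nestCost 3 0).forEachCost))

theorem setCost : PolyBounded ArrProg.setCost :=
  seekCost.add ((const 1).add ((const 1).add (((pow 4).mul (const 4)).add (const 1))))

theorem cost {A V : Type} (p : ArrProg A V) : PolyBounded fun n => ArrProg.cost n p := by
  induction p with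
  | skip => exact const 1
  | set a x b => exact setCost
  | ite a x p q ihp ihq =>
    exact seekCost.add ((const 1).add ((((pow 4).mul (const 4)).add (const 1)).add (ihp.add ihq)))
  | seq p q ihp ihq => exact ihp.add ihq
  | loop v p ih =>
    exact ((id.mul ((ih.add (const 2)).add (const 1))).add (const 1)).add
      ((id.mul (const 3)).add (const 1))
  | read a x => exact (const 1).add ((const 1).add setCost)
  | write b => exact const 1

theorem setupCost (u r : ℕ) : PolyBounded (ArrProg.setupCost u r) :=
  ((id.mul (const (3 + (u + 1) + 1))).add (const 1)).add
    (((id.mul (const 4)).add (const 1)).add (nestCost (r + 1) 4))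

theorem finishCost (t : ℕ) {f : ℕ → ℕ} (hf : PolyBounded f) :
    PolyBounded fun n => ArrProg.finishCost t (f n) n :=
  ((hf.mul (const 4)).add (const 1)).add (((const t).mul
    ((((id.add (pow 4)).add hf).mul (const 2)).add (const 1))).add (const 1))

end PolyBounded

/-- A function that is computed by an array program whose loops run up to the length of the input
is computed by a Turing machine in polynomial time. -/
theorem polyTime (p : ArrProg A V) (hp : p.WF []) {α : Type} (enc : α → List Bool)
    (henc : ∀ a, enc a ≠ []) :
    Nonempty (Turing.TM2ComputableInPolyTime enc (id : List Bool → List Bool) fun a =>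
      (run (enc a).length p (fun _ => 0) ⟨fun _ => false, enc a, []⟩).out) := by
  obtain ⟨q, hq⟩ := (PolyBounded.setupCost (unitStacks A V).length (arrayStacks A V).length).add
    ((PolyBounded.cost p).add (PolyBounded.finishCost
      (Finset.univ.filter fun k : Stk A V => k ≠ .out).card (PolyBounded.cost p)))
  exact polyTime_of_execLE enc _ (toStackProg p) .inp .out q fun a =>
    (execLE_toStackProg p hp (enc a) (henc a)).mono (hq _)

end ArrProg

/-! ### Reasoning about array programs -/

namespace ArrProg

open Function

variable {A V : Type} [DecidableEq A] [DecidableEq V]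

omit [DecidableEq V] in
/-- Whether a program may change the array `a`. -/
def writes (a : A) : ArrProg A V → Bool
  | skip => false
  | set a' _ _ => a' = a
  | ite _ _ p q => writes a p || writes a q
  | seq p q => writes a p || writes a q
  | loop _ p => writes a p
  | read a' _ => a' = a
  | write _ => false

/-- Whether a program may read the input. -/
def reads : ArrProg A V → Bool
  | ite _ _ p q => reads p || reads q
  | seq p q => reads p || reads q
  | loop _ p => reads p
  | read _ _ => true
  | _ => false

/-- Whether a program may write output. -/
def prints : ArrProg A V → Bool
  | ite _ _ p q => prints p || prints q
  | seq p q => prints p || prints q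
  | loop _ p => prints p
  | write _ => true
  | _ => false

/-- The invariant rule for loops. -/
theorem run_loop_induct {N : ℕ} {v : V} {p : ArrProg A V} {env : V → ℕ} {s : State A}
    (I : ℕ → State A → Prop) (h0 : I 0 s)
    (hs : ∀ i < N, ∀ s, I i s → I (i + 1) (run N p (update env v i) s)) :
    I N (run N (loop v p) env s) := by
  simp only [run]
  suffices ∀ n ≤ N, I n ((List.range n).foldl (fun s i => run N p (update env v i) s) s) from
    this N le_rfl
  intro n
  induction n with
  | zero => exact fun _ => h0
  | succ n ih =>
    intro hn
    rw [List.range_succ, List.foldl_append]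
    exact hs n hn _ (ih (by omega))

theorem mem_run_of_not_writes {N : ℕ} {p : ArrProg A V} {a : A} (h : p.writes a = false)
    (env : V → ℕ) (s : State A) (k : ℕ × ℕ × ℕ × ℕ) :
    (run N p env s).mem (a, k) = s.mem (a, k) := by
  induction p generalizing env s with
  | set a' x b =>
    have : a ≠ a' := fun h' => by simp [writes, h'] at h
    simp [run, State.put, this]
  | ite a' x p q ihp ihq =>
    simp only [writes, Bool.or_eq_false_iff] at h
    simp only [run]
    split_ifs
    exacts [ihp h.1 env s, ihq h.2 env s]
  | seq p q ihp ihq =>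
    simp only [writes, Bool.or_eq_false_iff] at h
    exact (ihq h.2 _ _).trans (ihp h.1 _ _)
  | loop v p ih =>
    exact run_loop_induct (fun _ s' => s'.mem (a, k) = s.mem (a, k)) rfl
      fun i _ s' hs' => (ih h _ _).trans hs'
  | read a' x =>
    have : a ≠ a' := fun h' => by simp [writes, h'] at h
    simp [run, this]
  | _ => simp [run]

theorem inp_run_of_not_reads {N : ℕ} {p : ArrProg A V} (h : p.reads = false)
    (env : V → ℕ) (s : State A) : (run N p env s).inp = s.inp := by
  induction p generalizing env s with
  | ite a' x p q ihp ihq =>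
    simp only [reads, Bool.or_eq_false_iff] at h
    simp only [run]
    split_ifs
    exacts [ihp h.1 env s, ihq h.2 env s]
  | seq p q ihp ihq =>
    simp only [reads, Bool.or_eq_false_iff] at h
    exact (ihq h.2 _ _).trans (ihp h.1 _ _)
  | loop v p ih =>
    exact run_loop_induct (fun _ s' => s'.inp = s.inp) rfl fun i _ s' hs' => (ih h _ _).trans hs'
  | read a' x => simp [reads] at h
  | _ => simp [run, State.put]

theorem out_run_of_not_prints {N : ℕ} {p : ArrProg A V} (h : p.prints = false)
    (env : V → ℕ) (s : State A) : (run N p env s).out = s.out := by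
  induction p generalizing env s with
  | ite a' x p q ihp ihq =>
    simp only [prints, Bool.or_eq_false_iff] at h
    simp only [run]
    split_ifs
    exacts [ihp h.1 env s, ihq h.2 env s]
  | seq p q ihp ihq =>
    simp only [prints, Bool.or_eq_false_iff] at h
    exact (ihq h.2 _ _).trans (ihp h.1 _ _)
  | loop v p ih =>
    exact run_loop_induct (fun _ s' => s'.out = s.out) rfl fun i _ s' hs' => (ih h _ _).trans hs'
  | write b => simp [prints] at h
  | _ => simp [run, State.put]

/-- Execute `p` for the values of `v` at which the array `g` holds. -/
def loopIf (v : V) (g : A) (x : V × V × V × V) (p : ArrProg A V) : ArrProg A V :=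
  loop v (ite g x p skip)

/-- The invariant rule for a loop that is restricted to an interval of length `cnt`. -/
theorem run_loopIf_induct {N lo cnt : ℕ} {v : V} {g : A} {x : V × V × V × V} {p : ArrProg A V}
    {env : V → ℕ} {s : State A} (hN : lo + cnt ≤ N) (I : ℕ → State A → Prop)
    (hg : ∀ j s, I j s → ∀ i < N,
      (s.mem (g, key (update env v i) x) = true ↔ lo ≤ i ∧ i < lo + cnt))
    (h0 : I 0 s) (hs : ∀ j < cnt, ∀ s, I j s → I (j + 1) (run N p (update env v (lo + j)) s)) :
    I cnt (run N (loopIf v g x p) env s) := by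
  have := run_loop_induct (N := N) (v := v) (p := ite g x p skip) (env := env) (s := s)
    (fun i => I (min (i - lo) cnt)) (by simpa using h0) (fun i hi s h => ?_)
  · rwa [min_eq_right (by omega)] at this
  · simp only [run]
    split_ifs with hc
    · rw [hg _ s h i hi] at hc
      have := hs (i - lo) (by omega) s (by rwa [min_eq_left (by omega)] at h)
      rw [min_eq_left (by omega), show i + 1 - lo = i - lo + 1 by omega]
      rwa [show lo + (i - lo) = i by omega] at this
    · rw [hg _ s h i hi] at hc
      rwa [show min (i + 1 - lo) cnt = min (i - lo) cnt by omega]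

end ArrProg

/-! ### Bipartite matching by price increases -/

/-- The invariants of the matching algorithm. `M` is the current matching of the vertices in `Lf`,
and the price of a right vertex `r` is the number of `c` with `P r c`. -/
structure PriceInv {L R : Type} (Lf : Finset L) (adj : L → R → Prop) (D : Set R)
    (M : L → R → Prop) (P : R → ℕ → Prop) : Prop where
  mem_left : ∀ {l r}, M l r → l ∈ Lf
  adj_of_mate : ∀ {l r}, M l r → adj l r
  left_unique : ∀ {l r r'}, M l r → M l r' → r = r'
  right_unique : ∀ {l l' r}, M l r → M l' r → l = l'
  /-- right vertices with a positive price are matched -/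
  matched_of_price : ∀ {r c}, P r c → ∃ l, M l r
  /-- the price of the partner of `l` exceeds the price of no neighbour of `l` by more than one -/
  slack : ∀ {l r r' c c'}, M l r → adj l r' → P r c → c' < c → P r' c'
  /-- the vertices in `D` are matched -/
  cover : ∀ r ∈ D, ∃ l, M l r

namespace PriceInv

variable {L R : Type} {Lf : Finset L} {adj : L → R → Prop} {D : Set R} {M : L → R → Prop}
  {P : R → ℕ → Prop}

/-- Matching an unmatched vertex `l` to a cheapest neighbour `r`, whose price `c` is increased and
which is taken away from its former partner, preserves the invariants. -/
theorem step (h : PriceInv Lf adj D M P) {l : L} {r : R} {c : ℕ} (hl : l ∈ Lf)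
    (hM : ∀ r, ¬ M l r) (hadj : adj l r) (hP : ¬ P r c)
    (hmin : ∀ c' < c, ∀ r', adj l r' → P r' c') :
    PriceInv Lf adj D (fun l' r' => (r' = r ∧ l' = l) ∨ (r' ≠ r ∧ M l' r'))
      (fun r' c' => (r' = r ∧ c' = c) ∨ P r' c') where
  mem_left := by
    rintro l' r' (⟨rfl, rfl⟩ | ⟨-, h'⟩)
    exacts [hl, h.mem_left h']
  adj_of_mate := by
    rintro l' r' (⟨rfl, rfl⟩ | ⟨-, h'⟩)
    exacts [hadj, h.adj_of_mate h']
  left_unique := by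
    rintro l' r' r'' (⟨h1, h2⟩ | ⟨-, h'⟩) (⟨h3, h4⟩ | ⟨-, h''⟩)
    exacts [h1.trans h3.symm, (hM _ (h2 ▸ h'')).elim, (hM _ (h4 ▸ h')).elim, h.left_unique h' h'']
  right_unique := by
    rintro l' l'' r' (⟨h1, h3⟩ | ⟨h1, h'⟩) (⟨h2, h4⟩ | ⟨h2, h''⟩)
    exacts [h3.trans h4.symm, (h2 h1).elim, (h1 h2).elim, h.right_unique h' h'']
  matched_of_price := by
    intro r' c' h'
    by_cases hr : r' = r
    · exact ⟨l, .inl ⟨hr, rfl⟩⟩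
    · obtain ⟨l', hl'⟩ := h.matched_of_price (h'.resolve_left fun h'' => hr h''.1)
      exact ⟨l', .inr ⟨hr, hl'⟩⟩
  slack := by
    rintro l' r' r'' c1 c2 (⟨rfl, rfl⟩ | ⟨hr, h'⟩) ha hc hlt
    · refine .inr ?_
      by_cases hcc : c1 ≤ c
      · exact hmin c2 (by omega) _ ha
      · -- the price of a matched vertex is the length of an initial segment, and `c1 > c`
        have hc1 : P r' c1 := hc.resolve_left fun h'' => hcc h''.2.le
        obtain ⟨l0, hl0⟩ := h.matched_of_price hc1
        exact (hP (h.slack hl0 (h.adj_of_mate hl0) hc1 (by omega))).elim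
    · exact .inr (h.slack h' ha (hc.resolve_left fun h'' => hr h''.1) hlt)
  cover := by
    intro r' hr'
    by_cases hr : r' = r
    · exact ⟨l, .inl ⟨hr, rfl⟩⟩
    · obtain ⟨l', hl'⟩ := h.cover r' hr'
      exact ⟨l', .inr ⟨hr, hl'⟩⟩

/-- If all the neighbours of an unmatched vertex `u` have the price `N > |Lf|`, then `Lf` cannot be
matched completely. A complete matching would send `u` and the vertices whose partner has a price
above `c + 1` to vertices with price above `c`, hence there would be more vertices with a partner
of price above `c` than with one of price above `c + 1`, for each of `N` values of `c`. -/
theorem not_exists_matching (h : PriceInv Lf adj D M P) {N : ℕ} (hN : Lf.card < N) {u : L}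
    (hu : u ∈ Lf) (hM : ∀ r, ¬ M u r) (hfull : ∀ r, adj u r → ∀ c < N, P r c)
    (f : L → R) (hf : Set.InjOn f Lf) (hadj : ∀ l ∈ Lf, adj l (f l)) : False := by
  classical
  let S : ℕ → Finset L := fun c => Lf.filter fun l => ∃ r, M l r ∧ P r c
  have huS : ∀ c, u ∉ S c := fun c hc => by
    obtain ⟨r, hr, -⟩ := (Finset.mem_filter.mp hc).2
    exact hM r hr
  have hS : ∀ c, c + 1 < N → (S (c + 1)).card + 1 ≤ (S c).card := by
    intro c hc
    rw [← Finset.card_insert_of_notMem (huS (c + 1))]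
    have hmem : ∀ l ∈ insert u (S (c + 1)), l ∈ Lf := by
      intro l hl
      rcases Finset.mem_insert.mp hl with rfl | hl
      exacts [hu, (Finset.mem_filter.mp hl).1]
    have hprice : ∀ l ∈ insert u (S (c + 1)), P (f l) c := by
      intro l hl
      rcases Finset.mem_insert.mp hl with rfl | hl
      · exact hfull _ (hadj _ hu) c (by omega)
      · obtain ⟨hl, r, hr, hP⟩ := Finset.mem_filter.mp hl
        exact h.slack hr (hadj l hl) hP (by omega)
    have hmate : ∀ l, ∃ l', l ∈ insert u (S (c + 1)) → M l' (f l) := fun l => by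
      by_cases hl : l ∈ insert u (S (c + 1))
      · obtain ⟨l', hl'⟩ := h.matched_of_price (hprice l hl)
        exact ⟨l', fun _ => hl'⟩
      · exact ⟨l, fun h' => (hl h').elim⟩
    choose g hg using hmate
    refine Finset.card_le_card_of_injOn g (fun l hl => ?_) (fun l hl l' hl' hgl => ?_)
    · exact Finset.mem_filter.mpr ⟨h.mem_left (hg l hl), f l, hg l hl, hprice l hl⟩
    · refine hf (hmem l hl) (hmem l' hl') (h.left_unique (hg l hl) ?_)
      rw [hgl]
      exact hg l' hl'
  have hS' : ∀ c < N, (S c).card + c + 1 ≤ Lf.card := by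
    intro c
    induction c with
    | zero =>
      intro _
      rw [Nat.add_zero, ← Finset.card_insert_of_notMem (huS 0)]
      exact Finset.card_le_card (Finset.insert_subset hu (Finset.filter_subset _ _))
    | succ c ih =>
      intro hc
      have := ih (by omega)
      have := hS c hc
      omega
  have := hS' (N - 1) (by omega)
  omega

end PriceInv

/-! ### The matching algorithm as an array program -/

namespace MRM

open ArrProg Function

/-- The arrays of the program. Left vertices are pairs `(i, h)` of an agent `i` and one of its
permissible rounds `h`. Right vertices are pairs `(a, h)` of a resource and a round, and pairs
`(i, d)` of an agent `i` and a round `d`, which stand for a permission of `i` to remain unmatched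
in one of its permissible rounds. -/
inductive Arr : Type
  /-- the indices of the agents -/
  | agent : Arr
  /-- the indices of the resources -/
  | resource : Arr
  /-- the indices of the rounds -/
  | round : Arr
  /-- an array that is zero throughout -/
  | zero : Arr
  /-- the left vertices -/
  | perm : Arr
  /-- the right vertices that belong to agents -/
  | dummy : Arr
  /-- the adjacency relation -/
  | adj : Arr
  /-- the current matching -/
  | mate : Arr
  /-- the prices: the entry at `(a, b, c)` says that the price of `(a, b)` exceeds `c` -/
  | price : Arr
  /-- the bit that was read last -/
  | bit : Arr
  /-- whether a unary number has been read completely -/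
  | done : Arr
  /-- whether a search has succeeded -/
  | acted : Arr
  /-- whether some left vertex is unmatched -/
  | fail : Arr
  deriving DecidableEq

instance : Fintype Arr where
  elems := {.agent, .resource, .round, .zero, .perm, .dummy, .adj, .mate, .price, .bit, .done,
    .acted, .fail}
  complete x := by cases x <;> simp

/-- The variables of the program. -/
inductive Var : Type
  /-- a variable with the constant value zero -/
  | z : Var
  /-- an agent, as a component of a left vertex -/
  | i : Var
  /-- a round, as a component of a left vertex -/
  | h : Var
  /-- a resource or an agent, as a component of a right vertex -/
  | a : Var
  /-- a round, as a component of a right vertex -/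
  | b : Var
  /-- a price, or the position in a unary number -/
  | c : Var
  /-- a second agent -/
  | i' : Var
  /-- a second round -/
  | h' : Var
  /-- counters of repetitions -/
  | t (e : Fin 4) : Var
  deriving DecidableEq, Fintype

/-- The programs for the problem. -/
abbrev Prog := ArrProg Arr Var

open Var

/-- Remove all the partners of the right vertex `(a, b)`. -/
def clearMate : Prog :=
  loop i' (loop h' (set .mate (i', h', a, b) false))

/-- Unless the search is over, match `(i, h)` to `(a, b)` if they are adjacent and the price of
`(a, b)` does not exceed `c`. -/
def tryEdge : Prog :=
  ite .acted (z, z, z, z) skip (ite .adj (i, h, a, b) (ite .price (a, b, c, z) skip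
    (seq (set .acted (z, z, z, z) true) (seq (set .price (a, b, c, z) true)
      (seq clearMate (set .mate (i, h, a, b) true))))) skip)

/-- Set `acted` if `(i, h)` is matched. -/
def findMate : Prog :=
  seq (set .acted (z, z, z, z) false)
    (loop a (loop b (ite .mate (i, h, a, b) (set .acted (z, z, z, z) true) skip)))

/-- Match `(i, h)` to a cheapest neighbour, unless it is matched already. -/
def matchOne : Prog :=
  seq findMate (loop c (loop a (loop b tryEdge)))

/-- Treat all the left vertices. -/
def matchAll : Prog :=
  loop i (loop h (ite .perm (i, h, z, z) matchOne skip))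

/-- Repeat `matchAll` for `N ^ 4` times. -/
def matching : Prog :=
  loop (t 0) (loop (t 1) (loop (t 2) (loop (t 3) matchAll)))

/-- The matching that is stored in a state. -/
def mateOf (s : State Arr) (l r : ℕ × ℕ) : Prop := s.mem (.mate, l.1, l.2, r.1, r.2) = true

/-- The prices that are stored in a state. -/
def priceOf (s : State Arr) (r : ℕ × ℕ) (c : ℕ) : Prop := s.mem (.price, r.1, r.2, c, 0) = true

/-- The adjacency relation that is stored in a state. -/
def adjOf (s : State Arr) (l r : ℕ × ℕ) : Prop := s.mem (.adj, l.1, l.2, r.1, r.2) = true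

/-- The left vertices that are stored in a state. -/
def permOf (s : State Arr) (l : ℕ × ℕ) : Prop := s.mem (.perm, l.1, l.2, 0, 0) = true

/-- The sum of all the prices. -/
def weight (N : ℕ) (s : State Arr) : ℕ :=
  ((Finset.range N ×ˢ Finset.range N ×ˢ Finset.range N).filter fun x =>
    s.mem (.price, x.1, x.2.1, x.2.2, 0) = true).card

theorem weight_le (N : ℕ) (s : State Arr) : weight N s ≤ N ^ 3 := by
  refine (Finset.card_filter_le _ _).trans ?_
  simp [Finset.card_product]
  exact le_of_eq (by ring)

theorem weight_congr {N : ℕ} {s s' : State Arr} (h : priceOf s' = priceOf s) :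
    weight N s' = weight N s := by
  unfold weight
  congr 1
  refine Finset.filter_congr fun x _ => ?_
  exact iff_of_eq (congrFun (congrFun h (x.1, x.2.1)) x.2.2)

theorem weight_lt {N : ℕ} {s s' : State Arr} {r : ℕ × ℕ} {c : ℕ} (h1 : r.1 < N) (h2 : r.2 < N)
    (hc : c < N) (hP : ¬ priceOf s r c)
    (h : priceOf s' = fun r' c' => (r' = r ∧ c' = c) ∨ priceOf s r' c') :
    weight N s < weight N s' := by
  refine Finset.card_lt_card ⟨fun x hx => ?_, fun hsub => ?_⟩
  · rw [Finset.mem_filter] at hx ⊢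
    refine ⟨hx.1, ?_⟩
    have : priceOf s' (x.1, x.2.1) x.2.2 := by rw [h]; exact .inr hx.2
    exact this
  · have : priceOf s' r c := by rw [h]; exact .inl ⟨rfl, rfl⟩
    have := hsub (Finset.mem_filter.mpr
      ⟨Finset.mem_product.mpr ⟨Finset.mem_range.mpr h1, Finset.mem_product.mpr
        ⟨Finset.mem_range.mpr h2, Finset.mem_range.mpr hc⟩⟩, this⟩ :
      (r.1, r.2, c) ∈ _)
    exact hP (Finset.mem_filter.mp this).2

theorem mem_run_clearMate {N : ℕ} (env : Var → ℕ) (s : State Arr) (k : Arr × ℕ × ℕ × ℕ × ℕ) :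
    (run N clearMate env s).mem k =
      if k.1 = .mate ∧ k.2.1 < N ∧ k.2.2.1 < N ∧ k.2.2.2.1 = env a ∧ k.2.2.2.2 = env b then false
      else s.mem k := by
  refine run_loop_induct (fun x s' => ∀ k, s'.mem k =
      if k.1 = .mate ∧ k.2.1 < x ∧ k.2.2.1 < N ∧ k.2.2.2.1 = env a ∧ k.2.2.2.2 = env b then false
      else s.mem k) (by simp) (fun x hx s1 h1 => ?_) k
  have key : ∀ k, (run N (loop h' (set .mate (i', h', a, b) false)) (update env i' x) s1).mem k =
      if k.1 = .mate ∧ (k.2.1 < x ∧ k.2.2.1 < N ∨ k.2.1 = x ∧ k.2.2.1 < N) ∧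
        k.2.2.2.1 = env a ∧ k.2.2.2.2 = env b then false
      else s.mem k := by
    refine run_loop_induct (fun y s' => ∀ k, s'.mem k =
      if k.1 = .mate ∧ (k.2.1 < x ∧ k.2.2.1 < N ∨ k.2.1 = x ∧ k.2.2.1 < y) ∧
        k.2.2.2.1 = env a ∧ k.2.2.2.2 = env b then false
      else s.mem k) (fun k => ?_) (fun y hy s2 h2 k => ?_)
    · rw [h1]
      congr 1
      simp only [eq_iff_iff]
      constructor
      · rintro ⟨h1, h2, h3, h4⟩
        exact ⟨h1, .inl ⟨h2, h3⟩, h4⟩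
      · rintro ⟨h1, h2, h4⟩
        exact ⟨h1, by omega, by omega, h4⟩
    · obtain ⟨k0, k1, k2, k3, k4⟩ := k
      simp only [run, State.put, update_apply, h2]
      simp only [ArrProg.key, Prod.mk.injEq, update_apply, reduceCtorEq, if_false, if_true]
      by_cases hk : k0 = .mate ∧ k1 = x ∧ k2 = y ∧ k3 = env a ∧ k4 = env b
      · rw [if_pos hk, if_pos]
        exact ⟨hk.1, by omega, by omega⟩
      · rw [if_neg hk]
        congr 1
        simp only [eq_iff_iff]
        constructor
        · rintro ⟨h1, h2, h3⟩
          exact ⟨h1, by omega, h3⟩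
        · rintro ⟨h1, h2, h3, h4⟩
          refine ⟨h1, ?_, h3, h4⟩
          by_contra h5
          exact hk ⟨h1, by omega, by omega, h3, h4⟩
  intro k
  refine (key k).trans ?_
  congr 1
  simp only [eq_iff_iff]
  constructor
  · rintro ⟨h1, h2, h3⟩
    exact ⟨h1, by omega, by omega, h3⟩
  · rintro ⟨h1, h2, h3, h4⟩
    exact ⟨h1, by omega, h4⟩

/-! ### Correctness of the matching algorithm -/

/-- The flag `acted`. -/
def actedOf (s : State Arr) : Prop := s.mem (.acted, 0, 0, 0, 0) = true

/-- Two states with the same matching and the same prices. -/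
def Same (s s' : State Arr) : Prop := mateOf s' = mateOf s ∧ priceOf s' = priceOf s

/-- A left vertex that is matched or all of whose neighbours have the maximal price. -/
def Settled (N : ℕ) (s : State Arr) (l : ℕ × ℕ) : Prop :=
  (∃ r, mateOf s l r) ∨ ∀ r, adjOf s l r → ∀ c < N, priceOf s r c

/-- The invariants of the program, for the left vertices `Lf`, the adjacency relation `adj` and the
right vertices `D` that belong to agents. -/
structure MatchInv (N : ℕ) (Lf : Finset (ℕ × ℕ)) (adj : ℕ × ℕ → ℕ × ℕ → Prop) (D : Set (ℕ × ℕ))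
    (s : State Arr) : Prop where
  inv : PriceInv Lf adj D (mateOf s) (priceOf s)
  adj_eq : adjOf s = adj
  perm_iff : ∀ l, permOf s l ↔ l ∈ Lf
  lt_of_mem : ∀ l ∈ Lf, l.1 < N ∧ l.2 < N
  lt_of_adj : ∀ l r, adj l r → r.1 < N ∧ r.2 < N

theorem Settled.congr {N : ℕ} {s s' : State Arr} (h : Same s s') (ha : adjOf s' = adjOf s)
    {l : ℕ × ℕ} : Settled N s' l ↔ Settled N s l := by
  simp only [Settled, h.1, h.2, ha]

variable {N : ℕ} {Lf : Finset (ℕ × ℕ)} {adj : ℕ × ℕ → ℕ × ℕ → Prop} {D : Set (ℕ × ℕ)}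

theorem MatchInv.congr {s s' : State Arr} (hI : MatchInv N Lf adj D s) (h : Same s s')
    (ha : adjOf s' = adjOf s) (hp : permOf s' = permOf s) : MatchInv N Lf adj D s' where
  inv := by rw [h.1, h.2]; exact hI.inv
  adj_eq := ha.trans hI.adj_eq
  perm_iff l := by rw [hp]; exact hI.perm_iff l
  lt_of_mem := hI.lt_of_mem
  lt_of_adj := hI.lt_of_adj

theorem adjOf_run {p : Prog} (h : p.writes .adj = false) (env : Var → ℕ) (s : State Arr) :
    adjOf (run N p env s) = adjOf s := by
  funext l r
  simp only [adjOf, mem_run_of_not_writes h]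

theorem permOf_run {p : Prog} (h : p.writes .perm = false) (env : Var → ℕ) (s : State Arr) :
    permOf (run N p env s) = permOf s := by
  funext l
  simp only [permOf, mem_run_of_not_writes h]

/-- The effect of matching `(i, h)` to `(a, b)`. -/
theorem run_tryEdge_of_act {env : Var → ℕ} (hz : env z = 0) {s : State Arr}
    (hs : ∀ l r, mateOf s l r → l.1 < N ∧ l.2 < N)
    (hact : ¬ actedOf s) (hadj : adjOf s (env i, env h) (env a, env b))
    (hP : ¬ priceOf s (env a, env b) (env c)) :
    actedOf (run N tryEdge env s) ∧
    (mateOf (run N tryEdge env s) = fun l' r' =>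
      (r' = (env a, env b) ∧ l' = (env i, env h)) ∨ (r' ≠ (env a, env b) ∧ mateOf s l' r')) ∧
    (priceOf (run N tryEdge env s) = fun r' c' =>
      (r' = (env a, env b) ∧ c' = env c) ∨ priceOf s r' c') := by
  simp only [actedOf, adjOf, priceOf] at hact hadj hP
  have hrun : run N tryEdge env s = (run N clearMate env ((s.put .acted (0, 0, 0, 0) true).put
      .price (env a, env b, env c, 0) true)).put .mate (env i, env h, env a, env b) true := by
    simp [tryEdge, run, key, hz, hact, hadj, hP]
  rw [hrun]
  refine ⟨?_, ?_, ?_⟩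
  · simp [actedOf, State.put, mem_run_clearMate]
  · funext l r
    obtain ⟨l1, l2⟩ := l
    obtain ⟨r1, r2⟩ := r
    have := hs (l1, l2) (r1, r2)
    simp only [mateOf] at this ⊢
    simp only [State.put, update_apply, mem_run_clearMate]
    simp only [Prod.mk.injEq, reduceCtorEq, false_and, if_false, true_and, eq_iff_iff]
    by_cases h1 : r1 = env a ∧ r2 = env b
    · by_cases h2 : l1 = env i ∧ l2 = env h
      · simp [h1, h2]
      · simp only [h1, and_true, ne_eq, not_true_eq_false, false_and, or_false, h2, true_and]
        rw [if_neg (by tauto)]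
        split_ifs with h3
        · simp
        · rw [h1.1, h1.2] at this
          simpa using fun h => h3 (this h)
    · rw [if_neg (by tauto), if_neg (by tauto)]
      simp [h1]
  · funext r c'
    obtain ⟨r1, r2⟩ := r
    simp only [priceOf, State.put, update_apply, mem_run_clearMate]
    simp only [Prod.mk.injEq, reduceCtorEq, false_and, if_false, true_and, eq_iff_iff]
    by_cases h1 : (r1 = env a ∧ r2 = env b) ∧ c' = env c
    · simp [h1]
    · rw [if_neg (by tauto)]
      simp [h1]

theorem run_tryEdge_of_not {env : Var → ℕ} (hz : env z = 0) {s : State Arr}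
    (h : actedOf s ∨ ¬ adjOf s (env i, env h) (env a, env b) ∨
      priceOf s (env a, env b) (env c)) :
    run N tryEdge env s = s := by
  simp only [actedOf, adjOf, priceOf] at h
  simp only [tryEdge, run, key, hz]
  split_ifs <;> simp_all

theorem same_run {p : Prog} (hm : p.writes .mate = false) (hp : p.writes .price = false)
    (env : Var → ℕ) (s : State Arr) : Same s (run N p env s) := by
  constructor
  · funext l r
    simp only [mateOf, mem_run_of_not_writes hm]
  · funext r c
    simp only [priceOf, mem_run_of_not_writes hp]

theorem actedOf_run_findMate {env : Var → ℕ} (hz : env z = 0) (s : State Arr) :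
    actedOf (run N findMate env s) ↔
      ∃ r : ℕ × ℕ, r.1 < N ∧ r.2 < N ∧ mateOf s (env i, env h) r := by
  set s0 := s.put .acted (0, 0, 0, 0) false with hs0
  have hrun : run N findMate env s = run N (loop a (loop b (ite .mate (i, h, a, b)
      (set .acted (z, z, z, z) true) skip))) env s0 := by
    simp only [findMate, run, key, hz, hs0]
  rw [hrun]
  have h0 : ¬ actedOf s0 := by simp [actedOf, hs0, State.put]
  have hmate : mateOf s0 = mateOf s := by
    funext l r
    simp [mateOf, hs0, State.put]
  rw [← hmate]
  have key := (run_loop_induct (N := N) (v := a) (p := loop b (ite .mate (i, h, a, b)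
      (set .acted (z, z, z, z) true) skip)) (env := env) (s := s0)
    (fun x s1 => mateOf s1 = mateOf s0 ∧ (actedOf s1 ↔
      ∃ r : ℕ × ℕ, r.1 < x ∧ r.2 < N ∧ mateOf s0 (env i, env h) r))
    ⟨rfl, by simp [h0]⟩ (fun x hx s1 h1 => ?_)).2
  · exact key
  · have key := run_loop_induct (N := N) (v := b) (p := ite .mate (i, h, a, b)
      (set .acted (z, z, z, z) true) skip) (env := update env a x) (s := s1)
      (fun y s2 => mateOf s2 = mateOf s0 ∧ (actedOf s2 ↔
        ∃ r : ℕ × ℕ, (r.1 < x ∧ r.2 < N ∨ r.1 = x ∧ r.2 < y) ∧ mateOf s0 (env i, env h) r))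
      ⟨h1.1, by simp [h1.2, and_assoc]⟩ (fun y hy s2 h2 => ?_)
    · refine ⟨key.1, key.2.trans (exists_congr fun r => ?_)⟩
      constructor
      · rintro ⟨h1, h2⟩
        exact ⟨by omega, by omega, h2⟩
      · rintro ⟨h1, h2, h3⟩
        exact ⟨by omega, h3⟩
    · simp only [run, ArrProg.key, update_apply, reduceCtorEq, if_false, if_true, hz]
      split_ifs with hc
      · have hc' : mateOf s0 (env i, env h) (x, y) := by rw [← h2.1]; exact hc
        refine ⟨?_, ?_⟩
        · rw [← h2.1]
          funext l r
          simp [mateOf, State.put]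
        · refine iff_of_true (by simp [actedOf, State.put]) ⟨(x, y), by simp, hc'⟩
      · have hc' : ¬ mateOf s0 (env i, env h) (x, y) := by rw [← h2.1]; exact hc
        refine ⟨h2.1, h2.2.trans (exists_congr fun r => ?_)⟩
        obtain ⟨r1, r2⟩ := r
        constructor
        · rintro ⟨h3, h4⟩
          exact ⟨by omega, h4⟩
        · rintro ⟨h3, h4⟩
          refine ⟨?_, h4⟩
          by_contra h5
          obtain ⟨rfl, rfl⟩ : r1 = x ∧ r2 = y := by omega
          exact hc' h4

/-- The state of the search for a cheapest neighbour of the unmatched left vertex `l`: either it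
has been successful, or the matching and the prices are those of `s` and `Q` lists the pairs of a
right vertex and a price bound that have been excluded. -/
def Search (N : ℕ) (Lf : Finset (ℕ × ℕ)) (adj : ℕ × ℕ → ℕ × ℕ → Prop) (D : Set (ℕ × ℕ))
    (l : ℕ × ℕ) (s s' : State Arr) (Q : ℕ × ℕ → ℕ → Prop) : Prop :=
  MatchInv N Lf adj D s' ∧ ((actedOf s' ∧ weight N s < weight N s' ∧ ¬ Settled N s l) ∨
    (¬ actedOf s' ∧ Same s s' ∧ ∀ r c, Q r c → adj l r → priceOf s r c))

theorem Search.mono {l : ℕ × ℕ} {s s' : State Arr} {Q Q' : ℕ × ℕ → ℕ → Prop}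
    (h : Search N Lf adj D l s s' Q) (hQ : ∀ r c, Q' r c → adj l r → Q r c) :
    Search N Lf adj D l s s' Q' :=
  ⟨h.1, h.2.imp id fun h' => ⟨h'.1, h'.2.1, fun r c hr ha => h'.2.2 r c (hQ r c hr ha) ha⟩⟩

/-- `tryEdge` continues the search: it excludes one more pair or applies `PriceInv.step`. As all the
smaller price bounds have been excluded, the neighbour that it finds is a cheapest one. -/
theorem search_tryEdge {env : Var → ℕ} (hz : env z = 0) {s s' : State Arr}
    {Q : ℕ × ℕ → ℕ → Prop} (hs : MatchInv N Lf adj D s)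
    (hS : Search N Lf adj D (env i, env h) s s' Q) (hl : (env i, env h) ∈ Lf)
    (hM : ∀ r, ¬ mateOf s (env i, env h) r) (hc : env c < N)
    (hQ : ∀ c' < env c, ∀ r, adj (env i, env h) r → Q r c') :
    Search N Lf adj D (env i, env h) s (run N tryEdge env s')
      (fun r c' => Q r c' ∨ (r = (env a, env b) ∧ c' = env c)) := by
  obtain ⟨hI, h1 | ⟨hact, hsame, hex⟩⟩ := hS
  · rw [run_tryEdge_of_not hz (.inl h1.1)]
    exact ⟨hI, .inl h1⟩
  · by_cases hcond : ¬ adjOf s' (env i, env h) (env a, env b) ∨ priceOf s' (env a, env b) (env c)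
    · rw [run_tryEdge_of_not hz (.inr hcond)]
      refine ⟨hI, .inr ⟨hact, hsame, ?_⟩⟩
      rintro r c' (hr | ⟨rfl, rfl⟩) ha
      · exact hex r c' hr ha
      · rw [hI.adj_eq, hsame.2] at hcond
        exact hcond.resolve_left fun h' => h' ha
    · push Not at hcond
      obtain ⟨h1, h2, h3⟩ := run_tryEdge_of_act hz
        (fun l r hlr => hI.lt_of_mem l (hI.inv.mem_left hlr)) hact hcond.1 hcond.2
      have hadj := hcond.1
      have hP := hcond.2
      rw [hI.adj_eq] at hadj
      rw [hsame.2] at hP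
      refine ⟨⟨?_, ?_, ?_, hI.lt_of_mem, hI.lt_of_adj⟩, .inl ⟨h1, ?_, ?_⟩⟩
      · rw [h2, h3, hsame.1, hsame.2]
        exact hs.inv.step hl hM hadj hP fun c' hc' r' ha => hex r' c' (hQ c' hc' r' ha) ha
      · rw [adjOf_run (by decide), hI.adj_eq]
      · rw [permOf_run (by decide)]
        exact hI.perm_iff
      · rw [hsame.2] at h3
        exact weight_lt (hI.lt_of_adj _ _ hadj).1 (hI.lt_of_adj _ _ hadj).2 hc hP h3
      · rintro (⟨r, hr⟩ | hfull)
        · exact hM r hr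
        · exact hP (hfull _ (by rw [hs.adj_eq]; exact hadj) _ hc)

/-- The treatment of a left vertex has no effect if the vertex is settled, and increases the sum of
the prices otherwise. -/
theorem matchOne_spec {env : Var → ℕ} (hz : env z = 0) {s : State Arr}
    (hs : MatchInv N Lf adj D s) (hl : (env i, env h) ∈ Lf) :
    MatchInv N Lf adj D (run N matchOne env s) ∧
      ((Same s (run N matchOne env s) ∧ Settled N s (env i, env h)) ∨
        (weight N s < weight N (run N matchOne env s) ∧ ¬ Settled N s (env i, env h))) := by
  set s1 := run N findMate env s with hs1
  have hsame : Same s s1 := same_run (by decide) (by decide) env s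
  have hI1 : MatchInv N Lf adj D s1 :=
    hs.congr hsame (adjOf_run (by decide) env s) (permOf_run (by decide) env s)
  have hact : actedOf s1 ↔ ∃ r, mateOf s (env i, env h) r := by
    rw [actedOf_run_findMate hz]
    refine exists_congr fun r => ⟨fun h => h.2.2, fun h => ⟨?_, ?_, h⟩⟩
    · exact (hs.lt_of_adj _ _ (hs.inv.adj_of_mate h)).1
    · exact (hs.lt_of_adj _ _ (hs.inv.adj_of_mate h)).2
  change MatchInv N Lf adj D (run N (loop c (loop a (loop b tryEdge))) env s1) ∧
      ((Same s (run N (loop c (loop a (loop b tryEdge))) env s1) ∧ _) ∨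
        (weight N s < weight N (run N (loop c (loop a (loop b tryEdge))) env s1) ∧ _))
  by_cases hm : actedOf s1
  · have : run N (loop c (loop a (loop b tryEdge))) env s1 = s1 := by
      refine run_loop_induct (fun _ s' => s' = s1) rfl fun x _ s' h1 => ?_
      refine run_loop_induct (fun _ s' => s' = s1) h1 fun y _ s' h2 => ?_
      refine run_loop_induct (fun _ s' => s' = s1) h2 fun w _ s' h3 => ?_
      rw [h3]
      exact run_tryEdge_of_not (by simp [hz]) (.inl hm)
    rw [this]
    exact ⟨hI1, .inl ⟨hsame, .inl (hact.mp hm)⟩⟩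
  · have hM : ∀ r, ¬ mateOf s (env i, env h) r := fun r hr => hm (hact.mpr ⟨r, hr⟩)
    have key : Search N Lf adj D (env i, env h) s
        (run N (loop c (loop a (loop b tryEdge))) env s1) (fun _ c' => c' < N) := by
      refine run_loop_induct (fun x s' => Search N Lf adj D (env i, env h) s s'
        (fun _ c' => c' < x)) ⟨hI1, .inr ⟨hm, hsame, by simp⟩⟩ fun x hx s' h1 => ?_
      have key : Search N Lf adj D (env i, env h) s
          (run N (loop a (loop b tryEdge)) (update env c x) s')
          (fun r c' => c' < x ∨ c' = x ∧ r.1 < N) := by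
        refine run_loop_induct (fun y s' => Search N Lf adj D (env i, env h) s s'
          (fun r c' => c' < x ∨ c' = x ∧ r.1 < y)) (h1.mono fun r c' hr _ => by simpa using hr)
          fun y hy s' h2 => ?_
        have key : Search N Lf adj D (env i, env h) s
            (run N (loop b tryEdge) (update (update env c x) a y) s')
            (fun r c' => c' < x ∨ c' = x ∧ (r.1 < y ∨ r.1 = y ∧ r.2 < N)) := by
          refine run_loop_induct (fun w s' => Search N Lf adj D (env i, env h) s s'
            (fun r c' => c' < x ∨ c' = x ∧ (r.1 < y ∨ r.1 = y ∧ r.2 < w)))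
            (h2.mono fun r c' hr _ => by simpa using hr) fun w hw s' h3 => ?_
          have := search_tryEdge (N := N) (env := update (update (update env c x) a y) b w)
            (by simpa using hz) hs (by simpa using h3) (by simpa using hl) (by simpa using hM)
            (by simpa using hx) (by simp +contextual)
          simp only [update_apply, reduceCtorEq, if_false, if_true] at this
          refine this.mono ?_
          rintro ⟨r1, r2⟩ c' hr -
          simp only [Prod.mk.injEq] at hr ⊢
          omega
        refine key.mono ?_
        rintro ⟨r1, r2⟩ c' hr ha
        have := hs.lt_of_adj _ _ ha
        simp only at hr this ⊢
        omega
      refine key.mono ?_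
      rintro ⟨r1, r2⟩ c' hr ha
      have := hs.lt_of_adj _ _ ha
      simp only at hr this ⊢
      omega
    obtain ⟨hI, ⟨-, h1, h2⟩ | ⟨-, h1, h2⟩⟩ := key
    · exact ⟨hI, .inr ⟨h1, h2⟩⟩
    · refine ⟨hI, .inl ⟨h1, .inr fun r ha c' hc' => h2 r c' hc' ?_⟩⟩
      rwa [hs.adj_eq] at ha

/-- The state of a pass through the left vertices that starts in `s`, after the treatment of the
left vertices in `Q`: either nothing has changed and these vertices are settled, or the sum of the
prices has grown. -/
def Pass (N : ℕ) (Lf : Finset (ℕ × ℕ)) (adj : ℕ × ℕ → ℕ × ℕ → Prop) (D : Set (ℕ × ℕ))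
    (s s' : State Arr) (Q : ℕ × ℕ → Prop) : Prop :=
  MatchInv N Lf adj D s' ∧ ((Same s s' ∧ ∀ l ∈ Lf, Q l → Settled N s l) ∨
    (weight N s < weight N s' ∧ ∃ l ∈ Lf, ¬ Settled N s l))

theorem Pass.mono {s s' : State Arr} {Q Q' : ℕ × ℕ → Prop} (h : Pass N Lf adj D s s' Q)
    (hQ : ∀ l ∈ Lf, Q' l → Q l) : Pass N Lf adj D s s' Q' :=
  ⟨h.1, h.2.imp (fun h' => ⟨h'.1, fun l hl hl' => h'.2 l hl (hQ l hl hl')⟩) id⟩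

theorem pass_matchOne {env : Var → ℕ} (hz : env z = 0) {s s' : State Arr} {Q : ℕ × ℕ → Prop}
    (hs : MatchInv N Lf adj D s) (hpass : Pass N Lf adj D s s' Q) :
    Pass N Lf adj D s (run N (ite .perm (i, h, z, z) matchOne skip) env s')
      (fun l => Q l ∨ l = (env i, env h)) := by
  obtain ⟨hI, hpass⟩ := hpass
  by_cases hl : (env i, env h) ∈ Lf
  · have hperm := (hI.perm_iff _).mpr hl
    have hrun : run N (ite .perm (i, h, z, z) matchOne skip) env s' = run N matchOne env s' := by
      simp only [permOf] at hperm
      simp only [run, key, hz]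
      rw [if_pos hperm]
    rw [hrun]
    obtain ⟨hI', h'⟩ := matchOne_spec hz hI hl
    refine ⟨hI', ?_⟩
    obtain ⟨hsame, hset⟩ | ⟨hlt, hex⟩ := hpass
    · have hcongr : Settled N s' (env i, env h) ↔ Settled N s (env i, env h) :=
        Settled.congr hsame (by rw [hI.adj_eq, hs.adj_eq])
      have hweight := weight_congr (N := N) hsame.2
      obtain ⟨h1, h2⟩ | ⟨h1, h2⟩ := h'
      · refine .inl ⟨⟨h1.1.trans hsame.1, h1.2.trans hsame.2⟩, ?_⟩
        rintro l hl (hQ | rfl)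
        exacts [hset l hl hQ, hcongr.mp h2]
      · exact .inr ⟨by omega, _, hl, fun h3 => h2 (hcongr.mpr h3)⟩
    · refine .inr ⟨?_, hex⟩
      obtain ⟨h1, -⟩ | ⟨h1, -⟩ := h'
      · rwa [weight_congr h1.2]
      · omega
  · have hrun : run N (ite .perm (i, h, z, z) matchOne skip) env s' = s' := by
      have hperm := mt (hI.perm_iff _).mp hl
      simp only [permOf] at hperm
      simp only [run, key, hz]
      rw [if_neg hperm]
    rw [hrun]
    refine Pass.mono ⟨hI, hpass⟩ ?_
    rintro l hl' (hQ | rfl)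
    exacts [hQ, (hl hl').elim]

theorem matchAll_spec {env : Var → ℕ} (hz : env z = 0) {s : State Arr}
    (hs : MatchInv N Lf adj D s) :
    Pass N Lf adj D s (run N matchAll env s) (fun _ => True) := by
  have key : Pass N Lf adj D s (run N matchAll env s) (fun l => l.1 < N) := by
    refine run_loop_induct (fun x s' => Pass N Lf adj D s s' (fun l => l.1 < x))
      ⟨hs, .inl ⟨⟨rfl, rfl⟩, by simp⟩⟩ fun x hx s' h1 => ?_
    have key : Pass N Lf adj D s
        (run N (loop h (ite .perm (i, h, z, z) matchOne skip)) (update env i x) s')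
        (fun l => l.1 < x ∨ l.1 = x ∧ l.2 < N) := by
      refine run_loop_induct (fun y s' => Pass N Lf adj D s s'
        (fun l => l.1 < x ∨ l.1 = x ∧ l.2 < y)) (h1.mono fun l _ hl => by simpa using hl)
        fun y hy s' h2 => ?_
      have := pass_matchOne (N := N) (env := update (update env i x) h y) (by simpa using hz) hs h2
      simp only [update_apply, reduceCtorEq, if_false, if_true] at this
      refine this.mono ?_
      rintro ⟨l1, l2⟩ - hl
      simp only [Prod.mk.injEq] at hl ⊢
      omega
    refine key.mono fun l hl hl' => ?_
    have := hs.lt_of_mem l hl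
    omega
  exact key.mono fun l hl _ => (hs.lt_of_mem l hl).1

/-- If a program achieves `q` units of progress, then a loop achieves `N` times as many. -/
theorem run_loop_progress {p : Prog} {v : Var} (hv : v ≠ z) {q : ℕ} {I : ℕ → State Arr → Prop}
    (hp : ∀ env : Var → ℕ, env z = 0 → ∀ k s, I k s → I (k + q) (run N p env s)) :
    ∀ env : Var → ℕ, env z = 0 → ∀ k s, I k s → I (k + N * q) (run N (loop v p) env s) := by
  intro env hz k s hI
  refine run_loop_induct (fun x s' => I (k + x * q) s') (by simpa using hI) fun x _ s' h1 => ?_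
  have := hp (update env v x) (by rwa [update_of_ne hv.symm]) _ _ h1
  rwa [Nat.succ_mul, ← Nat.add_assoc]

/-- Since the sum of the prices is at most `N ^ 3`, the repetition of `matchAll` comes to a state in
which it has no effect. -/
theorem matching_spec (hN : 2 ≤ N) {env : Var → ℕ} (hz : env z = 0) {s : State Arr}
    (hs : MatchInv N Lf adj D s) :
    MatchInv N Lf adj D (run N matching env s) ∧
      ∀ l ∈ Lf, Settled N (run N matching env s) l := by
  have hpass : ∀ env : Var → ℕ, env z = 0 → ∀ k s,
      (MatchInv N Lf adj D s ∧ (k ≤ weight N s ∨ ∀ l ∈ Lf, Settled N s l)) →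
      (MatchInv N Lf adj D (run N matchAll env s) ∧ (k + 1 ≤ weight N (run N matchAll env s) ∨
        ∀ l ∈ Lf, Settled N (run N matchAll env s) l)) := by
    rintro env hz k s ⟨hI, h1⟩
    obtain ⟨hI', ⟨h2, h3⟩ | ⟨h2, l, hl, h3⟩⟩ := matchAll_spec hz hI
    · refine ⟨hI', .inr fun l hl => ?_⟩
      rw [Settled.congr h2 (by rw [hI.adj_eq, hI'.adj_eq])]
      exact h3 l hl trivial
    · have := h1.resolve_right fun h4 => h3 (h4 l hl)
      exact ⟨hI', .inl (by omega)⟩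
  obtain ⟨hI, h1⟩ := run_loop_progress (N := N) (v := t 0) (by simp)
    (run_loop_progress (N := N) (v := t 1) (by simp)
      (run_loop_progress (N := N) (v := t 2) (by simp)
        (run_loop_progress (N := N) (v := t 3) (by simp) hpass))) env hz 0 s ⟨hs, .inl (by omega)⟩
  -- if no pass had been without effect, the sum of the prices would be at least `N ^ 4`
  refine ⟨hI, h1.resolve_left fun h2 => ?_⟩
  have h3 : N * (N * (N * (N * 1))) = N ^ 3 * N := by ring
  have h4 : N ^ 3 * 2 ≤ N ^ 3 * N := Nat.mul_le_mul_left _ hN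
  have h5 : 0 < N ^ 3 := by positivity
  have h6 := weight_le N (run N matching env s)
  change 0 + N * (N * (N * (N * 1))) ≤ weight N (run N matching env s) at h2
  omega

end MRM

/-! ### Reading the instance -/

namespace MRM

open ArrProg Function Var

variable {N : ℕ}

/-- Read a number in unary, executing `body` for each unit. The variable `c` runs through the
values at which the array `g` does not hold. -/
def readUnary (g : Arr) (body : Prog) : Prog :=
  seq (set .done (z, z, z, z) false) (loop c (ite g (c, z, z, z) skip
    (ite .done (z, z, z, z) skip (seq (read .bit (z, z, z, z))
      (ite .bit (z, z, z, z) body (set .done (z, z, z, z) true))))))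

/-- Read the numbers of agents, of resources and of rounds. The agents get the indices
`0, …, n - 1`, the resources `n, …, n + m - 1` and the rounds `0, …, k - 1`. -/
def readHeader : Prog :=
  seq (readUnary .zero (set .agent (c, z, z, z) true))
    (seq (readUnary .agent (set .resource (c, z, z, z) true))
      (readUnary .zero (set .round (c, z, z, z) true)))

/-- Read the compatibility graph. -/
def readEdges : Prog :=
  loopIf i .agent (i, z, z, z) (loopIf a .resource (a, z, z, z) (seq (read .bit (z, z, z, z))
    (ite .bit (z, z, z, z) (loop h (set .adj (i, h, a, h) true)) skip)))

/-- Read the permissible rounds of the agent `i`. -/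
def readRounds : Prog :=
  loopIf h .round (h, z, z, z) (seq (read .bit (z, z, z, z))
    (ite .bit (z, z, z, z) (seq (set .perm (i, h, z, z) true) (set .dummy (i, h, z, z) true)) skip))

/-- Remove the first right vertex that belongs to the agent `i`. -/
def dropDummy : Prog :=
  seq (set .acted (z, z, z, z) false) (loop h (ite .acted (z, z, z, z) skip
    (ite .dummy (i, h, z, z) (seq (set .dummy (i, h, z, z) false) (set .acted (z, z, z, z) true))
      skip)))

/-- Connect the right vertices that belong to the agent `i` with the left vertices of `i`, and
match them. -/
def addDummies : Prog :=
  loop h (ite .dummy (i, h, z, z) (seq (set .mate (i, h, i, h) true)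
    (loop h' (set .adj (i, h', i, h) true))) skip)

/-- Read the permissible rounds and the demands of all the agents. -/
def readAgents : Prog :=
  loopIf i .agent (i, z, z, z) (seq readRounds (seq (readUnary .zero dropDummy) addDummies))

theorem encodeUnary_zero : encodeUnary 0 = [false] := rfl

theorem encodeUnary_succ (n : ℕ) : encodeUnary (n + 1) = true :: encodeUnary n := rfl

/-- The invariant rule for `readUnary`, when `g` holds at the positions below `lo`: the body is
executed for the values `lo, …, lo + x - 1` of `c`. An invariant must not depend on the arrays `bit`
and `done`. -/
theorem run_readUnary {g : Arr} {body : Prog} (hw : body.writes .done = false)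
    (hr : body.reads = false) {env : Var → ℕ} (hz : env z = 0) {x lo : ℕ} (hN : lo + x < N)
    {rest : List Bool} {s : State Arr} (hinp : s.inp = encodeUnary x ++ rest)
    (I : ℕ → State Arr → Prop)
    (hcongr : ∀ j s s', (∀ a k, a ≠ .bit → a ≠ .done → s'.mem (a, k) = s.mem (a, k)) →
      I j s → I j s')
    (hg : ∀ j s, I j s → ∀ i < N, (s.mem (g, i, 0, 0, 0) = true ↔ i < lo))
    (h0 : I 0 s) (hs : ∀ j < x, ∀ s, I j s → I (j + 1) (run N body (update env c (lo + j)) s)) :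
    I x (run N (readUnary g body) env s) ∧ (run N (readUnary g body) env s).inp = rest := by
  have key := run_loop_induct (N := N) (v := c) (p := ite g (c, z, z, z) skip
    (ite .done (z, z, z, z) skip (seq (read .bit (z, z, z, z))
      (ite .bit (z, z, z, z) body (set .done (z, z, z, z) true))))) (env := env)
    (s := run N (set .done (z, z, z, z) false) env s)
    (fun i s' => I (min (i - lo) x) s' ∧
      ((i ≤ lo + x ∧ s'.mem (.done, 0, 0, 0, 0) = false ∧
        s'.inp = encodeUnary (x - (i - lo)) ++ rest) ∨
      (lo + x < i ∧ s'.mem (.done, 0, 0, 0, 0) = true ∧ s'.inp = rest)))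
    ⟨hcongr _ s _ (fun a k _ ha => by simp [run, State.put, ha]) (by simpa using h0),
      .inl ⟨by omega, by simp [run, State.put, key, hz], by simpa [run, State.put] using hinp⟩⟩
    (fun i hi s1 h1 => ?_)
  · rw [show min (N - lo) x = x by omega] at key
    obtain ⟨h1, h2 | h2⟩ := key
    · omega
    · exact ⟨h1, h2.2.2⟩
  · obtain ⟨hI, h1⟩ := h1
    have hgi := hg _ _ hI i hi
    by_cases hlo : i < lo
    · have hrun : run N (ite g (c, z, z, z) skip
          (ite .done (z, z, z, z) skip (seq (read .bit (z, z, z, z))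
          (ite .bit (z, z, z, z) body (set .done (z, z, z, z) true))))) (update env c i) s1 =
          s1 := by
        simp [run, key, hz, hgi.mpr hlo]
      rw [hrun, show i + 1 - lo = 0 by omega]
      rw [show i - lo = 0 by omega] at hI h1
      refine ⟨hI, ?_⟩
      rcases h1 with h1 | h1
      · exact .inl ⟨by omega, h1.2⟩
      · omega
    · rcases h1 with ⟨hle, hd, hin⟩ | ⟨hgt, hd, hin⟩
      · rcases Nat.lt_or_ge i (lo + x) with hlt | hge
        · obtain ⟨y, hy⟩ : ∃ y, x - (i - lo) = y + 1 := ⟨x - (i - lo) - 1, by omega⟩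
          rw [hy, encodeUnary_succ] at hin
          set s2 : State Arr := { mem := update s1.mem (.bit, 0, 0, 0, 0) true
                                  inp := encodeUnary y ++ rest, out := s1.out } with hs2
          have hrun : run N (ite g (c, z, z, z) skip
              (ite .done (z, z, z, z) skip (seq (read .bit (z, z, z, z))
              (ite .bit (z, z, z, z) body (set .done (z, z, z, z) true))))) (update env c i) s1 =
              run N body (update env c i) s2 := by
            simp [run, key, hz, hgi, hlo, hd, hin, hs2]
          rw [hrun]
          have hI2 : I (i - lo) s2 := by
            refine hcongr _ s1 _ (fun a k ha _ => by simp [hs2, ha]) ?_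
            rwa [min_eq_left (by omega)] at hI
          have := hs (i - lo) (by omega) s2 hI2
          rw [show lo + (i - lo) = i by omega] at this
          rw [show min (i + 1 - lo) x = i - lo + 1 by omega]
          refine ⟨this, .inl ⟨by omega, ?_, ?_⟩⟩
          · rw [mem_run_of_not_writes hw]
            simpa [hs2] using hd
          · rw [inp_run_of_not_reads hr, show x - (i + 1 - lo) = y by omega]
        · obtain rfl : i = lo + x := by omega
          rw [show x - (lo + x - lo) = 0 by omega, encodeUnary_zero] at hin
          have hrun : run N (ite g (c, z, z, z) skip
              (ite .done (z, z, z, z) skip (seq (read .bit (z, z, z, z))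
              (ite .bit (z, z, z, z) body (set .done (z, z, z, z) true)))))
              (update env c (lo + x)) s1 =
              State.put { mem := update s1.mem (.bit, 0, 0, 0, 0) false
                          inp := rest, out := s1.out } .done (0, 0, 0, 0) true := by
            simp [run, key, hz, hgi, hd, hin]
          rw [hrun]
          refine ⟨hcongr _ s1 _ (fun a k ha ha' => by simp [State.put, ha, ha']) ?_,
            .inr ⟨by omega, by simp [State.put], by simp [State.put]⟩⟩
          rwa [show min (lo + x + 1 - lo) x = min (lo + x - lo) x by omega]
      · have hrun : run N (ite g (c, z, z, z) skip
            (ite .done (z, z, z, z) skip (seq (read .bit (z, z, z, z))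
            (ite .bit (z, z, z, z) body (set .done (z, z, z, z) true))))) (update env c i) s1 =
            s1 := by
          simp [run, key, hz, hgi, hlo, hd]
        rw [hrun]
        refine ⟨?_, .inr ⟨by omega, hd, hin⟩⟩
        rwa [show min (i + 1 - lo) x = min (i - lo) x by omega]

/-- The array `a` is the characteristic function of the interval from `lo` to `hi - 1`. -/
def Interval (s : State Arr) (a : Arr) (lo hi : ℕ) : Prop :=
  ∀ i, s.mem (a, i, 0, 0, 0) = true ↔ lo ≤ i ∧ i < hi

theorem Interval.run {p : Prog} {a : Arr} (h : p.writes a = false) {s : State Arr} {lo hi : ℕ}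
    (hs : Interval s a lo hi) (env : Var → ℕ) : Interval (run N p env s) a lo hi := fun i => by
  rw [mem_run_of_not_writes h]
  exact hs i

/-- Reading a number in unary while marking its units in the array `a`, next to those in `g`. -/
theorem run_readTag {g a : Arr} (ha : a ≠ .bit) (ha' : a ≠ .done) (hg : g ≠ .bit) (hg' : g ≠ .done)
    (hag : a ≠ g) {env : Var → ℕ} (hz : env z = 0) {x lo : ℕ} (hN : lo + x < N)
    {rest : List Bool} {s : State Arr} (hinp : s.inp = encodeUnary x ++ rest)
    (hlo : Interval s g 0 lo) (hs : Interval s a 0 0) :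
    Interval (run N (readUnary g (set a (c, z, z, z) true)) env s) a lo (lo + x) ∧
      (run N (readUnary g (set a (c, z, z, z) true)) env s).inp = rest := by
  have key := run_readUnary (N := N) (g := g) (body := set a (c, z, z, z) true)
    (by simpa [writes] using ha') rfl hz hN hinp
    (fun j s => Interval s g 0 lo ∧ Interval s a lo (lo + j)) (fun j s s' hss h => ?_)
    (fun j s h i _ => by simpa using h.1 i) ⟨hlo, fun i => ?_⟩ (fun j hj s h => ?_)
  · exact ⟨key.1.2, key.2⟩
  · refine ⟨fun i => ?_, fun i => ?_⟩
    · rw [hss _ _ hg hg']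
      exact h.1 i
    · rw [hss _ _ ha ha']
      exact h.2 i
  · rw [hs i]
    omega
  · refine ⟨h.1.run (by simp [writes, hag]) _, fun i => ?_⟩
    have := h.2 i
    simp only [run, State.put, update_apply, key, reduceCtorEq, if_false, if_true, hz,
      Prod.mk.injEq, true_and, and_true]
    split_ifs with hi
    · simp only [true_iff]
      omega
    · rw [this]
      omega

/-- The arrays that describe the numbers of agents, resources and rounds. -/
structure Header (n m k : ℕ) (s : State Arr) : Prop where
  agent : Interval s .agent 0 n
  resource : Interval s .resource n (n + m)
  round : Interval s .round 0 k
  zero : Interval s .zero 0 0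

theorem Header.run {n m k : ℕ} {s : State Arr} (hs : Header n m k s) {p : Prog}
    (h1 : p.writes .agent = false) (h2 : p.writes .resource = false) (h3 : p.writes .round = false)
    (h4 : p.writes .zero = false) (env : Var → ℕ) : Header n m k (run N p env s) :=
  ⟨hs.agent.run h1 env, hs.resource.run h2 env, hs.round.run h3 env, hs.zero.run h4 env⟩

theorem run_readHeader {env : Var → ℕ} (hz : env z = 0) {n m k : ℕ} (hN : n + m + k < N)
    {rest : List Bool} {s : State Arr}
    (hinp : s.inp = encodeUnary n ++ (encodeUnary m ++ (encodeUnary k ++ rest)))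
    (hs : s.mem = fun _ => false) :
    Header n m k (run N readHeader env s) ∧ (run N readHeader env s).inp = rest := by
  have h0 : ∀ a, Interval s a 0 0 := fun a i => by simp [hs]
  obtain ⟨h1, h1'⟩ := run_readTag (N := N) (g := .zero) (a := .agent) (by simp) (by simp) (by simp)
    (by simp) (by simp) hz (by omega) hinp (h0 _) (h0 _)
  rw [Nat.zero_add] at h1
  obtain ⟨h2, h2'⟩ := run_readTag (N := N) (g := .agent) (a := .resource) (by simp) (by simp)
    (by simp) (by simp) (by simp) hz (by omega) h1' h1 ((h0 _).run (by decide) env)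
  obtain ⟨h3, h3'⟩ := run_readTag (N := N) (g := .zero) (a := .round) (by simp) (by simp) (by simp)
    (by simp) (by simp) hz (by omega) h2' (((h0 _).run (by decide) env).run (by decide) env)
    (((h0 _).run (by decide) env).run (by decide) env)
  rw [Nat.zero_add] at h3
  exact ⟨⟨(h1.run (by decide) env).run (by decide) env, h2.run (by decide) env, h3,
    (((h0 _).run (by decide) env).run (by decide) env).run (by decide) env⟩, h3'⟩

theorem run_loopIf {a : Arr} {v : Var} (hv : v ≠ z) {p : Prog} {env : Var → ℕ} (hz : env z = 0)
    {s : State Arr} {lo cnt : ℕ} (hN : lo + cnt ≤ N) (I : ℕ → State Arr → Prop)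
    (hg : ∀ j s, I j s → Interval s a lo (lo + cnt)) (h0 : I 0 s)
    (hs : ∀ j < cnt, ∀ s, I j s → I (j + 1) (run N p (update env v (lo + j)) s)) :
    I cnt (run N (loopIf v a (v, z, z, z) p) env s) := by
  refine run_loopIf_induct hN I (fun j s hI i _ => ?_) h0 hs
  simpa [key, hv.symm, hz] using hg j s hI i

/-- Reading a bit and executing `p` if it is one. -/
theorem run_readBit {p : Prog} {env : Var → ℕ} (hz : env z = 0) {s : State Arr} {b : Bool}
    {rest : List Bool} (hinp : s.inp = b :: rest) :
    run N (seq (read .bit (z, z, z, z)) (ite .bit (z, z, z, z) p skip)) env s =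
      if b then run N p env ⟨update s.mem (.bit, 0, 0, 0, 0) b, rest, s.out⟩
      else ⟨update s.mem (.bit, 0, 0, 0, 0) b, rest, s.out⟩ := by
  simp [run, key, hz, hinp]

theorem adjOf_run_edge {env : Var → ℕ} (s : State Arr) :
    adjOf (run N (loop h (set .adj (i, h, a, h) true)) env s) = fun l r =>
      adjOf s l r ∨ (l.1 = env i ∧ r.1 = env a ∧ r.2 = l.2 ∧ l.2 < N) := by
  refine run_loop_induct (fun x s' => adjOf s' = fun l r =>
      adjOf s l r ∨ (l.1 = env i ∧ r.1 = env a ∧ r.2 = l.2 ∧ l.2 < x)) (by simp)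
    fun x hx s' h1 => ?_
  funext l r
  have h2 := congrFun (congrFun h1 l) r
  simp only [adjOf, eq_iff_iff] at h2 ⊢
  simp only [run, State.put, update_apply, key, reduceCtorEq, if_false, if_true, Prod.mk.injEq,
    true_and]
  split_ifs with hc
  · simp only [true_iff]
    exact .inr ⟨hc.1, hc.2.2.1, by omega, by omega⟩
  · rw [h2]
    refine or_congr_right ⟨fun h3 => ⟨h3.1, h3.2.1, h3.2.2.1, by omega⟩,
      fun h3 => ⟨h3.1, h3.2.1, h3.2.2.1, ?_⟩⟩
    by_contra h4
    exact hc ⟨h3.1, by omega, h3.2.1, by omega⟩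

/-- The adjacency of left vertices and right vertices that belong to resources. -/
def RealAdj (N n m : ℕ) (e : ℕ → ℕ → Bool) (l r : ℕ × ℕ) : Prop :=
  l.2 < N ∧ r.2 = l.2 ∧ l.1 < n ∧ n ≤ r.1 ∧ r.1 < n + m ∧ e l.1 (r.1 - n) = true

theorem run_readEdges {env : Var → ℕ} (hz : env z = 0) {n m k : ℕ} (hN : n + m + k < N)
    {e : ℕ → ℕ → Bool} {rest : List Bool} {s : State Arr} (hs : Header n m k s)
    (hinp : s.inp = ((List.range' 0 n).map fun i => (List.range' 0 m).map (e i)).flatten ++ rest)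
    (hadj : ∀ l r, ¬ adjOf s l r) :
    adjOf (run N readEdges env s) = RealAdj N n m e ∧ (run N readEdges env s).inp = rest := by
  have key := run_loopIf (N := N) (a := .agent) (v := i) (p := loopIf a .resource (a, z, z, z)
    (seq (read .bit (z, z, z, z)) (ite .bit (z, z, z, z) (loop h (set .adj (i, h, a, h) true))
      skip))) (by simp) hz (s := s) (lo := 0) (cnt := n) (by omega)
    (fun x s' => Header n m k s' ∧
      s'.inp = ((List.range' x (n - x)).map fun i => (List.range' 0 m).map (e i)).flatten ++ rest ∧
      adjOf s' = fun l r => l.2 < N ∧ r.2 = l.2 ∧ l.1 < x ∧ n ≤ r.1 ∧ r.1 < n + m ∧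
        e l.1 (r.1 - n) = true)
    (fun x s' h => by simpa using h.1.agent) ⟨hs, hinp, ?_⟩ (fun x hx s' h => ?_)
  · exact ⟨key.2.2, by simpa [readEdges, readRounds] using key.2.1⟩
  · funext l r
    simp [hadj l r]
  · rw [Nat.zero_add]
    set rest' := ((List.range' (x + 1) (n - (x + 1))).map fun i =>
      (List.range' 0 m).map (e i)).flatten ++ rest with hrest'
    have hinp' : s'.inp = (List.range' 0 m).map (e x) ++ rest' := by
      obtain ⟨q, hq⟩ : ∃ q, n - x = q + 1 := ⟨n - x - 1, by omega⟩
      rw [h.2.1, hq, List.range'_succ, hrest', show n - (x + 1) = q by omega]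
      simp
    have key := run_loopIf (N := N) (a := .resource) (v := Var.a) (p :=
      (seq (read .bit (z, z, z, z)) (ite .bit (z, z, z, z)
        (loop Var.h (set .adj (i, Var.h, a, Var.h) true)) skip)))
      (env := update env i x) (by simp) (by simpa using hz)
      (s := s') (lo := n) (cnt := m) (by omega)
      (fun y s' => Header n m k s' ∧ s'.inp = (List.range' y (m - y)).map (e x) ++ rest' ∧
        adjOf s' = fun l r => l.2 < N ∧ r.2 = l.2 ∧ n ≤ r.1 ∧ r.1 < n + m ∧
          (l.1 < x ∨ l.1 = x ∧ r.1 < n + y) ∧ e l.1 (r.1 - n) = true)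
      (fun x s' h => h.1.resource) ⟨h.1, hinp', ?_⟩ (fun y hy s' h => ?_)
    · refine ⟨key.1, by simpa using key.2.1, key.2.2.trans ?_⟩
      funext l r
      simp only [eq_iff_iff]
      constructor
      · rintro ⟨h1, h2, h3, h4, h5, h6⟩
        exact ⟨h1, h2, by omega, h3, h4, h6⟩
      · rintro ⟨h1, h2, h3, h4, h5, h6⟩
        exact ⟨h1, h2, h4, h5, by omega, h6⟩
    · rw [h.2.2]
      funext l r
      simp only [eq_iff_iff]
      constructor
      · rintro ⟨h1, h2, h3, h4, h5, h6⟩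
        exact ⟨h1, h2, h4, h5, by omega, h6⟩
      · rintro ⟨h1, h2, h3, h4, h5, h6⟩
        exact ⟨h1, h2, by omega, h3, h4, h6⟩
    · refine ⟨h.1.run (by decide) (by decide) (by decide) (by decide) _, ?_⟩
      obtain ⟨q, hq⟩ : ∃ q, m - y = q + 1 := ⟨m - y - 1, by omega⟩
      have hq' : m - (y + 1) = q := by omega
      have hin := h.2.1
      rw [hq, List.range'_succ, List.map_cons, List.cons_append] at hin
      rw [run_readBit (by simpa using hz) hin]
      cases hb : e x y with
      | false =>
        refine ⟨by simp [hq'], ?_⟩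
        simp only [Bool.false_eq_true, if_false]
        have : ∀ l r, adjOf (⟨update s'.mem (.bit, 0, 0, 0, 0) false,
            (List.range' (y + 1) q).map (e x) ++ rest', s'.out⟩) l r = adjOf s' l r := by
          intro l r
          simp [adjOf]
        funext l r
        rw [this, h.2.2]
        simp only [eq_iff_iff]
        constructor
        · rintro ⟨h1, h2, h3, h4, h5, h6⟩
          exact ⟨h1, h2, h3, h4, by omega, h6⟩
        · rintro ⟨h1, h2, h3, h4, h5, h6⟩
          refine ⟨h1, h2, h3, h4, ?_, h6⟩
          rcases h5 with h5 | ⟨h5, h7⟩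
          · exact .inl h5
          · refine .inr ⟨h5, ?_⟩
            by_contra h8
            rw [h5, show r.1 - n = y by omega, hb] at h6
            cases h6
      | true =>
        simp only [if_true]
        refine ⟨by rw [inp_run_of_not_reads (by decide), hq'], ?_⟩
        rw [adjOf_run_edge]
        have : ∀ l r, adjOf (⟨update s'.mem (.bit, 0, 0, 0, 0) true,
            (List.range' (y + 1) q).map (e x) ++ rest', s'.out⟩) l r = adjOf s' l r := by
          intro l r
          simp [adjOf]
        funext l r
        rw [this, h.2.2]
        simp only [update_apply, reduceCtorEq, if_false, if_true, eq_iff_iff]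
        constructor
        · rintro (⟨h1, h2, h3, h4, h5, h6⟩ | ⟨h1, h2, h3, h4⟩)
          · exact ⟨h1, h2, h3, h4, by omega, h6⟩
          · refine ⟨h4, h3, by omega, by omega, by omega, ?_⟩
            rw [h1, h2, Nat.add_sub_cancel_left, hb]
        · rintro ⟨h1, h2, h3, h4, h5, h6⟩
          by_cases h7 : l.1 = x ∧ r.1 = n + y
          · exact .inr ⟨h7.1, h7.2, h2, h1⟩
          · exact .inl ⟨h1, h2, h3, h4, by omega, h6⟩

/-- The right vertices that belong to agents. -/
def dummyOf (s : State Arr) (r : ℕ × ℕ) : Prop := s.mem (.dummy, r.1, r.2, 0, 0) = true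

/-- The number of right vertices that belong to the agent `x`. -/
def dummyCard (N : ℕ) (s : State Arr) (x : ℕ) : ℕ :=
  ((Finset.range N).filter fun y => s.mem (.dummy, x, y, 0, 0) = true).card

theorem run_readRounds {env : Var → ℕ} (hz : env z = 0) {n m k : ℕ} (hN : n + m + k < N)
    {K : ℕ → Bool} {rest : List Bool} {s : State Arr} (hs : Header n m k s)
    (hinp : s.inp = (List.range' 0 k).map K ++ rest) :
    (permOf (run N readRounds env s) = fun l =>
      permOf s l ∨ (l.1 = env i ∧ l.2 < k ∧ K l.2 = true)) ∧
    (dummyOf (run N readRounds env s) = fun l =>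
      dummyOf s l ∨ (l.1 = env i ∧ l.2 < k ∧ K l.2 = true)) ∧
    (run N readRounds env s).inp = rest := by
  have key := run_loopIf (N := N) (a := .round) (v := h) (p := seq (read .bit (z, z, z, z))
    (ite .bit (z, z, z, z) (seq (set .perm (i, h, z, z) true) (set .dummy (i, h, z, z) true)) skip))
    (env := env) (by simp) hz (s := s) (lo := 0) (cnt := k) (by omega)
    (fun y s' => Header n m k s' ∧ s'.inp = (List.range' y (k - y)).map K ++ rest ∧
      (permOf s' = fun l => permOf s l ∨ (l.1 = env i ∧ l.2 < y ∧ K l.2 = true)) ∧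
      (dummyOf s' = fun l => dummyOf s l ∨ (l.1 = env i ∧ l.2 < y ∧ K l.2 = true)))
    (fun x s' h => by simpa using h.1.round) ⟨hs, hinp, by simp, by simp⟩ (fun y hy s' hI => ?_)
  · exact ⟨key.2.2.1, key.2.2.2, by simpa [readEdges, readRounds] using key.2.1⟩
  · refine ⟨hI.1.run (by decide) (by decide) (by decide) (by decide) _, ?_⟩
    obtain ⟨-, hin, hperm, hdummy⟩ := hI
    rw [Nat.zero_add]
    obtain ⟨q, hq⟩ : ∃ q, k - y = q + 1 := ⟨k - y - 1, by omega⟩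
    have hq' : k - (y + 1) = q := by omega
    rw [hq, List.range'_succ, List.map_cons, List.cons_append] at hin
    rw [run_readBit (by simpa using hz) hin, hq']
    have hp := fun l => iff_of_eq (congrFun hperm l)
    have hd := fun l => iff_of_eq (congrFun hdummy l)
    simp only [permOf, dummyOf] at hp hd
    have hlt : ∀ l : ℕ × ℕ, l.2 < y + 1 ↔ l.2 = y ∨ l.2 < y := fun l => by omega
    cases hb : K y with
    | false =>
      have hK : ∀ l : ℕ × ℕ, (l.2 < y + 1 ∧ K l.2 = true ↔ l.2 < y ∧ K l.2 = true) := fun l => by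
        rw [hlt]
        refine ⟨?_, fun h1 => ⟨.inr h1.1, h1.2⟩⟩
        rintro ⟨h1 | h1, h2⟩
        · rw [h1, hb] at h2
          cases h2
        · exact ⟨h1, h2⟩
      refine ⟨by simp, ?_, ?_⟩
      · funext l
        simp only [permOf, Bool.false_eq_true, if_false, eq_iff_iff, hK]
        rw [← hp l]
        simp
      · funext l
        simp only [dummyOf, Bool.false_eq_true, if_false, eq_iff_iff, hK]
        rw [← hd l]
        simp
    | true =>
      have hK : ∀ l : ℕ × ℕ, (l.2 < y + 1 ∧ K l.2 = true ↔ l.2 = y ∨ l.2 < y ∧ K l.2 = true) :=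
        fun l => by
        rw [hlt]
        constructor
        · rintro ⟨h1 | h1, h2⟩
          exacts [.inl h1, .inr ⟨h1, h2⟩]
        · rintro (h1 | h1)
          exacts [⟨.inl h1, by rw [h1, hb]⟩, ⟨.inr h1.1, h1.2⟩]
      refine ⟨by simp [run, State.put], ?_, ?_⟩
      · funext l
        simp only [permOf, if_true, eq_iff_iff, hK, run, State.put, update_apply, key,
          reduceCtorEq, if_false, Prod.mk.injEq, hz, true_and, and_true, false_and]
        split_ifs with hc
        · simp [hc.1, hc.2]
        · rw [hp l]
          tauto
      · funext l
        simp only [dummyOf, if_true, eq_iff_iff, hK, run, State.put, update_apply, key,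
          reduceCtorEq, if_false, Prod.mk.injEq, hz, true_and, and_true, false_and]
        split_ifs with hc
        · simp [hc.1, hc.2]
        · rw [hd l]
          tauto

/-- `j` right vertices of the agent `x` have been removed. -/
def Dropped (N x j : ℕ) (s s' : State Arr) : Prop :=
  (∀ r, dummyOf s' r → dummyOf s r) ∧ (∀ r, r.1 ≠ x → (dummyOf s' r ↔ dummyOf s r)) ∧
    dummyCard N s' x + j = dummyCard N s x

theorem dummyCard_congr {s s' : State Arr} (h : dummyOf s' = dummyOf s) (x : ℕ) :
    dummyCard N s' x = dummyCard N s x := by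
  unfold dummyCard
  congr 1
  refine Finset.filter_congr fun y _ => ?_
  exact iff_of_eq (congrFun h (x, y))

theorem run_dropDummy {env : Var → ℕ} (hz : env z = 0) {s : State Arr}
    (hs : 0 < dummyCard N s (env i)) : Dropped N (env i) 1 s (run N dropDummy env s) := by
  set s0 := s.put .acted (0, 0, 0, 0) false with hs0
  have hrun : run N dropDummy env s = run N (loop h (ite .acted (z, z, z, z) skip
    (ite .dummy (i, h, z, z) (seq (set .dummy (i, h, z, z) false) (set .acted (z, z, z, z) true))
      skip))) env s0 := by
    simp only [dropDummy, run, key, hz, hs0]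
  have key := run_loop_induct (N := N) (v := h) (p := ite .acted (z, z, z, z) skip
    (ite .dummy (i, h, z, z) (seq (set .dummy (i, h, z, z) false) (set .acted (z, z, z, z) true))
      skip)) (env := env) (s := s0)
    (fun y s' => (actedOf s' ∧ Dropped N (env i) 1 s s') ∨
      (¬ actedOf s' ∧ dummyOf s' = dummyOf s ∧ ∀ y' < y, ¬ dummyOf s (env i, y')))
    (.inr ⟨by simp [actedOf, hs0, State.put], ?_, by simp⟩) (fun y hy s' h1 => ?_)
  · rw [hrun]
    rcases key with key | key
    · exact key.2
    · have : dummyCard N s (env i) = 0 := by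
        rw [dummyCard, Finset.card_eq_zero, Finset.filter_eq_empty_iff]
        exact fun y hy => key.2.2 y (Finset.mem_range.mp hy)
      omega
  · funext r
    simp [dummyOf, hs0, State.put]
  · rcases h1 with h1 | ⟨h1, h2, h3⟩
    · have hact := h1.1
      simp only [actedOf] at hact
      refine .inl ?_
      simpa [run, ArrProg.key, hz, hact] using h1
    · have hact := h1
      simp only [actedOf] at hact
      by_cases hd : dummyOf s (env i, y)
      · have hd' : dummyOf s' (env i, y) := by rw [h2]; exact hd
        simp only [dummyOf] at hd'
        have hrun : run N (ite .acted (z, z, z, z) skip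
            (ite .dummy (i, h, z, z) (seq (set .dummy (i, h, z, z) false)
            (set .acted (z, z, z, z) true)) skip)) (update env h y) s' =
            (s'.put .dummy (env i, y, 0, 0) false).put .acted (0, 0, 0, 0) true := by
          simp [run, ArrProg.key, hz, hact, hd']
        rw [hrun]
        have hput : ∀ r, dummyOf ((s'.put .dummy (env i, y, 0, 0) false).put .acted (0, 0, 0, 0)
            true) r ↔ (r ≠ (env i, y) ∧ dummyOf s r) := by
          rintro ⟨r1, r2⟩
          rw [← h2]
          by_cases hr : r1 = env i ∧ r2 = y
          · simp [dummyOf, State.put, hr]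
          · simp [dummyOf, State.put, hr]
        refine .inl ⟨by simp [actedOf, State.put], fun r hr => ((hput r).mp hr).2, fun r hr => ?_,
          ?_⟩
        · rw [hput r]
          exact ⟨fun h4 => h4.2, fun h4 => ⟨fun h5 => hr (by rw [h5]), h4⟩⟩
        · have : ((Finset.range N).filter fun y' => ((s'.put .dummy (env i, y, 0, 0) false).put
              .acted (0, 0, 0, 0) true).mem (.dummy, env i, y', 0, 0) = true) =
              ((Finset.range N).filter fun y' =>
                s.mem (.dummy, env i, y', 0, 0) = true).erase y := by
            ext y'
            have := hput (env i, y')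
            simp only [dummyOf] at this
            simp only [Finset.mem_filter, Finset.mem_erase, this]
            simp only [ne_eq, Prod.mk.injEq, true_and]
            tauto
          rw [dummyCard, this, dummyCard]
          exact Finset.card_erase_add_one
            (Finset.mem_filter.mpr ⟨Finset.mem_range.mpr hy, hd⟩)
      · have hd' : ¬ dummyOf s' (env i, y) := by rw [h2]; exact hd
        simp only [dummyOf] at hd'
        have hrun : run N (ite .acted (z, z, z, z) skip
            (ite .dummy (i, h, z, z) (seq (set .dummy (i, h, z, z) false)
            (set .acted (z, z, z, z) true)) skip)) (update env h y) s' = s' := by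
          simp [run, ArrProg.key, hz, hact, hd']
        rw [hrun]
        refine .inr ⟨h1, h2, fun y' hy' => ?_⟩
        rcases Nat.lt_succ_iff_lt_or_eq.mp hy' with h4 | rfl
        exacts [h3 y' h4, hd]

theorem run_readDemand {env : Var → ℕ} (hz : env z = 0) {x : ℕ} (hN : x < N)
    {rest : List Bool} {s : State Arr} (hzero : Interval s .zero 0 0)
    (hinp : s.inp = encodeUnary x ++ rest) (hx : x ≤ dummyCard N s (env i)) :
    Dropped N (env i) x s (run N (readUnary .zero dropDummy) env s) ∧
      (run N (readUnary .zero dropDummy) env s).inp = rest := by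
  have key := run_readUnary (N := N) (g := .zero) (body := dropDummy) (by decide) (by decide) hz
    (x := x) (lo := 0) (by omega) hinp
    (fun j s' => Interval s' .zero 0 0 ∧ Dropped N (env i) j s s') (fun j s1 s2 hss h1 => ?_)
    (fun j s h i _ => by simpa using h.1 i) ⟨hzero, fun r hr => hr, fun r _ => Iff.rfl, rfl⟩
    (fun j hj s' h1 => ?_)
  · exact ⟨key.1.2, key.2⟩
  · have hd : dummyOf s2 = dummyOf s1 := by
      funext r
      simp only [dummyOf, hss .dummy _ (by simp) (by simp)]
    refine ⟨fun i => ?_, ?_⟩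
    · rw [hss _ _ (by simp) (by simp)]
      exact h1.1 i
    · unfold Dropped
      rw [hd, dummyCard_congr hd]
      exact h1.2
  · refine ⟨h1.1.run (by decide) _, ?_⟩
    obtain ⟨-, h2, h3, h4⟩ := h1
    have hi : update env c (0 + j) i = env i := by simp
    obtain ⟨h5, h6, h7⟩ := run_dropDummy (N := N) (env := update env c (0 + j)) (s := s')
      (by simpa using hz) (by rw [hi]; omega)
    rw [hi] at h6 h7
    exact ⟨fun r hr => h2 r (h5 r hr), fun r hr => (h6 r hr).trans (h3 r hr), by omega⟩

theorem adjOf_run_dummyEdge {env : Var → ℕ} (s : State Arr) :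
    adjOf (run N (loop h' (set .adj (i, h', i, h) true)) env s) = fun l r =>
      adjOf s l r ∨ (l.1 = env i ∧ r.1 = env i ∧ r.2 = env h ∧ l.2 < N) := by
  refine run_loop_induct (fun x s' => adjOf s' = fun l r =>
      adjOf s l r ∨ (l.1 = env i ∧ r.1 = env i ∧ r.2 = env h ∧ l.2 < x)) (by simp)
    fun x hx s' h1 => ?_
  funext l r
  have h2 := congrFun (congrFun h1 l) r
  simp only [adjOf, eq_iff_iff] at h2 ⊢
  simp only [run, State.put, update_apply, key, reduceCtorEq, if_false, if_true, Prod.mk.injEq,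
    true_and]
  split_ifs with hc
  · simp only [true_iff]
    exact .inr ⟨hc.1, hc.2.2.1, hc.2.2.2, by omega⟩
  · rw [h2]
    refine or_congr_right ⟨fun h3 => ⟨h3.1, h3.2.1, h3.2.2.1, by omega⟩,
      fun h3 => ⟨h3.1, h3.2.1, h3.2.2.1, ?_⟩⟩
    by_contra h4
    exact hc ⟨h3.1, by omega, h3.2.1, h3.2.2.1⟩

theorem dummyOf_run {p : Prog} (h : p.writes .dummy = false) (env : Var → ℕ) (s : State Arr) :
    dummyOf (run N p env s) = dummyOf s := by
  funext l
  simp only [dummyOf, mem_run_of_not_writes h]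

theorem mateOf_run {p : Prog} (h : p.writes .mate = false) (env : Var → ℕ) (s : State Arr) :
    mateOf (run N p env s) = mateOf s := by
  funext l r
  simp only [mateOf, mem_run_of_not_writes h]

theorem run_addDummies {env : Var → ℕ} (hz : env z = 0) (s : State Arr) :
    (mateOf (run N addDummies env s) = fun l r =>
      mateOf s l r ∨ (r = l ∧ l.1 = env i ∧ l.2 < N ∧ dummyOf s l)) ∧
    (adjOf (run N addDummies env s) = fun l r =>
      adjOf s l r ∨ (l.1 = env i ∧ r.1 = env i ∧ l.2 < N ∧ r.2 < N ∧ dummyOf s r)) := by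
  have key := run_loop_induct (N := N) (v := h) (p := ite .dummy (i, h, z, z)
    (seq (set .mate (i, h, i, h) true) (loop h' (set .adj (i, h', i, h) true))) skip) (env := env)
    (s := s) (fun y s' => dummyOf s' = dummyOf s ∧
      (mateOf s' = fun l r => mateOf s l r ∨ (r = l ∧ l.1 = env i ∧ l.2 < y ∧ dummyOf s l)) ∧
      (adjOf s' = fun l r =>
        adjOf s l r ∨ (l.1 = env i ∧ r.1 = env i ∧ l.2 < N ∧ r.2 < y ∧ dummyOf s r)))
    ⟨rfl, by simp, by simp⟩ (fun y hy s' h1 => ?_)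
  · exact key.2
  · obtain ⟨h1, h2, h3⟩ := h1
    refine ⟨(dummyOf_run (by decide) _ _).trans h1, ?_⟩
    have hlt : ∀ u, u < y + 1 ↔ u = y ∨ u < y := fun u => by omega
    by_cases hd : dummyOf s (env i, y)
    · have hd' : dummyOf s' (env i, y) := by rw [h1]; exact hd
      simp only [dummyOf] at hd'
      have hrun : run N (ite .dummy (i, h, z, z)
          (seq (set .mate (i, h, i, h) true) (loop h' (set .adj (i, h', i, h) true))) skip)
          (update env h y) s' = run N (loop h' (set .adj (i, h', i, h) true)) (update env h y)
            (s'.put .mate (env i, y, env i, y) true) := by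
        conv_lhs => rw [run]
        rw [if_pos (by simpa [key, hz] using hd'), run]
        simp [run, key]
      rw [hrun]
      constructor
      · rw [mateOf_run (by decide)]
        funext l r
        have h4 := iff_of_eq (congrFun (congrFun h2 l) r)
        obtain ⟨l1, l2⟩ := l
        obtain ⟨r1, r2⟩ := r
        simp only [mateOf, eq_iff_iff] at h4 ⊢
        simp only [State.put, update_apply, Prod.mk.injEq, true_and, hlt] at h4 ⊢
        split_ifs with hc
        · obtain ⟨rfl, rfl, rfl, rfl⟩ := hc
          simp [hd]
        · rw [h4]
          refine or_congr_right ⟨fun h5 => ⟨h5.1, h5.2.1, .inr h5.2.2.1, h5.2.2.2⟩,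
            fun h5 => ⟨h5.1, h5.2.1, h5.2.2.1.resolve_left fun h6 => ?_, h5.2.2.2⟩⟩
          exact hc ⟨h5.2.1, h6, h5.1.1.trans h5.2.1, h5.1.2.trans h6⟩
      · rw [adjOf_run_dummyEdge]
        have h4 : adjOf (s'.put .mate (env i, y, env i, y) true) = adjOf s' := by
          funext l r
          simp [adjOf, State.put]
        rw [h4, h3]
        funext l r
        simp only [update_apply, reduceCtorEq, if_false, if_true, eq_iff_iff, hlt]
        constructor
        · rintro ((h5 | h5) | h5)
          · exact .inl h5
          · exact .inr ⟨h5.1, h5.2.1, h5.2.2.1, .inr h5.2.2.2.1, h5.2.2.2.2⟩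
          · refine .inr ⟨h5.1, h5.2.1, h5.2.2.2, .inl h5.2.2.1, ?_⟩
            rwa [show r = (env i, y) from Prod.ext h5.2.1 h5.2.2.1]
        · rintro (h5 | ⟨h5, h6, h7, h8 | h8, h9⟩)
          · exact .inl (.inl h5)
          · exact .inr ⟨h5, h6, h8, h7⟩
          · exact .inl (.inr ⟨h5, h6, h7, h8, h9⟩)
    · have hd' : ¬ dummyOf s' (env i, y) := by rw [h1]; exact hd
      simp only [dummyOf] at hd'
      have hrun : run N (ite .dummy (i, h, z, z)
          (seq (set .mate (i, h, i, h) true) (loop h' (set .adj (i, h', i, h) true))) skip)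
          (update env h y) s' = s' := by
        conv_lhs => rw [run]
        rw [if_neg (by simpa [key, hz] using hd'), run]
      rw [hrun, h2, h3]
      constructor
      · funext l r
        simp only [eq_iff_iff, hlt]
        refine or_congr_right ⟨fun h5 => ⟨h5.1, h5.2.1, .inr h5.2.2.1, h5.2.2.2⟩,
            fun h5 => ⟨h5.1, h5.2.1, h5.2.2.1.resolve_left fun h6 => hd ?_, h5.2.2.2⟩⟩
        have := h5.2.2.2
        rwa [show l = (env i, y) from Prod.ext h5.2.1 h6] at this
      · funext l r
        simp only [eq_iff_iff, hlt]
        refine or_congr_right ⟨fun h5 => ⟨h5.1, h5.2.1, h5.2.2.1, .inr h5.2.2.2.1, h5.2.2.2.2⟩,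
            fun h5 => ⟨h5.1, h5.2.1, h5.2.2.1, h5.2.2.2.1.resolve_left fun h6 => hd ?_,
              h5.2.2.2.2⟩⟩
        have := h5.2.2.2.2
        rwa [show r = (env i, y) from Prod.ext h5.2.1 h6] at this

/-- The state after the data of the first `x` agents have been read. -/
structure AgentsRead (N k : ℕ) (K : ℕ → ℕ → Bool) (ρ : ℕ → ℕ) (real : ℕ × ℕ → ℕ × ℕ → Prop)
    (x : ℕ) (s : State Arr) : Prop where
  perm : permOf s = fun l => l.1 < x ∧ l.2 < k ∧ K l.1 l.2 = true
  dummy_le : ∀ r, dummyOf s r → r.1 < x ∧ r.2 < k ∧ K r.1 r.2 = true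
  card : ∀ y < x, dummyCard N s y + ρ y = ((Finset.range k).filter fun d => K y d = true).card
  mate : mateOf s = fun l r => r = l ∧ dummyOf s l
  adj : adjOf s = fun l r => real l r ∨ (l.1 = r.1 ∧ l.2 < N ∧ dummyOf s r)

theorem run_readAgents {env : Var → ℕ} (hz : env z = 0) {n m k : ℕ} (hN : n + m + k < N)
    {K : ℕ → ℕ → Bool} {ρ : ℕ → ℕ} {real : ℕ × ℕ → ℕ × ℕ → Prop} {rest : List Bool} {s : State Arr}
    (hρ : ∀ y < n, ρ y ≤ ((Finset.range k).filter fun d => K y d = true).card)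
    (hs : Header n m k s)
    (hinp : s.inp = ((List.range' 0 n).map fun i =>
      (List.range' 0 k).map (K i) ++ encodeUnary (ρ i)).flatten ++ rest)
    (hA : AgentsRead N k K ρ real 0 s) :
    AgentsRead N k K ρ real n (run N readAgents env s) ∧
      Header n m k (run N readAgents env s) := by
  have key := run_loopIf (N := N) (a := .agent) (v := i) (p := seq readRounds
    (seq (readUnary .zero dropDummy) addDummies)) (by simp) hz (s := s) (lo := 0) (cnt := n)
    (by omega)
    (fun x s' => Header n m k s' ∧
      s'.inp = ((List.range' x (n - x)).map fun i =>
        (List.range' 0 k).map (K i) ++ encodeUnary (ρ i)).flatten ++ rest ∧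
      AgentsRead N k K ρ real x s')
    (fun x s' h => by simpa using h.1.agent) ⟨hs, hinp, hA⟩ (fun x hx s' h => ?_)
  · exact ⟨key.2.2, key.1⟩
  · obtain ⟨hH, hin, hA⟩ := h
    have hz' : update env i (0 + x) z = 0 := by simpa using hz
    have hi : update env i (0 + x) i = x := by simp
    refine ⟨hH.run (by decide) (by decide) (by decide) (by decide) _, ?_⟩
    set rest' := ((List.range' (x + 1) (n - (x + 1))).map fun i =>
        (List.range' 0 k).map (K i) ++ encodeUnary (ρ i)).flatten ++ rest with hrest'
    have hinp' : s'.inp = (List.range' 0 k).map (K x) ++ (encodeUnary (ρ x) ++ rest') := by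
      obtain ⟨q, hq⟩ : ∃ q, n - x = q + 1 := ⟨n - x - 1, by omega⟩
      rw [hin, hq, List.range'_succ, hrest', show n - (x + 1) = q by omega]
      simp
    set env' := update env i (0 + x) with henv'
    obtain ⟨h1, h2, h3⟩ := run_readRounds (N := N) hz' hN hH hinp'
    set s1 := run N readRounds env' s' with hs1
    rw [hi, hA.perm] at h1
    rw [hi] at h2
    have hnot : ∀ y, ¬ dummyOf s' (x, y) := fun y hy => absurd (hA.dummy_le _ hy).1 (by simp)
    have hcard1 : dummyCard N s1 x = ((Finset.range k).filter fun d => K x d = true).card := by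
      unfold dummyCard
      congr 1
      ext y
      have := iff_of_eq (congrFun h2 (x, y))
      simp only [hnot, false_or, true_and] at this
      simp only [dummyOf] at this
      simp only [Finset.mem_filter, Finset.mem_range, this]
      constructor
      · exact fun h4 => h4.2
      · exact fun h4 => ⟨by omega, h4⟩
    have hmate1 : mateOf s1 = mateOf s' := mateOf_run (by decide) _ _
    have hadj1 : adjOf s1 = adjOf s' := adjOf_run (by decide) _ _
    have hρx := hρ x hx
    have hkc : ((Finset.range k).filter fun d => K x d = true).card ≤ k :=
      (Finset.card_filter_le _ _).trans (by simp)
    obtain ⟨⟨h4, h5, h6⟩, h7⟩ := run_readDemand (N := N) hz' (x := ρ x) (by omega)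
      (hH.run (by decide) (by decide) (by decide) (by decide) _).zero h3 (by rw [hi, ← hs1]; omega)
    rw [hi] at h5 h6
    set s2 := run N (readUnary .zero dropDummy) env' s1 with hs2
    have hperm2 : permOf s2 = permOf s1 := permOf_run (by decide) _ _
    have hmate2 : mateOf s2 = mateOf s1 := mateOf_run (by decide) _ _
    have hadj2 : adjOf s2 = adjOf s1 := adjOf_run (by decide) _ _
    obtain ⟨h8, h9⟩ := run_addDummies (N := N) hz' s2
    rw [hi] at h8 h9
    change (run N addDummies env' s2).inp = rest' ∧
      AgentsRead N k K ρ real (x + 1) (run N addDummies env' s2)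
    set s3 := run N addDummies env' s2 with hs3
    have hperm3 : permOf s3 = permOf s2 := permOf_run (by decide) _ _
    have hdummy3 : dummyOf s3 = dummyOf s2 := dummyOf_run (by decide) _ _
    have hinp3 : s3.inp = s2.inp := inp_run_of_not_reads (by decide) _ _
    have hlt : ∀ l : ℕ × ℕ, l.1 < x + 1 ↔ l.1 < x ∨ l.1 = x := fun l => by omega
    have hd2 : ∀ r, r.1 ≠ x → (dummyOf s2 r ↔ dummyOf s' r) := fun r hr => by
      rw [h5 r hr, h2]
      simp [hr]
    have hle : ∀ r, dummyOf s2 r → r.1 < x + 1 ∧ r.2 < k ∧ K r.1 r.2 = true := by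
      intro r hr
      have := h4 r hr
      rw [h2] at this
      rcases this with h10 | ⟨h10, h11⟩
      · have := hA.dummy_le r h10
        exact ⟨by omega, this.2⟩
      · exact ⟨by omega, by rwa [h10]⟩
    refine ⟨hinp3.trans h7, ?_, ?_, ?_, ?_, ?_⟩
    · rw [hperm3, hperm2, h1]
      funext l
      simp only [hlt, eq_iff_iff]
      constructor
      · rintro (h10 | h10)
        exacts [⟨.inl h10.1, h10.2⟩, ⟨.inr h10.1, by rw [h10.1]; exact h10.2⟩]
      · rintro ⟨h10 | h10, h11⟩
        · exact .inl ⟨h10, h11⟩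
        · rw [h10] at h11
          exact .inr ⟨h10, h11⟩
    · rw [hdummy3]
      exact hle
    · intro y hy
      rw [dummyCard_congr hdummy3]
      rcases Nat.lt_succ_iff_lt_or_eq.mp hy with h10 | rfl
      · have : dummyCard N s2 y = dummyCard N s' y := by
          unfold dummyCard
          congr 1
          exact Finset.filter_congr fun d _ => hd2 (y, d) (Nat.ne_of_lt h10)
        rw [this]
        exact hA.card y h10
      · rw [h6, hcard1]
    · rw [h8, hdummy3, hmate2, hmate1, hA.mate]
      funext l r
      simp only [eq_iff_iff]
      by_cases hl : l.1 = x
      · constructor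
        · rintro (h10 | h10)
          · exact absurd (hA.dummy_le l h10.2).1 (by omega)
          · exact ⟨h10.1, h10.2.2.2⟩
        · rintro ⟨h10, h11⟩
          have := hle l h11
          exact .inr ⟨h10, hl, by omega, h11⟩
      · rw [hd2 l hl]
        simp [hl]
    · rw [h9, hdummy3, hadj2, hadj1, hA.adj]
      funext l r
      simp only [eq_iff_iff, or_assoc]
      refine or_congr_right ?_
      by_cases hr : r.1 = x
      · constructor
        · rintro (h10 | h10)
          · exact absurd (hA.dummy_le r h10.2.2).1 (by omega)
          · exact ⟨by omega, h10.2.2.1, h10.2.2.2.2⟩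
        · rintro ⟨h10, h11, h12⟩
          have := hle r h12
          exact .inr ⟨by omega, hr, h11, by omega, h12⟩
      · rw [hd2 r hr]
        simp [hr]

end MRM

/-! ### Writing the answer -/

namespace MRM

open ArrProg Function Var

variable {N : ℕ}

/-- Set `fail` if some left vertex is unmatched. -/
def checkAll : Prog :=
  loop i (loop h (ite .perm (i, h, z, z) (seq findMate
    (ite .acted (z, z, z, z) skip (set .fail (z, z, z, z) true))) skip))

/-- Write the matchings of all the rounds. -/
def writeMatchings : Prog :=
  loopIf h .round (h, z, z, z) (loopIf i .agent (i, z, z, z) (loopIf a .resource (a, z, z, z)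
    (ite .mate (i, h, a, h) (write true) (write false))))

/-- Write the answer. -/
def writeAnswer : Prog :=
  ite .fail (z, z, z, z) (write false) (seq (write true) writeMatchings)

/-- The complete program. -/
def program : Prog :=
  seq readHeader (seq readEdges (seq readAgents (seq matching (seq checkAll writeAnswer))))

/-- The flag `fail`. -/
def failOf (s : State Arr) : Prop := s.mem (.fail, 0, 0, 0, 0) = true

theorem run_checkAll {env : Var → ℕ} (hz : env z = 0) {s : State Arr} (hs : ¬ failOf s) :
    failOf (run N checkAll env s) ↔ ∃ l : ℕ × ℕ, l.1 < N ∧ l.2 < N ∧ permOf s l ∧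
      ¬ ∃ r : ℕ × ℕ, r.1 < N ∧ r.2 < N ∧ mateOf s l r := by
  set bad : ℕ × ℕ → Prop := fun l => permOf s l ∧
      ¬ ∃ r : ℕ × ℕ, r.1 < N ∧ r.2 < N ∧ mateOf s l r with hbad
  have key := run_loop_induct (N := N) (v := i) (p := loop h (ite .perm (i, h, z, z) (seq findMate
    (ite .acted (z, z, z, z) skip (set .fail (z, z, z, z) true))) skip)) (env := env) (s := s)
    (fun x s' => permOf s' = permOf s ∧ mateOf s' = mateOf s ∧
      (failOf s' ↔ ∃ l : ℕ × ℕ, l.1 < x ∧ l.2 < N ∧ bad l)) ⟨rfl, rfl, by simp [hs]⟩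
    (fun x hx s1 h1 => ?_)
  · exact key.2.2
  · have key := run_loop_induct (N := N) (v := h) (p := ite .perm (i, h, z, z) (seq findMate
      (ite .acted (z, z, z, z) skip (set .fail (z, z, z, z) true))) skip) (env := update env i x)
      (s := s1) (fun y s' => permOf s' = permOf s ∧ mateOf s' = mateOf s ∧
        (failOf s' ↔ ∃ l : ℕ × ℕ, (l.1 < x ∧ l.2 < N ∨ l.1 = x ∧ l.2 < y) ∧ bad l))
      ⟨h1.1, h1.2.1, by simp [h1.2.2, and_assoc]⟩ (fun y hy s2 h2 => ?_)
    · refine ⟨key.1, key.2.1, key.2.2.trans (exists_congr fun l => ?_)⟩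
      constructor
      · rintro ⟨h3, h4⟩
        exact ⟨by omega, by omega, h4⟩
      · rintro ⟨h3, h4, h5⟩
        exact ⟨by omega, h5⟩
    · obtain ⟨h2, h3, h4⟩ := h2
      refine ⟨(permOf_run (by decide) _ _).trans h2, (mateOf_run (by decide) _ _).trans h3, ?_⟩
      set env' := update (update env i x) h y with henv'
      have hz' : env' z = 0 := by simpa [henv'] using hz
      have hfind := actedOf_run_findMate (N := N) hz' s2
      have hfail : failOf (run N findMate env' s2) ↔ failOf s2 := by
        simp only [failOf]
        rw [mem_run_of_not_writes (by decide)]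
      -- the new state has failed if and only if the old one has or `(x, y)` is unmatched
      have hstep : failOf (run N (ite .perm (i, h, z, z) (seq findMate
          (ite .acted (z, z, z, z) skip (set .fail (z, z, z, z) true))) skip) env' s2) ↔
          failOf s2 ∨ bad (x, y) := by
        have hi : env' i = x := by simp [henv']
        have hh : env' h = y := by simp [henv']
        rw [h3, hi, hh] at hfind
        have hkey : key env' (i, h, z, z) = (x, y, 0, 0) := by simp [ArrProg.key, hi, hh, hz']
        have hkey0 : key env' (z, z, z, z) = (0, 0, 0, 0) := by simp [ArrProg.key, hz']
        simp only [run, hkey, hkey0]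
        by_cases hp : s2.mem (.perm, x, y, 0, 0) = true
        · rw [if_pos hp]
          have hp' : permOf s (x, y) := by rw [← h2]; exact hp
          by_cases hact : (run N findMate env' s2).mem (.acted, 0, 0, 0, 0) = true
          · rw [if_pos hact, hfail]
            exact ⟨.inl, fun h5 => h5.resolve_right fun h6 => h6.2 (hfind.mp hact)⟩
          · rw [if_neg hact]
            exact iff_of_true (by simp [failOf, State.put])
              (.inr ⟨hp', fun h5 => hact (hfind.mpr h5)⟩)
        · rw [if_neg hp]
          have hp' : ¬ permOf s (x, y) := by rw [← h2]; exact hp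
          exact ⟨.inl, fun h5 => h5.resolve_right fun h6 => hp' h6.1⟩
      rw [hstep, h4]
      constructor
      · rintro (⟨l, h5, h6⟩ | h5)
        · exact ⟨l, by omega, h6⟩
        · exact ⟨(x, y), by simp, h5⟩
      · rintro ⟨⟨l1, l2⟩, h5, h6⟩
        by_cases hl : l1 = x ∧ l2 = y
        · obtain ⟨rfl, rfl⟩ := hl
          exact .inr h6
        · refine .inl ⟨(l1, l2), ?_, h6⟩
          simp only at h5 ⊢
          omega

/-- The output of a loop that does not change the arrays. -/
theorem run_loopIf_out {g : Arr} {v : Var} (hv : v ≠ z) {p : Prog} {env : Var → ℕ} (hz : env z = 0)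
    {s : State Arr} {lo cnt : ℕ} (hN : lo + cnt ≤ N) (hg : Interval s g lo (lo + cnt))
    (f : ℕ → List Bool)
    (h : ∀ j < cnt, ∀ s', s'.mem = s.mem →
      (run N p (update env v (lo + j)) s').mem = s.mem ∧
      (run N p (update env v (lo + j)) s').out = s'.out ++ f j) :
    (run N (loopIf v g (v, z, z, z) p) env s).mem = s.mem ∧
    (run N (loopIf v g (v, z, z, z) p) env s).out =
      s.out ++ ((List.range cnt).map f).flatten := by
  refine run_loopIf hv hz hN (fun j s' => s'.mem = s.mem ∧
    s'.out = s.out ++ ((List.range j).map f).flatten) (fun j s' hs' i => ?_) (by simp)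
    fun j hj s' hs' => ?_
  · rw [hs'.1]
    exact hg i
  · obtain ⟨h1, h2⟩ := h j hj s' hs'.1
    refine ⟨h1, ?_⟩
    rw [h2, hs'.2, List.range_succ]
    simp

theorem run_writeMatchings {env : Var → ℕ} (hz : env z = 0) {n m k : ℕ} (hN : n + m + k < N)
    {s : State Arr} (hs : Header n m k s) :
    (run N writeMatchings env s).out = s.out ++ ((List.range k).map fun h =>
      ((List.range n).map fun i => ((List.range m).map fun j =>
        [s.mem (.mate, i, h, n + j, h)]).flatten).flatten).flatten := by
  refine (run_loopIf_out (by simp) hz (lo := 0) (by omega) (by simpa using hs.round) _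
    fun y hy s1 h1 => ?_).2
  rw [← h1]
  refine run_loopIf_out (by simp) (by simpa using hz) (lo := 0) (by omega)
    (fun j => by rw [h1]; simpa using hs.agent j) _ fun x hx s2 h2 => ?_
  rw [← h2]
  refine run_loopIf_out (by simp) (by simpa using hz) (lo := n) (by omega)
    (fun j => by rw [h2, h1]; exact hs.resource j) _ fun w hw s3 h3 => ?_
  simp only [run, key, update_apply, reduceCtorEq, if_false, if_true, Nat.zero_add, h3]
  cases s2.mem (.mate, x, y, n + w, y) <;> simp

end MRM

/-! ### Instances and their answers -/

namespace MRM

open ArrProg Function Var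

/-- The compatibility graph with natural numbers as indices. -/
def edgeBit (I : MRMInstance) (i j : ℕ) : Bool :=
  decide (∃ (hi : i < I.n) (hj : j < I.m), (⟨i, hi⟩, ⟨j, hj⟩) ∈ I.E)

/-- The permissible rounds with natural numbers as indices. -/
def permBit (I : MRMInstance) (i h : ℕ) : Bool :=
  decide (∃ (hi : i < I.n) (hh : h < I.k), (⟨h, hh⟩ : Fin I.k) ∈ I.K ⟨i, hi⟩)

/-- The demands with natural numbers as indices. -/
def demand (I : MRMInstance) (i : ℕ) : ℕ := if hi : i < I.n then I.ρ ⟨i, hi⟩ else 0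

theorem edgeBit_fin {I : MRMInstance} (i : Fin I.n) (j : Fin I.m) :
    edgeBit I i j = true ↔ (i, j) ∈ I.E := by
  simp [edgeBit]

theorem permBit_fin {I : MRMInstance} (i : Fin I.n) (h : Fin I.k) :
    permBit I i h = true ↔ h ∈ I.K i := by
  simp [permBit]

theorem card_permBit {I : MRMInstance} (i : Fin I.n) :
    ((Finset.range I.k).filter fun h => permBit I i h = true).card = (I.K i).card := by
  rw [← Finset.card_map Fin.valEmbedding]
  congr 1
  ext h
  simp only [Finset.mem_filter, Finset.mem_range, Finset.mem_map, Fin.valEmbedding_apply]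
  constructor
  · rintro ⟨h1, h2⟩
    exact ⟨⟨h, h1⟩, (permBit_fin i ⟨h, h1⟩).mp h2, rfl⟩
  · rintro ⟨h', h1, rfl⟩
    exact ⟨h'.2, (permBit_fin i h').mpr h1⟩

theorem ofFn_eq_map_range {α : Type} {n : ℕ} (f : ℕ → α) :
    (List.ofFn fun i : Fin n => f i) = (List.range n).map f :=
  List.ext_getElem (by simp) (by simp)

theorem encode_eq (I : MRMInstance) :
    I.encode = encodeUnary I.n ++ (encodeUnary I.m ++ (encodeUnary I.k ++
      (((List.range I.n).map fun i => (List.range I.m).map (edgeBit I i)).flatten ++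
      ((List.range I.n).map fun i =>
        (List.range I.k).map (permBit I i) ++ encodeUnary (demand I i)).flatten))) := by
  rw [MRMInstance.encode, encodeMatrix, ← ofFn_eq_map_range, ← ofFn_eq_map_range]
  simp only [encodeSet, ← ofFn_eq_map_range]
  congr 8
  · funext i
    congr 1
    funext j
    rw [Bool.eq_iff_iff, edgeBit_fin]
    simp
  · funext i
    congr 2
    · funext h
      rw [Bool.eq_iff_iff, permBit_fin]
      simp
    · simp [demand]

theorem length_encodeUnary (x : ℕ) : (encodeUnary x).length = x + 1 := by
  induction x with
  | zero => rfl
  | succ x ih => rw [encodeUnary_succ, List.length_cons, ih]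

theorem length_encode (I : MRMInstance) :
    I.n + I.m + I.k + 3 + I.n * I.k ≤ I.encode.length := by
  have : I.n * I.k ≤ (((List.range I.n).map fun i =>
      (List.range I.k).map (permBit I i) ++ encodeUnary (demand I i)).flatten).length := by
    rw [List.length_flatten, List.map_map]
    refine le_trans ?_ (List.card_nsmul_le_sum _ I.k fun x hx => ?_)
    · simp
    · obtain ⟨i, -, rfl⟩ := List.mem_map.mp hx
      simp
  rw [encode_eq]
  simp only [List.length_append, length_encodeUnary] at *
  omega

/-- The left vertices of an instance. -/
def lefts (I : MRMInstance) : Finset (ℕ × ℕ) :=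
  (Finset.range I.n ×ˢ Finset.range I.k).filter fun l => permBit I l.1 l.2 = true

theorem mem_lefts {I : MRMInstance} {l : ℕ × ℕ} :
    l ∈ lefts I ↔ l.1 < I.n ∧ l.2 < I.k ∧ permBit I l.1 l.2 = true := by
  simp [lefts, and_assoc]

/-- The adjacency relation of the auxiliary graph, in which the right vertices that belong to the
agent `i` are the pairs `(i, d)` with `d ∈ D i`. -/
def fullAdj (N : ℕ) (I : MRMInstance) (D : ℕ → Finset ℕ) (l r : ℕ × ℕ) : Prop :=
  RealAdj N I.n I.m (edgeBit I) l r ∨ (l.1 = r.1 ∧ l.2 < N ∧ r.2 ∈ D r.1)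

/-- Each agent `i` has `|K i| - ρ i` right vertices, namely the pairs `(i, d)` with `d ∈ D i`. -/
def IsDummy (I : MRMInstance) (D : ℕ → Finset ℕ) : Prop :=
  ∀ i : Fin I.n, (D i).card + I.ρ i = (I.K i).card

/-- The program reaches a state in which all the left vertices are settled, before it writes its
answer. -/
theorem run_matching_state (I : MRMInstance) :
    ∃ (D : ℕ → Finset ℕ) (s : State Arr), IsDummy I D ∧ Header I.n I.m I.k s ∧ s.out = [] ∧
      ¬ failOf s ∧
      MatchInv I.encode.length (lefts I) (fullAdj I.encode.length I D)
        {r | r.2 ∈ D r.1} s ∧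
      (∀ l ∈ lefts I, Settled I.encode.length s l) ∧
      run I.encode.length program (fun _ => 0) ⟨fun _ => false, I.encode, []⟩ =
        run I.encode.length (seq checkAll writeAnswer) (fun _ => 0) s := by
  set N := I.encode.length with hNdef
  have hlen : I.n + I.m + I.k + 3 + I.n * I.k ≤ N := length_encode I
  set s0 : State Arr := ⟨fun _ => false, I.encode, []⟩ with hs0
  obtain ⟨h1, h1'⟩ := run_readHeader (N := N) (env := fun _ => 0) rfl (n := I.n) (m := I.m)
    (k := I.k) (by omega) (s := s0) (encode_eq I) rfl
  set s1 := run N readHeader (fun _ => 0) s0 with hs1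
  have hmem1 : ∀ a k, readHeader.writes a = false → s1.mem (a, k) = false := fun a k ha => by
    rw [hs1, mem_run_of_not_writes ha]
  have hadj1 : ∀ l r, ¬ adjOf s1 l r := fun l r => by simp [adjOf, hmem1 .adj _ (by decide)]
  rw [List.range_eq_range', List.range_eq_range', List.range_eq_range'] at h1'
  obtain ⟨h2, h2'⟩ := run_readEdges (N := N) (env := fun _ => 0) rfl (by omega) h1 h1' hadj1
  have hH2 := h1.run (N := N) (p := readEdges) (by decide) (by decide) (by decide) (by decide)
    fun _ => 0
  set s2 := run N readEdges (fun _ => 0) s1 with hs2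
  have hmem2 : ∀ a k, readHeader.writes a = false → readEdges.writes a = false →
      s2.mem (a, k) = false := fun a k ha ha' => by
    rw [hs2, mem_run_of_not_writes ha', hmem1 a k ha]
  have hA : AgentsRead N I.k (permBit I) (demand I) (RealAdj N I.n I.m (edgeBit I)) 0 s2 := by
    refine ⟨?_, fun r hr => ?_, by simp, ?_, ?_⟩
    · funext l
      simp [permOf, hmem2 .perm _ (by decide) (by decide)]
    · simp [dummyOf, hmem2 .dummy _ (by decide) (by decide)] at hr
    · funext l r
      simp [mateOf, dummyOf, hmem2 .mate _ (by decide) (by decide),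
        hmem2 .dummy _ (by decide) (by decide)]
    · rw [h2]
      funext l r
      simp [dummyOf, hmem2 .dummy _ (by decide) (by decide)]
  obtain ⟨hA, hH3⟩ := run_readAgents (N := N) (env := fun _ => 0) rfl (by omega)
    (K := permBit I) (ρ := demand I) (rest := [])
    (fun y hy => by
      have := I.ρ_le ⟨y, hy⟩
      rw [← card_permBit ⟨y, hy⟩] at this
      simpa [demand, hy] using this) hH2 (by simpa using h2') hA
  set s3 := run N readAgents (fun _ => 0) s2 with hs3
  have hprice3 : ∀ r c, ¬ priceOf s3 r c := fun r c => by
    simp only [priceOf, hs3]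
    rw [mem_run_of_not_writes (by decide), hmem2 _ _ (by decide) (by decide)]
    simp
  set D : ℕ → Finset ℕ := fun i => (Finset.range N).filter fun d =>
    s3.mem (.dummy, i, d, 0, 0) = true with hD
  have hmemD : ∀ r : ℕ × ℕ, r.2 ∈ D r.1 ↔ dummyOf s3 r := fun r => by
    simp only [hD, Finset.mem_filter, Finset.mem_range]
    refine ⟨fun h => h.2, fun h => ⟨?_, h⟩⟩
    have := (hA.dummy_le r h).2.1
    omega
  have hM : MatchInv N (lefts I) (fullAdj N I D) {r | r.2 ∈ D r.1} s3 := by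
    refine ⟨⟨fun {l r} h => ?_, fun {l r} h => ?_, fun {l r r'} h h' => ?_, fun {l l' r} h h' => ?_,
      fun {r c} h => (hprice3 r c h).elim, fun {l r r' c c'} _ _ h => (hprice3 r c h).elim,
      fun r hr => ⟨r, ?_⟩⟩, ?_, fun l => ?_, fun l hl => ?_, fun l r h => ?_⟩
    · rw [hA.mate] at h
      exact mem_lefts.mpr (hA.dummy_le l h.2)
    · rw [hA.mate] at h
      obtain ⟨rfl, h⟩ := h
      have := hA.dummy_le r h
      exact .inr ⟨rfl, by omega, (hmemD r).mpr h⟩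
    · rw [hA.mate] at h h'
      exact h.1.trans h'.1.symm
    · rw [hA.mate] at h h'
      exact h.1.symm.trans h'.1
    · rw [hA.mate]
      exact ⟨rfl, (hmemD r).mp hr⟩
    · rw [hA.adj]
      funext l r
      simp only [fullAdj, hmemD]
    · rw [hA.perm, mem_lefts]
    · have := mem_lefts.mp hl
      omega
    · rcases h with h | h
      · have := h.1
        have := h.2.1
        have := h.2.2.2.2.1
        omega
      · have := hA.dummy_le r ((hmemD r).mp h.2.2)
        omega
  obtain ⟨hM4, hset⟩ := matching_spec (N := N) (by omega) (env := fun _ => 0) rfl hM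
  refine ⟨D, run N matching (fun _ => 0) s3, fun i => ?_,
    hH3.run (by decide) (by decide) (by decide) (by decide) _, ?_, ?_, hM4, hset, rfl⟩
  · have := hA.card i i.2
    rw [card_permBit] at this
    simpa [dummyCard, demand, hD] using this
  · rw [out_run_of_not_prints (by decide), hs3, out_run_of_not_prints (by decide), hs2,
      out_run_of_not_prints (by decide), hs1, out_run_of_not_prints (by decide)]
  · simp only [failOf, hs3]
    rw [mem_run_of_not_writes (by decide), mem_run_of_not_writes (by decide),
      hmem2 _ _ (by decide) (by decide)]
    simp

variable {I : MRMInstance} {D : ℕ → Finset ℕ} {N : ℕ}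

theorem mem_E_of_fullAdj {i : Fin I.n} {j : Fin I.m} {h h' : ℕ}
    (ha : fullAdj N I D (i, h) (I.n + j, h')) : (i, j) ∈ I.E := by
  rcases ha with ha | ha
  · have := ha.2.2.2.2.2
    simp only [Nat.add_sub_cancel_left] at this
    exact (edgeBit_fin i j).mp this
  · have h1 : i.val = I.n + j := ha.1
    omega

/-- A `k`-round matching that satisfies all the agents gives rise to a complete matching of the
left vertices: in the permissible rounds in which the agent `i` is not matched to a resource, at
most `|K i| - ρ i` in number, it is matched to the right vertices that belong to it. -/
theorem exists_complete_matching (hD : IsDummy I D) (hN : I.k ≤ N) (M : KRoundMatching I)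
    (hM : ∀ i, M.Satisfies i) :
    ∃ f : ℕ × ℕ → ℕ × ℕ, Set.InjOn f (lefts I) ∧ ∀ l ∈ lefts I, fullAdj N I D l (f l) := by
  classical
  have hcard : ∀ i : Fin I.n, Fintype.card {h // h ∈ I.K i \ M.rounds i} ≤
      Fintype.card {d // d ∈ D i} := by
    intro i
    rw [Fintype.card_coe, Fintype.card_coe]
    have h1 := hM i
    have h2 := Finset.card_sdiff_add_card_inter (I.K i) (M.rounds i)
    have h3 := hD i
    rw [KRoundMatching.Satisfies, Finset.inter_comm] at h1
    omega
  have hemb := fun i => (Function.Embedding.nonempty_of_card_le (hcard i)).some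
  have hround : ∀ (i : Fin I.n) (h : Fin I.k), ∃ j : ℕ, h ∈ M.rounds i →
      ∃ j' : Fin I.m, j'.val = j ∧ (i, j') ∈ M.edges h := by
    intro i h
    by_cases hh : h ∈ M.rounds i
    · obtain ⟨j, hj⟩ := (Finset.mem_filter.mp hh).2
      exact ⟨j, fun _ => ⟨j, rfl, hj⟩⟩
    · exact ⟨0, fun h' => (hh h').elim⟩
  choose res hres using hround
  let f : Fin I.n → Fin I.k → ℕ × ℕ := fun i h =>
    if h ∈ M.rounds i then (I.n + res i h, h)
    else if hh : h ∈ I.K i \ M.rounds i then (i, hemb i ⟨h, hh⟩) else (0, 0)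
  have hfres : ∀ i h, h ∈ M.rounds i → f i h = (I.n + res i h, h.val) := fun i h hh => if_pos hh
  have hfdummy : ∀ i h (hh : h ∈ I.K i \ M.rounds i), f i h = (i.val, (hemb i ⟨h, hh⟩).val) :=
    fun i h hh => (if_neg (Finset.mem_sdiff.mp hh).2).trans (dif_pos hh)
  have hinj : ∀ i h i' h', h ∈ I.K i → h' ∈ I.K i' → f i h = f i' h' → i = i' ∧ h = h' := by
    intro i h i' h' hK hK' heq
    by_cases h1 : h ∈ M.rounds i <;> by_cases h2 : h' ∈ M.rounds i'
    · rw [hfres i h h1, hfres i' h' h2, Prod.mk.injEq] at heq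
      obtain rfl : h = h' := Fin.ext heq.2
      obtain ⟨j, hj, hj'⟩ := hres i h h1
      obtain ⟨j', hj1, hj1'⟩ := hres i' h h2
      obtain rfl : j = j' := Fin.ext (by omega)
      exact ⟨M.resource_unique h i i' j hj' hj1', rfl⟩
    · rw [hfres i h h1, hfdummy i' h' (Finset.mem_sdiff.mpr ⟨hK', h2⟩), Prod.mk.injEq] at heq
      have := i'.2
      omega
    · rw [hfres i' h' h2, hfdummy i h (Finset.mem_sdiff.mpr ⟨hK, h1⟩), Prod.mk.injEq] at heq
      have := i.2
      omega
    · rw [hfdummy i h (Finset.mem_sdiff.mpr ⟨hK, h1⟩),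
        hfdummy i' h' (Finset.mem_sdiff.mpr ⟨hK', h2⟩), Prod.mk.injEq] at heq
      obtain rfl : i = i' := Fin.ext heq.1
      have := (hemb i).injective (Subtype.ext heq.2)
      exact ⟨rfl, congrArg Subtype.val this⟩
  refine ⟨fun l => if hl : l.1 < I.n ∧ l.2 < I.k then f ⟨l.1, hl.1⟩ ⟨l.2, hl.2⟩ else (0, 0),
    ?_, ?_⟩
  · rintro ⟨i, h⟩ hl ⟨i', h'⟩ hl' heq
    obtain ⟨h1, h2, h3⟩ := mem_lefts.mp hl
    obtain ⟨h1', h2', h3'⟩ := mem_lefts.mp hl'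
    simp only at h1 h2 h3 h1' h2' h3'
    simp only [h1, h2, h1', h2', and_self, dif_pos] at heq
    have := hinj ⟨i, h1⟩ ⟨h, h2⟩ ⟨i', h1'⟩ ⟨h', h2'⟩ ((permBit_fin ⟨i, h1⟩ ⟨h, h2⟩).mp h3)
      ((permBit_fin ⟨i', h1'⟩ ⟨h', h2'⟩).mp h3') heq
    simpa using this
  · rintro ⟨i, h⟩ hl
    obtain ⟨h1, h2, h3⟩ := mem_lefts.mp hl
    simp only at h1 h2 h3
    simp only [h1, h2, and_self, dif_pos]
    have hK := (permBit_fin ⟨i, h1⟩ ⟨h, h2⟩).mp h3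
    by_cases hh : (⟨h, h2⟩ : Fin I.k) ∈ M.rounds ⟨i, h1⟩
    · rw [hfres _ _ hh]
      obtain ⟨j, hj, hj'⟩ := hres _ _ hh
      have hE := (edgeBit_fin ⟨i, h1⟩ j).mpr (M.edges_subset _ hj')
      have := j.2
      refine .inl ⟨by simp only; omega, rfl, h1, by simp only; omega, by simp only; omega, ?_⟩
      rw [← hj]
      simpa using hE
    · have hh' := Finset.mem_sdiff.mpr ⟨hK, hh⟩
      rw [hfdummy _ _ hh']
      exact .inr ⟨rfl, by simp only; omega, (hemb _ _).2⟩

/-- The `k`-round matching that is stored in a state. -/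
def toMatching {s : State Arr}
    (hs : MatchInv N (lefts I) (fullAdj N I D) {r | r.2 ∈ D r.1} s) : KRoundMatching I where
  edges h := Finset.univ.filter fun p => s.mem (.mate, p.1, h, I.n + p.2, h) = true
  edges_subset h p hp := by
    have : mateOf s (p.1, h) (I.n + p.2, h) := (Finset.mem_filter.mp hp).2
    exact mem_E_of_fullAdj (hs.inv.adj_of_mate this)
  agent_unique h i j j' hj hj' := by
    have h1 : mateOf s (i, h) (I.n + j, h) := (Finset.mem_filter.mp hj).2
    have h2 : mateOf s (i, h) (I.n + j', h) := (Finset.mem_filter.mp hj').2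
    have := congrArg Prod.fst (hs.inv.left_unique h1 h2)
    exact Fin.ext (by simpa using this)
  resource_unique h i i' j hj hj' := by
    have h1 : mateOf s (i, h) (I.n + j, h) := (Finset.mem_filter.mp hj).2
    have h2 : mateOf s (i', h) (I.n + j, h) := (Finset.mem_filter.mp hj').2
    have := congrArg Prod.fst (hs.inv.right_unique h1 h2)
    exact Fin.ext (by simpa using this)

theorem mem_rounds_toMatching {s : State Arr}
    (hs : MatchInv N (lefts I) (fullAdj N I D) {r | r.2 ∈ D r.1} s) (i : Fin I.n) (h : Fin I.k) :
    h ∈ (toMatching hs).rounds i ↔ ∃ j : Fin I.m, mateOf s (i, h) (I.n + j, h) := by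
  simp [KRoundMatching.rounds, toMatching, mateOf]

/-- If all the left vertices are matched, each agent `i` is matched to a resource in exactly `ρ i`
rounds, since all the right vertices that belong to it are matched in the other `|K i| - ρ i`
permissible rounds. -/
theorem toMatching_spec (hD : IsDummy I D) {s : State Arr}
    (hs : MatchInv N (lefts I) (fullAdj N I D) {r | r.2 ∈ D r.1} s)
    (hall : ∀ l ∈ lefts I, ∃ r, mateOf s l r) (i : Fin I.n) :
    (toMatching hs).Satisfies i ∧ (toMatching hs).rounds i ⊆ I.K i ∧
      ((toMatching hs).rounds i).card = I.ρ i := by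
  classical
  have hsub : (toMatching hs).rounds i ⊆ I.K i := by
    intro h hh
    obtain ⟨j, hj⟩ := (mem_rounds_toMatching hs i h).mp hh
    exact (permBit_fin i h).mp (mem_lefts.mp (hs.inv.mem_left hj)).2.2
  have hpartner : ∀ h, ∃ d : ℕ, h ∈ I.K i \ (toMatching hs).rounds i →
      d ∈ D i ∧ mateOf s (i, h) (i, d) := by
    intro h
    by_cases hh : h ∈ I.K i \ (toMatching hs).rounds i
    · rw [Finset.mem_sdiff] at hh
      obtain ⟨⟨r1, r2⟩, hr⟩ := hall (i, h) (mem_lefts.mpr ⟨i.2, h.2, (permBit_fin i h).mpr hh.1⟩)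
      rcases hs.inv.adj_of_mate hr with ha | ha
      · obtain ⟨-, h1, -, h2, h3, -⟩ := ha
        simp only at h1 h2 h3
        refine (hh.2 ((mem_rounds_toMatching hs i h).mpr ⟨⟨r1 - I.n, by omega⟩, ?_⟩)).elim
        rw [show I.n + (r1 - I.n) = r1 by omega]
        rw [h1] at hr
        exact hr
      · obtain ⟨h1, -, h2⟩ := ha
        simp only at h1 h2
        subst h1
        exact ⟨r2, fun _ => ⟨h2, hr⟩⟩
    · exact ⟨0, fun h' => (hh h').elim⟩
  choose g hg using hpartner
  have hcard : (I.K i \ (toMatching hs).rounds i).card = (D i).card := by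
    refine Finset.card_bij (fun h _ => g h) (fun h hh => (hg h hh).1) (fun h hh h' hh' heq => ?_)
      fun d hd => ?_
    · have h1 := (hg h hh).2
      rw [heq] at h1
      have := congrArg Prod.snd (hs.inv.right_unique h1 (hg h' hh').2)
      exact Fin.ext this
    · obtain ⟨⟨l1, l2⟩, hl⟩ := hs.inv.cover (i, d) hd
      obtain ⟨h1, h2, h3⟩ := mem_lefts.mp (hs.inv.mem_left hl)
      simp only at h1 h2 h3
      have hl1 : l1 = i := by
        rcases hs.inv.adj_of_mate hl with ha | ha
        · have h4 := ha.2.2.2.1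
          have := i.2
          simp only at h4
          omega
        · exact ha.1
      subst hl1
      have hmem : (⟨l2, h2⟩ : Fin I.k) ∈ I.K i \ (toMatching hs).rounds i := by
        refine Finset.mem_sdiff.mpr ⟨(permBit_fin i ⟨l2, h2⟩).mp h3, fun hh => ?_⟩
        obtain ⟨j, hj⟩ := (mem_rounds_toMatching hs i ⟨l2, h2⟩).mp hh
        have := congrArg Prod.fst (hs.inv.left_unique hl hj)
        have := i.2
        simp only at *
        omega
      exact ⟨⟨l2, h2⟩, hmem, congrArg Prod.snd (hs.inv.left_unique (hg _ hmem).2 hl)⟩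
  have hρ : ((toMatching hs).rounds i).card = I.ρ i := by
    have h1 := Finset.card_sdiff_add_card_eq_card hsub
    have h2 := hD i
    omega
  refine ⟨?_, hsub, hρ⟩
  rw [KRoundMatching.Satisfies, Finset.inter_eq_left.mpr hsub, hρ]

theorem encodeAnswer_toMatching {s : State Arr}
    (hs : MatchInv N (lefts I) (fullAdj N I D) {r | r.2 ∈ D r.1} s) :
    encodeAnswer (some (toMatching hs)) = true :: ((List.range I.k).map fun h =>
      ((List.range I.n).map fun i => ((List.range I.m).map fun j =>
        [s.mem (.mate, i, h, I.n + j, h)]).flatten).flatten).flatten := by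
  have hsingle : ∀ (l : List ℕ) (f : ℕ → Bool), (l.map fun j => [f j]).flatten = l.map f := by
    intro l f
    induction l with
    | nil => rfl
    | cons x l ih => simp [ih]
  simp only [hsingle]
  simp only [← ofFn_eq_map_range]
  simp [encodeAnswer, encodeMatrix, toMatching]

/-- The program finds a solution or establishes that there is none. -/
theorem exists_answer (I : MRMInstance) : ∃ A : Option (KRoundMatching I),
    (run I.encode.length program (fun _ => 0) ⟨fun _ => false, I.encode, []⟩).out =
      encodeAnswer A ∧
    (∀ M, A = some M → ∀ i, M.Satisfies i ∧ M.rounds i ⊆ I.K i ∧ (M.rounds i).card = I.ρ i) ∧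
    (A = none → ¬ ∃ M : KRoundMatching I, ∀ i, M.Satisfies i) := by
  obtain ⟨D, s, hD, hH, hout, hfail, hs, hset, hrun⟩ := run_matching_state I
  rw [hrun]
  have hlen := length_encode I
  set N := I.encode.length with hN
  have hcheck := run_checkAll (N := N) (env := fun _ => 0) rfl hfail
  change ∃ A, (run N writeAnswer (fun _ => 0) (run N checkAll (fun _ => 0) s)).out = _ ∧ _
  set s' := run N checkAll (fun _ => 0) s with hs'
  have hout' : s'.out = [] := (out_run_of_not_prints (by decide) _ _).trans hout
  have hH' : Header I.n I.m I.k s' :=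
    hH.run (by decide) (by decide) (by decide) (by decide) _
  have hmate' : ∀ k, s'.mem (.mate, k) = s.mem (.mate, k) := fun k =>
    mem_run_of_not_writes (by decide) _ _ k
  have hunmatched : ∀ l : ℕ × ℕ, (¬ ∃ r : ℕ × ℕ, r.1 < N ∧ r.2 < N ∧ mateOf s l r) ↔
      ¬ ∃ r, mateOf s l r := fun l => by
    refine not_congr (exists_congr fun r => ⟨fun h => h.2.2, fun h => ?_⟩)
    have := hs.lt_of_adj _ _ (hs.inv.adj_of_mate h)
    exact ⟨this.1, this.2, h⟩
  by_cases hf : failOf s'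
  · refine ⟨none, ?_, by simp, fun _ => ?_⟩
    · simp only [failOf] at hf
      simp [writeAnswer, run, key, hf, hout', encodeAnswer]
    · rintro ⟨M, hM⟩
      obtain ⟨l, -, -, hl, hl'⟩ := hcheck.mp hf
      rw [hunmatched] at hl'
      rw [hs.perm_iff] at hl
      obtain ⟨f, hf1, hf2⟩ := exists_complete_matching (N := N) hD (by omega) M hM
      have hcard : (lefts I).card < N := by
        have h1 : (lefts I).card ≤ I.n * I.k := by
          refine (Finset.card_filter_le _ _).trans ?_
          simp
        omega
      have hfull := (hset l hl).resolve_left hl'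
      rw [hs.adj_eq] at hfull
      exact hs.inv.not_exists_matching hcard hl (fun r hr => hl' ⟨r, hr⟩) hfull f hf1 hf2
  · refine ⟨some (toMatching hs), ?_, ?_, by simp⟩
    · rw [encodeAnswer_toMatching]
      have hrun' : run N writeAnswer (fun _ => 0) s' =
          run N writeMatchings (fun _ => 0) { s' with out := s'.out ++ [true] } := by
        simp only [failOf] at hf
        simp [writeAnswer, run, key, hf]
      have hw := run_writeMatchings (N := N) (env := fun _ => 0) rfl (n := I.n) (m := I.m)
        (k := I.k) (by omega) (s := { s' with out := s'.out ++ [true] })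
        ⟨hH'.agent, hH'.resource, hH'.round, hH'.zero⟩
      rw [hrun', hw]
      simp [hout', hmate']
    · rintro M hM
      obtain rfl := Option.some_injective _ hM
      refine toMatching_spec hD hs fun l hl => ?_
      by_contra hl'
      refine hf (hcheck.mpr ⟨l, (hs.lt_of_mem l hl).1, (hs.lt_of_mem l hl).2,
        (hs.perm_iff l).mpr hl, ?_⟩)
      rwa [hunmatched]

end MRM

theorem mainTheorem2 :
    ∃ A : (I : MRMInstance) → Option (KRoundMatching I),
      Nonempty (Turing.TM2ComputableInPolyTime MRMInstance.encode (id : List Bool → List Bool)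
        (fun I => encodeAnswer (A I))) ∧
      ∀ I : MRMInstance,
        (∀ M, A I = some M →
          ∀ i, M.Satisfies i ∧ M.rounds i ⊆ I.K i ∧ (M.rounds i).card = I.ρ i) ∧
        (A I = none → ¬ ∃ M : KRoundMatching I, ∀ i, M.Satisfies i) := by
  choose A hA using MRM.exists_answer
  refine ⟨A, ?_, fun I => (hA I).2⟩
  have henc : ∀ I : MRMInstance, I.encode ≠ [] := fun I h => by
    have := MRM.length_encode I
    rw [h, List.length_nil] at this
    omega
  have := ArrProg.polyTime MRM.program (by decide) MRMInstance.encode henc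
  simpa only [fun I => (hA I).1] using this
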